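/- Fix an integer $\Delta\ge 0$ and an integer $k\ge 1$. An LCL problem $\Pi=(\Sigma_{\mathrm{in}},\Sigma_{\mathrm{out}},C,r)$ consists of finite label sets $\Sigma_{\mathrm{in}},\Sigma_{\mathrm{out}}$, a constant radius $r\in\mathbb N$, and a set $C$ (understood up to isomorphism) of graphs $H$ with a distinguished centre, such that every node of $H$ is at distance at most $r$ from the centre and carries a label in $\Sigma_{\mathrm{in}}\times\Sigma_{\mathrm{out}}$. Given a graph $G=(V,E)$ and an input labelling $i\colon V\to\Sigma_{\mathrm{in}}$, an output labelling $o\colon V\to\Sigma_{\mathrm{out}}$ is valid if for every node $v$ the subgraph of $G$ induced by the nodes at distance at most $r$ from $v$, centred at $v$ and labelled by $(i,o)$, belongs to $C$. In the deterministic LOCAL model, the nodes of an $n$-node graph carry distinct identifiers from $\{1,\dots,n^k\}$. An algorithm running in $t(n)$ rounds is an arbitrary function that computes the output of each node $v$ from $n$ and from the $t(n)$-radius neighbourhood of $v$, i.e. from all nodes at distance at most $t(n)$ from $v$, with their identifiers, degrees and input labels, and all edges incident to a node at distance at most $t(n)-1$ from $v$. We say that $\Pi$ is solvable in $t(n)$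 rounds on trees of maximum degree at most $\Delta$ if there is such an algorithm whose output is valid on every $n$-node tree of maximum degree at most $\Delta$, for every $n$, every assignment of identifiers and every input labelling. The complexity of $\Pi$ on these trees is the pointwise smallest $t\colon\mathbb N\to\mathbb N$ such that $\Pi$ is solvable in $t(n)$ rounds on them. Then for every LCL problem $\Pi$ the following hold. 1. If $\Pi$ is solvable in $t(n)$ rounds on trees of maximum degree at most $\Delta$ for some $t(n)=o(n)$, then $\Pi$ is solvable in $s(n)$ rounds on trees of maximum degree at most $\Delta$ for some $s(n)=O(\sqrt n)$. 2. Consequently, the complexity of $\Pi$ on trees of maximum degree at most $\Delta$ is never a function that is both $\omega(\sqrt n)$ and $o(n)$. -/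

import Mathlib

open Filter Asymptotics

/-- A graph centred at one of its nodes, every node carrying an input label and an output label. -/
structure CenteredGraph (I O : Type*) where
  V : Type
  graph : SimpleGraph V
  center : V
  inp : V → I
  out : V → O

/-- Two centred labelled graphs are the same up to renaming their nodes. -/
def CenteredGraph.Isomorphic {I O : Type*} (H K : CenteredGraph I O) : Prop :=
  ∃ e : H.graph ≃g K.graph, e H.center = K.center ∧
    (∀ u, K.inp (e u) = H.inp u) ∧ (∀ u, K.out (e u) = H.out u)

/-- The ball `B(v)`: the subgraph induced by the nodes at distance at most `r` from `v`,
together with the input and output labels of these nodes. -/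
def labelledBall {I O : Type*} {V : Type} (G : SimpleGraph V) (inp : V → I) (out : V → O)
    (r : ℕ) (v : V) : CenteredGraph I O where
  V := {u : V | G.edist v u ≤ (r : ℕ∞)}
  graph := G.induce {u : V | G.edist v u ≤ (r : ℕ∞)}
  center := ⟨v, by simp⟩
  inp := fun u => inp u.1
  out := fun u => out u.1

/-- A locally checkable labelling problem with input labels `I` and output labels `O`
(both are finite wherever a problem is considered): a checkability radius `r` and a set `C`
of centred labelled graphs of radius at most `r`. -/
structure LCL (I O : Type*) where
  r : ℕ
  C : Set (CenteredGraph I O)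
  radius_le : ∀ H ∈ C, ∀ u : H.V, H.graph.edist H.center u ≤ (r : ℕ∞)

/-- `(G, inp, out)` is a valid configuration: every ball `B(v)` is, up to isomorphism, in `C`. -/
def LCL.IsValid {I O : Type*} (P : LCL I O) {V : Type} (G : SimpleGraph V)
    (inp : V → I) (out : V → O) : Prop :=
  ∀ v : V, ∃ H ∈ P.C, (labelledBall G inp out P.r v).Isomorphic H

/-- What a node of a network can know about its neighbourhood. As identifiers are unique, nodes
are represented by their identifiers: `nodes` lists triples (identifier, degree, input label),
and `edges` lists pairs of identifiers. -/
structure View (I : Type*) where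
  center : ℕ
  nodes : Set (ℕ × ℕ × I)
  edges : Set (ℕ × ℕ)

/-- The `t`-radius neighbourhood of `v`, that is, all that `v` can learn in `t` rounds of
communication: all nodes at distance at most `t` from `v`, with their initial knowledge
(identifier, degree, input), and all edges incident to a node at distance at most `t - 1`. -/
def localView {I : Type*} {V : Type} (G : SimpleGraph V) (ident : V → ℕ) (inp : V → I)
    (t : ℕ) (v : V) : View I where
  center := ident v
  nodes := {x | ∃ u : V, G.edist v u ≤ (t : ℕ∞) ∧
    x = (ident u, (G.neighborSet u).ncard, inp u)}
  edges := {x | ∃ u w : V, G.Adj u w ∧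
    (G.edist v u < (t : ℕ∞) ∨ G.edist v w < (t : ℕ∞)) ∧ x = (ident u, ident w)}

/-- A deterministic algorithm in the LOCAL model: from the number `n` of nodes of the network and
from what it has gathered about its neighbourhood, a node computes its output label. No bound on
the message size and on the computational power of a node is imposed. -/
def LocalAlgorithm (I O : Type*) := ℕ → View I → O

/-- A family of graphs. -/
def GraphFamily := ∀ V : Type, SimpleGraph V → Prop

/-- The trees of maximum degree at most `Δ`. -/
def treesOfDegreeAtMost (Δ : ℕ) : GraphFamily :=
  fun V G => G.IsTree ∧ ∀ v : V, (G.neighborSet v).encard ≤ (Δ : ℕ∞)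

/-- `ident` assigns unique identifiers of `O(log n)` bits, namely from `{1, …, n ^ k}`, to the
nodes of a network with `n` nodes. -/
def IsIdentAssignment (k : ℕ) {V : Type} [Fintype V] (ident : V → ℕ) : Prop :=
  Function.Injective ident ∧ ∀ v, 1 ≤ ident v ∧ ident v ≤ Fintype.card V ^ k

/-- The algorithm `A` solves the problem `P` in `t n` rounds on every `n`-node graph of the family,
for every `n`, every assignment of identifiers from `{1, …, n ^ k}` and every input labelling. -/
def LCL.SolvedBy {I O : Type*} (P : LCL I O) (F : GraphFamily) (k : ℕ)
    (A : LocalAlgorithm I O) (t : ℕ → ℕ) : Prop :=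
  ∀ (V : Type) [Fintype V] (G : SimpleGraph V), F V G →
    ∀ ident : V → ℕ, IsIdentAssignment k ident → ∀ inp : V → I,
      P.IsValid G inp
        (fun v => A (Fintype.card V) (localView G ident inp (t (Fintype.card V)) v))

/-- Some deterministic LOCAL algorithm solves `P` in `t n` rounds on the `n`-node graphs of the
family. -/
def LCL.SolvableIn {I O : Type*} (P : LCL I O) (F : GraphFamily) (k : ℕ) (t : ℕ → ℕ) : Prop :=
  ∃ A : LocalAlgorithm I O, P.SolvedBy F k A t

/-- `t` is the distributed time complexity of `P` in the family: the pointwise smallest function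
such that `P` can be solved in `t n` rounds. -/
def LCL.HasComplexity {I O : Type*} (P : LCL I O) (F : GraphFamily) (k : ℕ) (t : ℕ → ℕ) : Prop :=
  IsLeast {s : ℕ → ℕ | P.SolvableIn F k s} t

/-!
A fast algorithm cannot be run on a tree with `n` nodes as if the tree had `N ≫ n` nodes: the rest
of the tree is missing, and the promise on `N` could be noticed. The proof makes such a run
possible on auxiliary trees with exactly `N` nodes that are built from small parts of the given
tree, and transfers the labels found there back. It needs only `O(√n)` rounds.

*Gluing.* The constraint of radius `r` is turned into a constraint on the labels around a single
node. Every half-edge `(u, v)` carries a message: the isomorphism type of the labelled tree of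
depth less than `r` that hangs at `u` away from `v` (`msgLabel`). `NodeOK` says that the labels
around a node occur around a correctly labelled node of some tree. True messages of a valid
labelling satisfy it (`nodeOK_of_isValid`), and conversely labels that satisfy it everywhere in a
tree are the true messages and certify validity (`isValid_of_nodeOK`). There are finitely many
messages, and solutions on the parts of a tree fit together as soon as they agree on the edges
between the parts (`exists_nodeOK_of_parts`).

*Cutting.* Let `τ ≈ √n`. Branches of height less than `τ` are pruned, which leaves the `Core`; the
pruned trees are recovered as `hang`. Where the core looks like a long path (`IsChain`), a ruling
set is computed from the `O(√n)` binary digits of the identifiers (`Ruling`), and the edge next to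
each of its nodes is cut. The components that remain have diameter `O(√n)`: a path in a component
that is longer has, in every stretch of constant length far from its ends, a node with a third
neighbour in the core, hence a branch with more than `τ` nodes; these branches are disjoint and
there are at most `√n` of them (`length_lt_of_nonBacktracking_cutGraph`).

*Labels of the cut edges.* Near a cut edge, on either side, there are `h` consecutive core nodes of
core degree two, with the trees hanging off them. Each of these blocks defines a relation between
the labels of the two core edges at its root (`BlockRel`). Since `h` is at least the number of
relations, the sequence of blocks can be pumped to a longer one with the same composed relation
(`exists_pump`). The pumped sequences of the two sides form a strip that is so long that the
algorithm, run as on a tree with `N` nodes, does not see the ends of the strip from its middle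
edge. The labels it computes around the middle edge become those of the cut edge (`cutLabel`).

*Completing a component.* Replace the blocks next to the cut edges of a component by the whole
strips, and lengthen one of them by padding nodes until there are exactly `N` nodes (`network`,
`isTree_network`, `exists_network`). This is where `t N = o(N)` is needed: the length of the strips
grows with `t N`, and the network without padding still has at most `N` nodes. The algorithm is
correct on this tree, and on the middle edges of the strips its output has the prescribed labels
(`msgLabel_network`). By the choice of the pumped sequences, the half strips can be exchanged for
the original blocks (`exists_solution_of_arm`). So each component has a solution with the
prescribed labels on the cut edges.

*Locality.* All of this depends on the neighbourhood of radius `O(√n)` only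
(`Agree.pieceSolution_eq`), so a node can evaluate it in any graph that accounts for its view; fixed
choices make the nodes of a component agree on the solution (`isValid_gapOutput`,
`solvableIn_sqrt`). The statement about the complexity follows, since a least running time `t` is at
most the running time `O(√n)` found in this way.
-/

namespace TreeGap

/-! ### Distances, non-backtracking walks and trees -/

section Graph

variable {V V' : Type*} {G : SimpleGraph V} {G' : SimpleGraph V'}

theorem edist_lt_natCast_succ_iff {u v : V} {m : ℕ} :
    G.edist v u < ((m + 1 : ℕ) : ℕ∞) ↔ G.edist v u ≤ (m : ℕ∞) := by
  rw [Nat.cast_add, Nat.cast_one]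
  exact ENat.lt_natCast_add_one_iff

theorem edist_le_of_adj {u v w : V} {m : ℕ} (h : G.edist v u ≤ (m : ℕ∞)) (ha : G.Adj u w) :
    G.edist v w ≤ ((m + 1 : ℕ) : ℕ∞) := by
  calc G.edist v w ≤ G.edist v u + G.edist u w := SimpleGraph.edist_triangle
    _ ≤ (m : ℕ∞) + 1 := by
        gcongr
        exact (SimpleGraph.edist_eq_one_iff_adj.2 ha).le
    _ = ((m + 1 : ℕ) : ℕ∞) := by push_cast; rfl

theorem edist_le_add {u v w : V} {m l : ℕ} (h : G.edist v u ≤ (m : ℕ∞))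
    (h' : G.edist u w ≤ (l : ℕ∞)) : G.edist v w ≤ ((m + l : ℕ) : ℕ∞) := by
  calc G.edist v w ≤ G.edist v u + G.edist u w := SimpleGraph.edist_triangle
    _ ≤ (m : ℕ∞) + l := by gcongr
    _ = ((m + l : ℕ) : ℕ∞) := by push_cast; rfl

theorem edist_le_mono {u v : V} {m l : ℕ} (h : G.edist v u ≤ (m : ℕ∞)) (hml : m ≤ l) :
    G.edist v u ≤ (l : ℕ∞) := h.trans (by exact_mod_cast hml)

theorem edist_le_zero_iff {u v : V} : G.edist v u ≤ ((0 : ℕ) : ℕ∞) ↔ u = v := by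
  rw [Nat.cast_zero, nonpos_iff_eq_zero, SimpleGraph.edist_eq_zero_iff, eq_comm]

theorem edist_le_succ_iff {u v : V} {m : ℕ} :
    G.edist v u ≤ ((m + 1 : ℕ) : ℕ∞) ↔
      u = v ∨ ∃ y, G.edist v y ≤ (m : ℕ∞) ∧ G.Adj y u := by
  constructor
  · intro h
    have hne : G.edist v u ≠ ⊤ := by
      intro ht; rw [ht] at h; simp at h
    obtain ⟨p, hp⟩ := SimpleGraph.exists_walk_of_edist_ne_top hne
    rw [← hp] at h
    rcases Nat.eq_zero_or_pos p.length with h0 | h0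
    · left; exact (SimpleGraph.Walk.eq_of_length_eq_zero h0).symm
    · right
      have hnn : ¬ p.Nil := by
        intro hn; rw [← SimpleGraph.Walk.length_eq_zero_iff] at hn; omega
      refine ⟨p.penultimate, ?_, p.adj_penultimate hnn⟩
      refine (SimpleGraph.edist_le p.dropLast).trans ?_
      have h1 : p.length ≤ m + 1 := by exact_mod_cast h
      have h2 : p.dropLast.length + 1 = p.length := by
        simp [SimpleGraph.Walk.length_dropLast]; omega
      exact_mod_cast (by omega : p.dropLast.length ≤ m)
  · rintro (rfl | ⟨y, hy, ha⟩)
    · simp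
    · exact edist_le_of_adj hy ha

/-- In a forest, a node has at most one neighbour that is not farther from a given root. -/
theorem eq_of_adj_of_dist_le (hG : G.IsAcyclic) {r x y y' : V} (hr : G.Reachable r x)
    (hy : G.Adj x y) (hy' : G.Adj x y') (h : G.dist r y ≤ G.dist r x)
    (h' : G.dist r y' ≤ G.dist r x) : y = y' := by
  classical
  have key : ∀ z, G.Adj x z → G.dist r z ≤ G.dist r x →
      ∃ p : G.Walk r z, p.IsPath ∧ x ∉ p.support := by
    intro z hz hd
    obtain ⟨p, hp, hl⟩ := (hr.trans hz.reachable).exists_path_of_dist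
    refine ⟨p, hp, fun hx => ?_⟩
    have h1 := SimpleGraph.dist_le (p.takeUntil x hx)
    have h2 := SimpleGraph.Walk.length_takeUntil_lt_length hx hz.ne
    omega
  obtain ⟨p, hp, hxp⟩ := key y hy h
  obtain ⟨q, hq, hxq⟩ := key y' hy' h'
  have e := (hG.subsingleton_path _ _).elim ⟨p.concat hy.symm, hp.concat hxp hy.symm⟩
    ⟨q.concat hy'.symm, hq.concat hxq hy'.symm⟩
  have e' := congrArg (fun w : G.Path r x => w.1.penultimate) e
  simpa using e'

theorem exists_adj_dist_lt {r x : V} (hr : G.Reachable r x) (hne : x ≠ r) :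
    ∃ y, G.Adj x y ∧ G.dist r y < G.dist r x := by
  obtain ⟨p, hl⟩ := hr.exists_walk_length_eq_dist
  have hnn : ¬ p.Nil := fun hn => hne hn.eq.symm
  refine ⟨p.penultimate, (p.adj_penultimate hnn).symm, ?_⟩
  have h1 := SimpleGraph.dist_le p.dropLast
  have h2 : p.dropLast.length + 1 = p.length := by
    have : p.length ≠ 0 := fun h => hnn (SimpleGraph.Walk.length_eq_zero_iff.1 h)
    simp [SimpleGraph.Walk.length_dropLast]; omega
  omega

/-- `s 0, …, s m` is a walk that never turns back along the edge it has just used. -/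
def NonBacktracking (G : SimpleGraph V) (s : ℕ → V) (m : ℕ) : Prop :=
  (∀ i < m, G.Adj (s i) (s (i + 1))) ∧ ∀ i, i + 2 ≤ m → s i ≠ s (i + 2)

theorem NonBacktracking.mono {s : ℕ → V} {m l : ℕ} (h : NonBacktracking G s m) (hl : l ≤ m) :
    NonBacktracking G s l :=
  ⟨fun i hi => h.1 i (by omega), fun i hi => h.2 i (by omega)⟩

theorem NonBacktracking.shift {s : ℕ → V} {m l k : ℕ} (h : NonBacktracking G s m)
    (hl : l + k ≤ m) : NonBacktracking G (fun i => s (i + k)) l := by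
  refine ⟨fun i hi => ?_, fun i hi => ?_⟩
  · have := h.1 (i + k) (by omega)
    rwa [show i + k + 1 = i + 1 + k by omega] at this
  · have := h.2 (i + k) (by omega)
    rwa [show i + k + 2 = i + 2 + k by omega] at this

theorem NonBacktracking.rev {s : ℕ → V} {m l : ℕ} (h : NonBacktracking G s m) (hl : l ≤ m) :
    NonBacktracking G (fun i => s (m - i)) l := by
  refine ⟨fun i hi => ?_, fun i hi => ?_⟩
  · have := (h.1 (m - (i + 1)) (by omega)).symm
    rwa [show m - (i + 1) + 1 = m - i by omega] at this
  · have := (h.2 (m - (i + 2)) (by omega)).symm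
    rwa [show m - (i + 2) + 2 = m - i by omega] at this

/-- Two non-backtracking walks, the first step of the second differing from the first step of the
reversed first one, can be joined. -/
theorem NonBacktracking.append {s t : ℕ → V} {m l : ℕ} (hs : NonBacktracking G s m)
    (ht : NonBacktracking G t l) (h0 : t 0 = s m) (h1 : 0 < m → 0 < l → s (m - 1) ≠ t 1) :
    NonBacktracking G (fun i => if i ≤ m then s i else t (i - m)) (m + l) := by
  refine ⟨fun i hi => ?_, fun i hi => ?_⟩
  · dsimp only
    rcases lt_trichotomy i m with h | h | h
    · rw [if_pos h.le, if_pos (by omega)]; exact hs.1 i h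
    · subst h
      rw [if_pos le_rfl, if_neg (by omega), ← h0, show i + 1 - i = 0 + 1 by omega]
      exact ht.1 0 (by omega)
    · rw [if_neg (by omega), if_neg (by omega), show i + 1 - m = i - m + 1 by omega]
      exact ht.1 _ (by omega)
  · dsimp only
    rcases lt_trichotomy (i + 1) m with h | h | h
    · rw [if_pos (by omega), if_pos (by omega)]; exact hs.2 i (by omega)
    · rw [if_pos (by omega), if_neg (by omega), show i = m - 1 by omega,
        show m - 1 + 2 - m = 1 by omega]
      exact h1 (by omega) (by omega)
    · rcases eq_or_ne i m with h' | h'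
      · subst h'
        rw [if_pos le_rfl, if_neg (by omega), ← h0, show i + 2 - i = 0 + 2 by omega]
        exact ht.2 0 (by omega)
      · rw [if_neg (by omega), if_neg (by omega), show i + 2 - m = i - m + 2 by omega]
        exact ht.2 _ (by omega)

theorem NonBacktracking.reachable {s : ℕ → V} {m : ℕ} (h : NonBacktracking G s m) :
    ∀ i ≤ m, G.Reachable (s 0) (s i) := by
  intro i
  induction i with
  | zero => intro _; exact SimpleGraph.Reachable.refl _
  | succ i ih => intro hi; exact (ih (by omega)).trans (h.1 i (by omega)).reachable

theorem NonBacktracking.edist_le {s : ℕ → V} {m : ℕ} (h : NonBacktracking G s m) :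
    ∀ i ≤ m, G.edist (s 0) (s i) ≤ (i : ℕ∞) := by
  intro i
  induction i with
  | zero => intro _; simp
  | succ i ih => intro hi; exact edist_le_of_adj (ih (by omega)) (h.1 i (by omega))

/-- In a forest, non-backtracking walks are geodesics. -/
theorem NonBacktracking.dist_eq (hG : G.IsAcyclic) {s : ℕ → V} {m : ℕ}
    (h : NonBacktracking G s m) : ∀ i ≤ m, G.dist (s 0) (s i) = i := by
  have key : ∀ i, i + 1 ≤ m → G.dist (s 0) (s i) = i ∧ G.dist (s 0) (s (i + 1)) = i + 1 := by
    intro i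
    induction i with
    | zero =>
      intro hi
      exact ⟨by simp, SimpleGraph.dist_eq_one_iff_adj.2 (h.1 0 (by omega))⟩
    | succ i ih =>
      intro hi
      obtain ⟨h1, h2⟩ := ih (by omega)
      refine ⟨h2, ?_⟩
      have ha := h.1 (i + 1) (by omega)
      have hr := h.reachable (i + 1) (by omega)
      rcases ha.diff_dist_adj (u := s 0) with h3 | h3 | h3
      · exact absurd (eq_of_adj_of_dist_le hG hr (h.1 i (by omega)).symm ha (by omega) h3.le)
          (h.2 i (by omega))
      · omega
      · exact absurd (eq_of_adj_of_dist_le hG hr (h.1 i (by omega)).symm ha (by omega) (by omega))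
          (h.2 i (by omega))
  intro i hi
  cases i with
  | zero => simp
  | succ i => exact (key i hi).2

theorem NonBacktracking.injOn (hG : G.IsAcyclic) {s : ℕ → V} {m : ℕ}
    (h : NonBacktracking G s m) {i j : ℕ} (hi : i ≤ m) (hj : j ≤ m) (hij : s i = s j) : i = j := by
  rw [← h.dist_eq hG i hi, ← h.dist_eq hG j hj, hij]

/-- In a forest, a non-backtracking walk is determined by its two ends. -/
theorem NonBacktracking.unique (hG : G.IsAcyclic) {s t : ℕ → V} {m l : ℕ}
    (hs : NonBacktracking G s m) (ht : NonBacktracking G t l) (h0 : s 0 = t 0) (h1 : s m = t l) :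
    m = l ∧ ∀ i ≤ m, s i = t i := by
  have hml : m = l := by
    rw [← hs.dist_eq hG m le_rfl, ← ht.dist_eq hG l le_rfl, h0, h1]
  subst hml
  refine ⟨rfl, ?_⟩
  have key : ∀ j ≤ m, s (m - j) = t (m - j) := by
    intro j
    induction j with
    | zero => intro _; exact h1
    | succ j ih =>
      intro hj
      have e := ih (by omega)
      have hr := hs.reachable (m - j) (by omega)
      have a1 := (hs.1 (m - (j + 1)) (by omega)).symm
      have a2 := (ht.1 (m - (j + 1)) (by omega)).symm
      rw [show m - (j + 1) + 1 = m - j by omega] at a1 a2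
      rw [← e] at a2
      refine eq_of_adj_of_dist_le hG hr a1 a2 ?_ ?_
      · rw [hs.dist_eq hG _ (by omega), hs.dist_eq hG _ (by omega)]; omega
      · rw [hs.dist_eq hG _ (by omega), h0, ht.dist_eq hG _ (by omega)]; omega
  intro i hi
  have := key (m - i) (by omega)
  rwa [show m - (m - i) = i by omega] at this

/-- A shortest path, as a non-backtracking walk. -/
theorem exists_nonBacktracking {u v : V} (h : G.Reachable u v) :
    ∃ s : ℕ → V, s 0 = u ∧ s (G.dist u v) = v ∧ NonBacktracking G s (G.dist u v) := by
  obtain ⟨p, hp, hl⟩ := h.exists_path_of_dist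
  refine ⟨p.getVert, p.getVert_zero, by rw [← hl]; exact p.getVert_length,
    fun i hi => p.adj_getVert_succ (by omega), fun i hi e => ?_⟩
  have := hp.getVert_injOn (by simp; omega) (by simp; omega) e
  omega

/-- A graph is acyclic as soon as its nodes can be ranked such that no node has two distinct
neighbours of rank at most its own. -/
theorem isAcyclic_of_rank {α : Type*} [LinearOrder α] (rk : V → α)
    (h : ∀ x y y', G.Adj x y → G.Adj x y' → rk y ≤ rk x → rk y' ≤ rk x → y = y') :
    G.IsAcyclic := by
  classical
  intro v c hc
  have hne : c.support.toFinset.Nonempty := ⟨v, by simp⟩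
  obtain ⟨x, hx, hmax⟩ := Finset.exists_max_image c.support.toFinset rk hne
  have hx' : x ∈ c.support := by simpa using hx
  have hc' : (c.rotate x hx').IsCycle := SimpleGraph.Walk.IsCycle.rotate hx' hc
  have hmem : ∀ y ∈ (c.rotate x hx').support, rk y ≤ rk x := by
    intro y hy
    refine hmax y ?_
    rw [List.mem_toFinset]
    exact (SimpleGraph.Walk.mem_support_rotate_iff c x hx').1 hy
  refine hc'.snd_ne_penultimate (h x _ _ ?_ ?_ ?_ ?_)
  · exact (c.rotate x hx').adj_snd hc'.not_nil
  · exact ((c.rotate x hx').adj_penultimate hc'.not_nil).symm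
  · exact hmem _ (SimpleGraph.Walk.getVert_mem_support _ _)
  · exact hmem _ (SimpleGraph.Walk.getVert_mem_support _ _)

/-- A graph ranked as in `isAcyclic_of_rank` is a tree if every node but one has a neighbour of
smaller rank. -/
theorem isTree_of_rank {α : Type*} [LinearOrder α] [WellFoundedLT α] (rk : V → α) (r : V)
    (h : ∀ x y y', G.Adj x y → G.Adj x y' → rk y ≤ rk x → rk y' ≤ rk x → y = y')
    (h' : ∀ x, x ≠ r → ∃ y, G.Adj x y ∧ rk y < rk x) : G.IsTree := by
  have hr : ∀ x, G.Reachable r x := by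
    intro x
    induction hx : rk x using WellFoundedLT.induction generalizing x with
    | ind a ih =>
      by_cases hxr : x = r
      · rw [hxr]
      · obtain ⟨y, hy, hlt⟩ := h' x hxr
        exact (ih (rk y) (hx ▸ hlt) y rfl).trans hy.symm.reachable
  have : Nonempty V := ⟨r⟩
  exact ⟨⟨fun x y => (hr x).symm.trans (hr y)⟩, isAcyclic_of_rank rk h⟩

end Graph

/-! ### Maps that are bijective on neighbourhoods -/

section Covering

variable {V V' : Type*} {G : SimpleGraph V} {G' : SimpleGraph V'} {φ : V → V'}

/-- The image of a ball under a map that is a bijection on the neighbourhoods of its inner nodes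
is a ball. -/
theorem edist_image_iff {v : V} {t : ℕ}
    (hφ : ∀ u, G.edist v u < (t : ℕ∞) →
      Set.BijOn φ (G.neighborSet u) (G'.neighborSet (φ u))) :
    ∀ m ≤ t, ∀ u', G'.edist (φ v) u' ≤ (m : ℕ∞) ↔
      ∃ u, G.edist v u ≤ (m : ℕ∞) ∧ φ u = u' := by
  intro m
  induction m with
  | zero =>
    intro _ u'
    simp only [edist_le_zero_iff]
    constructor
    · rintro rfl; exact ⟨v, rfl, rfl⟩
    · rintro ⟨u, rfl, rfl⟩; rfl
  | succ m ih =>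
    intro hm u'
    have hlt : ∀ {y}, G.edist v y ≤ (m : ℕ∞) → G.edist v y < (t : ℕ∞) := fun hy =>
      lt_of_le_of_lt hy (by exact_mod_cast hm)
    constructor
    · intro h
      rcases edist_le_succ_iff.1 h with rfl | ⟨y', hy', ha⟩
      · exact ⟨v, by simp, rfl⟩
      · obtain ⟨y, hy, rfl⟩ := (ih (by omega) y').1 hy'
        obtain ⟨w, hw, rfl⟩ := (hφ y (hlt hy)).surjOn ha
        exact ⟨w, edist_le_of_adj hy hw, rfl⟩
    · rintro ⟨u, hu, rfl⟩
      rcases edist_le_succ_iff.1 hu with rfl | ⟨y, hy, ha⟩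
      · simp
      · exact edist_le_of_adj ((ih (by omega) _).2 ⟨y, hy, rfl⟩) ((hφ y (hlt hy)).mapsTo ha)

/-- A node sees the same in two networks if its neighbourhood in the first one is mapped to that
in the second one by a map that is a bijection on the neighbourhoods of nodes. -/
theorem localView_eq_of_bijOn {I : Type*} {V V' : Type} {G : SimpleGraph V} {G' : SimpleGraph V'}
    {φ : V → V'} {ident : V → ℕ} {ident' : V' → ℕ} {inp : V → I} {inp' : V' → I} {v : V} {t : ℕ}
    (hφ : ∀ u, G.edist v u ≤ (t : ℕ∞) →
      Set.BijOn φ (G.neighborSet u) (G'.neighborSet (φ u)) ∧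
      ident' (φ u) = ident u ∧ inp' (φ u) = inp u) :
    localView G' ident' inp' t (φ v) = localView G ident inp t v := by
  have hb := edist_image_iff (G := G) (G' := G') (φ := φ) (v := v) (t := t)
    (fun u hu => (hφ u hu.le).1)
  have hlt : ∀ u', G'.edist (φ v) u' < (t : ℕ∞) ↔ ∃ u, G.edist v u < (t : ℕ∞) ∧ φ u = u' := by
    intro u'
    cases t with
    | zero => simp
    | succ t => simp only [edist_lt_natCast_succ_iff]; exact hb t (by omega) u'
  have hnear : ∀ {u w}, G.edist v u < (t : ℕ∞) → G.Adj u w → G.edist v w ≤ (t : ℕ∞) := by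
    intro u w hu ha
    cases t with
    | zero => simp at hu
    | succ t => exact edist_le_of_adj (edist_lt_natCast_succ_iff.1 hu) ha
  unfold localView
  congr 1
  · exact (hφ v (by simp)).2.1
  · ext x
    simp only [Set.mem_ofPred_eq]
    constructor
    · rintro ⟨u', hu', rfl⟩
      obtain ⟨u, hu, rfl⟩ := (hb t le_rfl u').1 hu'
      obtain ⟨h1, h2, h3⟩ := hφ u hu
      refine ⟨u, hu, ?_⟩
      rw [h2, h3, ← h1.image_eq, h1.injOn.ncard_image]
    · rintro ⟨u, hu, rfl⟩
      obtain ⟨h1, h2, h3⟩ := hφ u hu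
      refine ⟨φ u, (hb t le_rfl _).2 ⟨u, hu, rfl⟩, ?_⟩
      rw [h2, h3, ← h1.image_eq, h1.injOn.ncard_image]
  · have hE : ∀ x : ℕ × ℕ, (∃ u w, G'.Adj u w ∧ G'.edist (φ v) u < (t : ℕ∞) ∧
          x = (ident' u, ident' w)) ↔
        ∃ u w, G.Adj u w ∧ G.edist v u < (t : ℕ∞) ∧ x = (ident u, ident w) := by
      intro x
      constructor
      · rintro ⟨u', w', ha, hu', rfl⟩
        obtain ⟨u, hu, rfl⟩ := (hlt u').1 hu'
        obtain ⟨w, hw, rfl⟩ := (hφ u hu.le).1.surjOn ha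
        refine ⟨u, w, hw, hu, ?_⟩
        rw [(hφ u hu.le).2.1, (hφ w (hnear hu hw)).2.1]
      · rintro ⟨u, w, ha, hu, rfl⟩
        refine ⟨φ u, φ w, (hφ u hu.le).1.mapsTo ha, (hlt _).2 ⟨u, hu, rfl⟩, ?_⟩
        rw [(hφ u hu.le).2.1, (hφ w (hnear hu ha)).2.1]
    have hsym : ∀ {W : Type} (H : SimpleGraph W) (idW : W → ℕ) (c : W) (x : ℕ × ℕ),
        (∃ u w, H.Adj u w ∧ (H.edist c u < (t : ℕ∞) ∨ H.edist c w < (t : ℕ∞)) ∧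
          x = (idW u, idW w)) ↔
        (∃ u w, H.Adj u w ∧ H.edist c u < (t : ℕ∞) ∧ x = (idW u, idW w)) ∨
        (∃ u w, H.Adj u w ∧ H.edist c u < (t : ℕ∞) ∧ x.swap = (idW u, idW w)) := by
      intro W H idW c x
      constructor
      · rintro ⟨u, w, ha, h | h, rfl⟩
        · exact Or.inl ⟨u, w, ha, h, rfl⟩
        · exact Or.inr ⟨w, u, ha.symm, h, rfl⟩
      · rintro (⟨u, w, ha, h, rfl⟩ | ⟨u, w, ha, h, hx⟩)
        · exact ⟨u, w, ha, Or.inl h, rfl⟩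
        · exact ⟨w, u, ha.symm, Or.inr h, by rw [← Prod.swap_swap x, hx]; rfl⟩
    ext x
    simp only [Set.mem_ofPred_eq]
    rw [hsym G' ident' (φ v) x, hsym G ident v x, hE x, hE x.swap]

end Covering

/-! ### Encoding a radius-`r` constraint by labels on half-edges -/

/-- A rooted tree of depth at most `d` with node labels in `L` and at most `Δ` children per node,
up to isomorphism: the label of the root, and for every type of depth `d - 1` the number of
children of that type. -/
def Code (Δ : ℕ) (L : Type*) : ℕ → Type _
  | 0 => L
  | d + 1 => L × (Code Δ L d → Fin (Δ + 1))

instance Code.finite (Δ : ℕ) (L : Type*) [Finite L] : ∀ d, Finite (Code Δ L d)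
  | 0 => inferInstanceAs (Finite L)
  | d + 1 =>
    have := Code.finite Δ L d
    inferInstanceAs (Finite (L × (Code Δ L d → Fin (Δ + 1))))

section Msg

variable {L V V' : Type*} {Δ : ℕ}

/-- What `u` can tell about its depth-`d` neighbourhood to its neighbour `e`: the code of the part
of the ball of radius `d` around `u` that is not reached through `e`. With `e = u` nothing is
excluded. -/
noncomputable def msg (Δ : ℕ) (G : SimpleGraph V) (lab : V → L) :
    (d : ℕ) → V → V → Code Δ L d
  | 0, u, _ => lab u
  | d + 1, u, e =>
    (lab u, fun c => Fin.ofNat (Δ + 1) {w | G.Adj u w ∧ w ≠ e ∧ msg Δ G lab d w u = c}.ncard)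

/-- The label of a half-edge: the messages of all depths below `r`. -/
abbrev EdgeLabel (Δ : ℕ) (L : Type*) (r : ℕ) := ∀ d : Fin r, Code Δ L d

/-- The half-edge labelling that the messages define. -/
noncomputable def msgLabel (Δ : ℕ) (G : SimpleGraph V) (lab : V → L) (r : ℕ) (u v : V) :
    EdgeLabel Δ L r := fun d => msg Δ G lab d u v

/-- How often each pair of labels occurs on the edges at `v`, as (label of the half-edge leaving
`v`, label of the half-edge entering `v`). -/
noncomputable def edgeCount {M : Type*} (G : SimpleGraph V) (x : V → V → M) (v : V) : M × M → ℕ :=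
  fun p => {u | G.Adj v u ∧ (x v u, x u v) = p}.ncard

theorem edgeCount_eq_of_bijOn {M : Type*} {G : SimpleGraph V} {G' : SimpleGraph V'}
    {x : V → V → M} {x' : V' → V' → M} {φ : V → V'} {v : V} {v' : V'}
    (h : Set.BijOn φ (G.neighborSet v) (G'.neighborSet v'))
    (hx : ∀ u, G.Adj v u → x' v' (φ u) = x v u ∧ x' (φ u) v' = x u v) :
    edgeCount G' x' v' = edgeCount G x v := by
  funext p
  unfold edgeCount
  have : {u | G'.Adj v' u ∧ (x' v' u, x' u v') = p} =
      φ '' {u | G.Adj v u ∧ (x v u, x u v) = p} := by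
    ext u'
    constructor
    · rintro ⟨ha, hp⟩
      obtain ⟨u, hu, rfl⟩ := h.surjOn ha
      refine ⟨u, ⟨hu, ?_⟩, rfl⟩
      rw [← hp, (hx u hu).1, (hx u hu).2]
    · rintro ⟨u, ⟨hu, hp⟩, rfl⟩
      exact ⟨h.mapsTo hu, by rw [← hp, (hx u hu).1, (hx u hu).2]⟩
  rw [this, Set.InjOn.ncard_image]
  exact h.injOn.mono fun u hu => hu.1

theorem msg_fst_eq {G : SimpleGraph V} {G' : SimpleGraph V'} {lab : V → L} {lab' : V' → L}
    {u e : V} {u' e' : V'} :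
    ∀ {d : ℕ}, msg Δ G lab d u e = msg Δ G' lab' d u' e' → lab u = lab' u'
  | 0, h => h
  | _ + 1, h => congrArg Prod.fst h

/-- Messages are preserved by maps that are bijective on neighbourhoods. -/
theorem msg_eq_of_bijOn {G : SimpleGraph V} {G' : SimpleGraph V'} {lab : V → L} {lab' : V' → L}
    {φ : V → V'} :
    ∀ (d : ℕ) (u e : V),
      (∀ w, G.edist u w ≤ (d : ℕ∞) →
        Set.BijOn φ (G.neighborSet w) (G'.neighborSet (φ w)) ∧ lab' (φ w) = lab w) →
      G.Adj u e → msg Δ G' lab' d (φ u) (φ e) = msg Δ G lab d u e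
  | 0, u, e, h, _ => (h u (by simp)).2
  | d + 1, u, e, h, he => by
    have hu := h u (by simp)
    unfold msg
    refine Prod.ext hu.2 ?_
    funext c
    dsimp only
    congr 1
    have : {w | G'.Adj (φ u) w ∧ w ≠ φ e ∧ msg Δ G' lab' d w (φ u) = c} =
        φ '' {w | G.Adj u w ∧ w ≠ e ∧ msg Δ G lab d w u = c} := by
      have hrec : ∀ w, G.Adj u w → msg Δ G' lab' d (φ w) (φ u) = msg Δ G lab d w u := by
        intro w hw
        refine msg_eq_of_bijOn d w u (fun z hz => h z ?_) hw.symm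
        have := edist_le_add (m := 1) (SimpleGraph.edist_eq_one_iff_adj.2 hw).le hz
        rwa [add_comm] at this
      ext w'
      constructor
      · rintro ⟨ha, hne, hm⟩
        obtain ⟨w, hw, rfl⟩ := hu.1.surjOn ha
        exact ⟨w, ⟨hw, fun h => hne (h ▸ rfl), by rw [← hm, hrec w hw]⟩, rfl⟩
      · rintro ⟨w, ⟨hw, hne, hm⟩, rfl⟩
        exact ⟨hu.1.mapsTo hw, fun h => hne (hu.1.injOn hw he h), by rw [hrec w hw, hm]⟩
    rw [this, Set.InjOn.ncard_image]
    exact hu.1.injOn.mono fun w hw => hw.1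

/-- Finite sets with the same number of elements of each colour are in a colour-preserving
bijection. -/
theorem exists_bijOn_of_ncard_fiber_eq {C : Type*} [Nonempty V'] {A : Set V} {B : Set V'}
    (hA : A.Finite) (hB : B.Finite) {f : V → C} {g : V' → C}
    (h : ∀ c, {a | a ∈ A ∧ f a = c}.ncard = {b | b ∈ B ∧ g b = c}.ncard) :
    ∃ e : V → V', Set.BijOn e A B ∧ ∀ a ∈ A, g (e a) = f a := by
  classical
  have := hA.to_subtype
  have := hB.to_subtype
  have hc : ∀ c, Nonempty ({a : A // f a = c} ≃ {b : B // g b = c}) := by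
    intro c
    refine Finite.card_eq.1 ?_
    have e1 : Nat.card {a : A // f a = c} = {a | a ∈ A ∧ f a = c}.ncard :=
      Nat.card_congr (Equiv.subtypeSubtypeEquivSubtypeInter (· ∈ A) (fun a => f a = c))
    have e2 : Nat.card {b : B // g b = c} = {b | b ∈ B ∧ g b = c}.ncard :=
      Nat.card_congr (Equiv.subtypeSubtypeEquivSubtypeInter (· ∈ B) (fun a => g a = c))
    rw [e1, e2, h]
  let E : A ≃ B := Equiv.ofFiberEquiv (f := fun a : A => f a) (g := fun b : B => g b)
    fun c => (hc c).some
  have hE : ∀ a : A, g (E a) = f a := fun a =>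
    Equiv.ofFiberEquiv_map (f := fun a : A => f a) (g := fun b : B => g b) _ a
  refine ⟨fun a => if h : a ∈ A then (E ⟨a, h⟩ : V') else Classical.arbitrary V', ⟨?_, ?_, ?_⟩, ?_⟩
  · intro a ha
    simp [ha]
  · intro a ha b hb hab
    simp only [dif_pos ha, dif_pos hb] at hab
    have := E.injective (Subtype.ext hab)
    exact congrArg Subtype.val this
  · intro b hb
    refine ⟨(E.symm ⟨b, hb⟩ : A), (E.symm ⟨b, hb⟩).2, ?_⟩
    simp
  · intro a ha
    simpa [ha] using hE ⟨a, ha⟩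

end Msg

section EdgeProblem

variable {I O : Type*}

/-- A node constraint on labels of half-edges: the pairs of labels around the node are those
of some correctly labelled node in a tree. -/
def EdgeOK (P : LCL I O) (Δ : ℕ) (i : I) (o : O)
    (cnt : EdgeLabel Δ (I × O) P.r × EdgeLabel Δ (I × O) P.r → ℕ) : Prop :=
  ∃ (V : Type) (G : SimpleGraph V) (inp : V → I) (out : V → O) (v : V),
    G.IsTree ∧ (∀ u, (G.neighborSet u).encard ≤ (Δ : ℕ∞)) ∧ inp v = i ∧ out v = o ∧
    (∃ H ∈ P.C, (labelledBall G inp out P.r v).Isomorphic H) ∧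
    cnt = edgeCount G (msgLabel Δ G (fun u => (inp u, out u)) P.r) v

/-- The labels at `v` satisfy the node constraint. -/
def NodeOK {V : Type*} (P : LCL I O) (Δ : ℕ) (G : SimpleGraph V) (inp : V → I) (out : V → O)
    (x : V → V → EdgeLabel Δ (I × O) P.r) (v : V) : Prop :=
  EdgeOK P Δ (inp v) (out v) (edgeCount G x v)

theorem nodeOK_iff_of_bijOn {V V' : Type*} {P : LCL I O} {Δ : ℕ} {G : SimpleGraph V}
    {G' : SimpleGraph V'} {inp : V → I} {inp' : V' → I} {out : V → O} {out' : V' → O}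
    {x : V → V → EdgeLabel Δ (I × O) P.r} {x' : V' → V' → EdgeLabel Δ (I × O) P.r}
    {φ : V → V'} {v : V} {v' : V'}
    (h : Set.BijOn φ (G.neighborSet v) (G'.neighborSet v'))
    (hi : inp' v' = inp v) (ho : out' v' = out v)
    (hx : ∀ u, G.Adj v u → x' v' (φ u) = x v u ∧ x' (φ u) v' = x u v) :
    NodeOK P Δ G' inp' out' x' v' ↔ NodeOK P Δ G inp out x v := by
  unfold NodeOK
  rw [edgeCount_eq_of_bijOn h hx, hi, ho]

/-- The node constraint only depends on the labels at the node. -/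
theorem NodeOK.congr {V : Type*} {P : LCL I O} {Δ : ℕ} {G : SimpleGraph V} {inp : V → I}
    {out out' : V → O} {x x' : V → V → EdgeLabel Δ (I × O) P.r} {v : V}
    (h : NodeOK P Δ G inp out x v) (ho : out' v = out v)
    (hx : ∀ u, G.Adj v u → x' v u = x v u ∧ x' u v = x u v) : NodeOK P Δ G inp out' x' v :=
  (nodeOK_iff_of_bijOn (φ := id) (Set.bijOn_id _) rfl ho hx).2 h

/-- In a valid configuration, the true messages satisfy all node constraints. -/
theorem nodeOK_of_isValid {V : Type} {P : LCL I O} {Δ : ℕ} {G : SimpleGraph V} {inp : V → I}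
    {out : V → O} (hG : G.IsTree) (hΔ : ∀ u, (G.neighborSet u).encard ≤ (Δ : ℕ∞))
    (h : P.IsValid G inp out) (v : V) :
    NodeOK P Δ G inp out (msgLabel Δ G (fun u => (inp u, out u)) P.r) v :=
  ⟨V, G, inp, out, v, hG, hΔ, rfl, rfl, h v, rfl⟩

section Iso

variable {V V' : Type} {P : LCL I O} {Δ : ℕ} {G : SimpleGraph V} {G' : SimpleGraph V'}

theorem finite_of_encard_le {A : Set V} (h : A.encard ≤ (Δ : ℕ∞)) : A.Finite :=
  Set.finite_of_encard_le_coe h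

theorem ncard_sub_lt {A B : Set V} (h : A.encard ≤ (Δ : ℕ∞)) (hBA : B ⊆ A) :
    B.ncard < Δ + 1 := by
  have h1 := Set.ncard_le_ncard hBA (finite_of_encard_le h)
  have h2 : A.ncard ≤ Δ := by
    have := (finite_of_encard_le h).cast_ncard_eq
    rw [← this] at h
    exact_mod_cast h
  omega

/-- Around a node that satisfies the node constraint there is a matching correctly labelled node
in a tree. -/
theorem EdgeOK.exists_bijOn {inp : V → I} {out : V → O}
    {x : V → V → EdgeLabel Δ (I × O) P.r} {v : V}
    (hΔ : (G.neighborSet v).encard ≤ (Δ : ℕ∞)) (h : NodeOK P Δ G inp out x v) :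
    ∃ (V' : Type) (G' : SimpleGraph V') (inp' : V' → I) (out' : V' → O) (v' : V') (e : V → V'),
      G'.IsTree ∧ (∀ u, (G'.neighborSet u).encard ≤ (Δ : ℕ∞)) ∧ inp' v' = inp v ∧
      out' v' = out v ∧ (∃ H ∈ P.C, (labelledBall G' inp' out' P.r v').Isomorphic H) ∧
      Set.BijOn e (G.neighborSet v) (G'.neighborSet v') ∧
      ∀ w ∈ G.neighborSet v,
        msgLabel Δ G' (fun u => (inp' u, out' u)) P.r v' (e w) = x v w ∧
        msgLabel Δ G' (fun u => (inp' u, out' u)) P.r (e w) v' = x w v := by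
  obtain ⟨V', G', inp', out', v', h1, h2, h3, h4, h5, h6⟩ := h
  have : Nonempty V' := ⟨v'⟩
  obtain ⟨e, he, he'⟩ := exists_bijOn_of_ncard_fiber_eq (finite_of_encard_le hΔ)
    (finite_of_encard_le (h2 v')) (f := fun w => (x v w, x w v))
    (g := fun w => (msgLabel Δ G' (fun u => (inp' u, out' u)) P.r v' w,
      msgLabel Δ G' (fun u => (inp' u, out' u)) P.r w v'))
    (fun c => congrFun h6 c)
  exact ⟨V', G', inp', out', v', e, h1, h2, h3, h4, h5, he, fun w hw => Prod.ext_iff.1 (he' w hw)⟩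

/-- Labels of half-edges that satisfy all node constraints are the true messages. -/
theorem eq_msgLabel_of_nodeOK {inp : V → I} {out : V → O}
    {x : V → V → EdgeLabel Δ (I × O) P.r}
    (hΔ : ∀ u, (G.neighborSet u).encard ≤ (Δ : ℕ∞)) (h : ∀ v, NodeOK P Δ G inp out x v) :
    ∀ u v, G.Adj u v → x u v = msgLabel Δ G (fun u => (inp u, out u)) P.r u v := by
  have key : ∀ (d : ℕ) (hd : d < P.r) (u v : V), G.Adj u v →
      x u v ⟨d, hd⟩ = msg Δ G (fun u => (inp u, out u)) d u v := by
    intro d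
    induction d with
    | zero =>
      intro hd u v ha
      obtain ⟨V', G', inp', out', v', e, h1, h2, h3, h4, h5, he, he'⟩ :=
        EdgeOK.exists_bijOn (hΔ u) (h u)
      rw [← (he' v ha).1]
      show (inp' v', out' v') = (inp u, out u)
      rw [h3, h4]
    | succ d ih =>
      intro hd u v ha
      obtain ⟨V', G', inp', out', v', e, h1, h2, h3, h4, h5, he, he'⟩ :=
        EdgeOK.exists_bijOn (hΔ u) (h u)
      rw [← (he' v ha).1]
      show msg Δ G' _ (d + 1) v' (e v) = _
      unfold msg
      refine Prod.ext (by simp [h3, h4]) ?_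
      funext c
      dsimp only
      congr 1
      have hrec : ∀ w, G.Adj u w → msg Δ G' (fun u => (inp' u, out' u)) d (e w) v' =
          msg Δ G (fun u => (inp u, out u)) d w u := by
        intro w hw
        rw [← ih (by omega) w u hw.symm, ← (he' w hw).2]
        rfl
      have : {w | G'.Adj v' w ∧ w ≠ e v ∧ msg Δ G' (fun u => (inp' u, out' u)) d w v' = c} =
          e '' {w | G.Adj u w ∧ w ≠ v ∧ msg Δ G (fun u => (inp u, out u)) d w u = c} := by
        ext w'
        constructor
        · rintro ⟨ha', hne, hm⟩
          obtain ⟨w, hw, rfl⟩ := he.surjOn ha'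
          exact ⟨w, ⟨hw, fun h => hne (h ▸ rfl), by rw [← hm, hrec w hw]⟩, rfl⟩
        · rintro ⟨w, ⟨hw, hne, hm⟩, rfl⟩
          exact ⟨he.mapsTo hw, fun h => hne (he.injOn hw ha h), by rw [hrec w hw, hm]⟩
      rw [this, Set.InjOn.ncard_image]
      exact he.injOn.mono fun w hw => hw.1
  intro u v ha
  funext d
  exact key d d.2 u v ha

/-- Equal messages of depth `k + 1` make it possible to match the children. -/
theorem exists_bijOn_of_msg_eq {L : Type*} {lab : V → L} {lab' : V' → L} {k : ℕ} {u y : V}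
    {u' y' : V'} (hΔ : (G.neighborSet u).encard ≤ (Δ : ℕ∞))
    (hΔ' : (G'.neighborSet u').encard ≤ (Δ : ℕ∞)) (hy : G.Adj u y) (hy' : G'.Adj u' y')
    (h : msg Δ G lab (k + 1) u y = msg Δ G' lab' (k + 1) u' y') :
    ∃ e : V → V', Set.BijOn e (G.neighborSet u) (G'.neighborSet u') ∧ e y = y' ∧
      ∀ w, G.Adj u w → w ≠ y → msg Δ G lab k w u = msg Δ G' lab' k (e w) u' := by
  classical
  have : Nonempty V' := ⟨u'⟩
  have h2 := congrArg Prod.snd h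
  obtain ⟨e, he, he'⟩ := exists_bijOn_of_ncard_fiber_eq (A := G.neighborSet u \ {y})
    (B := G'.neighborSet u' \ {y'}) ((finite_of_encard_le hΔ).sdiff)
    ((finite_of_encard_le hΔ').sdiff) (f := fun w => msg Δ G lab k w u)
    (g := fun w => msg Δ G' lab' k w u') (by
      intro c
      have hc := congrArg Fin.val (congrFun h2 c)
      simp only [msg, Fin.ofNat] at hc
      rw [Nat.mod_eq_of_lt (ncard_sub_lt hΔ fun w hw => hw.1),
        Nat.mod_eq_of_lt (ncard_sub_lt hΔ' fun w hw => hw.1)] at hc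
      have e1 : {a | a ∈ G.neighborSet u \ {y} ∧ msg Δ G lab k a u = c} =
          {w | G.Adj u w ∧ w ≠ y ∧ msg Δ G lab k w u = c} := by
        ext w; simp [and_assoc]
      have e2 : {a | a ∈ G'.neighborSet u' \ {y'} ∧ msg Δ G' lab' k a u' = c} =
          {w | G'.Adj u' w ∧ w ≠ y' ∧ msg Δ G' lab' k w u' = c} := by
        ext w; simp [and_assoc]
      rw [e1, e2, hc])
  refine ⟨Function.update e y y', ?_, by simp, ?_⟩
  · have h3 : Set.BijOn (Function.update e y y') (G.neighborSet u \ {y})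
        (G'.neighborSet u' \ {y'}) :=
      he.congr fun w hw => by
        rw [Function.update_of_ne (by simpa using hw.2)]
    have h4 := h3.insert (a := y) (by simp)
    simpa [Set.insert_eq_of_mem, hy, hy'] using h4
  · intro w hw hne
    rw [Function.update_of_ne hne]
    exact (he' w ⟨hw, by simpa using hne⟩).symm

end Iso
end EdgeProblem

/-! ### Labels of half-edges that certify validity -/

section EdgeProblemValid

variable {I O : Type*} {V V' : Type} {P : LCL I O} {Δ : ℕ} {G : SimpleGraph V}
  {G' : SimpleGraph V'}

theorem edist_le_iff_dist_le (hG : G.Connected) {u v : V} {m : ℕ} :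
    G.edist u v ≤ (m : ℕ∞) ↔ G.dist u v ≤ m := by
  rw [← (hG u v).coe_dist_eq_edist]
  exact_mod_cast Iff.rfl

/-- Matching half-edge labels around `v` and `v'` can be continued to a map that is bijective on
the neighbourhoods of the nodes at distance less than `d`. -/
theorem exists_covering_of_nodeOK {inp : V → I} {out : V → O}
    {x : V → V → EdgeLabel Δ (I × O) P.r}
    (hG : G.IsTree) (hΔ : ∀ u, (G.neighborSet u).encard ≤ (Δ : ℕ∞))
    (h : ∀ v, NodeOK P Δ G inp out x v) {v : V} {inp' : V' → I} {out' : V' → O} {v' : V'}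
    (hΔ' : ∀ u, (G'.neighborSet u).encard ≤ (Δ : ℕ∞))
    (hi : inp' v' = inp v) (ho : out' v' = out v) {e : V → V'}
    (he : Set.BijOn e (G.neighborSet v) (G'.neighborSet v'))
    (hm : ∀ w ∈ G.neighborSet v,
        msgLabel Δ G' (fun u => (inp' u, out' u)) P.r v' (e w) = x v w ∧
        msgLabel Δ G' (fun u => (inp' u, out' u)) P.r (e w) v' = x w v) :
    ∀ d ≤ P.r, ∃ φ : V → V', φ v = v' ∧
      (∀ u, G.dist v u ≤ d → (inp' (φ u), out' (φ u)) = (inp u, out u)) ∧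
      (∀ u, G.dist v u < d → Set.BijOn φ (G.neighborSet u) (G'.neighborSet (φ u))) ∧
      (∀ u w k, G.Adj u w → G.dist v w = G.dist v u + 1 → G.dist v w ≤ d →
        k + G.dist v w = P.r →
        msg Δ G (fun u => (inp u, out u)) k w u =
          msg Δ G' (fun u => (inp' u, out' u)) k (φ w) (φ u)) := by
  classical
  have : Nonempty V' := ⟨v'⟩
  have hx := eq_msgLabel_of_nodeOK hΔ h
  intro d
  induction d with
  | zero =>
    intro _
    refine ⟨fun _ => v', rfl, ?_, fun u hu => absurd hu (by omega), fun u w k _ _ _ _ => by omega⟩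
    intro u hu
    have : u = v := ((hG.connected.dist_eq_zero_iff).1 (by omega)).symm
    rw [this, hi, ho]
  | succ d ih =>
    intro hd
    obtain ⟨φ, hv, hlab, hbij, hmsg⟩ := ih (by omega)
    -- the children of a node at distance `d` can be matched
    have hstep : ∀ u, G.dist v u = d → ∃ eu : V → V',
        Set.BijOn eu (G.neighborSet u) (G'.neighborSet (φ u)) ∧
        ∀ w k, G.Adj u w → (G.dist v w < d → eu w = φ w) ∧
          (G.dist v w = d + 1 → k + (d + 1) = P.r →
            msg Δ G (fun u => (inp u, out u)) k w u =
              msg Δ G' (fun u => (inp' u, out' u)) k (eu w) (φ u)) := by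
      intro u hu
      by_cases h0 : d = 0
      · subst h0
        have huv : u = v := ((hG.connected.dist_eq_zero_iff).1 (by omega)).symm
        subst huv
        rw [hv]
        refine ⟨e, he, fun w k hw => ⟨fun hlt => by omega, fun _ hk => ?_⟩⟩
        have h1 := (hm w hw).2
        rw [hx w u hw.symm] at h1
        exact (congrFun h1 ⟨k, by omega⟩).symm
      · obtain ⟨y, hy, hylt⟩ := exists_adj_dist_lt (hG.connected v u) (by
          rintro rfl; simp at hu; omega)
        have hyd : G.dist v u = G.dist v y + 1 := by
          rcases hy.diff_dist_adj (u := v) with h3 | h3 | h3 <;> omega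
        have h1 := hmsg y u (P.r - d) hy.symm hyd (by omega) (by omega)
        obtain ⟨k, hk⟩ : ∃ k, P.r - d = k + 1 := ⟨P.r - d - 1, by omega⟩
        rw [hk] at h1
        obtain ⟨eu, heu, hey, heu'⟩ := exists_bijOn_of_msg_eq (hΔ u) (hΔ' (φ u)) hy
          ((hbij y (by omega)).mapsTo hy.symm).symm h1
        refine ⟨eu, heu, fun w k' hw => ⟨fun hlt => ?_, fun hwd hk' => ?_⟩⟩
        · have : w = y := eq_of_adj_of_dist_le hG.isAcyclic (hG.connected v u) hw hy
            (by omega) (by omega)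
          rw [this, hey]
        · obtain rfl : k' = k := by omega
          refine heu' w hw ?_
          rintro rfl
          omega
    choose! eu heu heu' using hstep
    have hpar : ∀ w, G.dist v w = d + 1 → ∃ y, G.Adj w y ∧ G.dist v y = d := by
      intro w hw
      obtain ⟨y, hy, hylt⟩ := exists_adj_dist_lt (hG.connected v w) (by
        rintro rfl; simp at hw)
      refine ⟨y, hy, ?_⟩
      rcases hy.diff_dist_adj (u := v) with h3 | h3 | h3 <;> omega
    choose! par hpar1 hpar2 using hpar
    have hparu : ∀ u w, G.Adj u w → G.dist v w = d + 1 → G.dist v u = d → par w = u := by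
      intro u w ha hw hu
      exact eq_of_adj_of_dist_le hG.isAcyclic (hG.connected v w) (hpar1 w hw) ha.symm
        (by rw [hpar2 w hw]; omega) (by omega)
    let φ' : V → V' := fun w => if G.dist v w = d + 1 then eu (par w) w else φ w
    have hφ' : ∀ w, G.dist v w ≤ d → φ' w = φ w := fun w hw => if_neg (by omega)
    have hφ'' : ∀ u w, G.Adj u w → G.dist v u = d → φ' w = eu u w := by
      intro u w ha hu
      have := hG.dist_ne_of_adj v ha
      by_cases hw : G.dist v w = d + 1
      · simp only [φ', if_pos hw]
        rw [hparu u w ha hw hu]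
      · have hlt : G.dist v w < d := by
          rcases ha.diff_dist_adj (u := v) with h3 | h3 | h3 <;> omega
        rw [hφ' w (by omega), (heu' u hu w 0 ha).1 hlt]
    have hmsg' : ∀ u w k, G.Adj u w → G.dist v w = G.dist v u + 1 → G.dist v w ≤ d + 1 →
        k + G.dist v w = P.r →
        msg Δ G (fun u => (inp u, out u)) k w u =
          msg Δ G' (fun u => (inp' u, out' u)) k (φ' w) (φ' u) := by
      intro u w k ha h1 h2 h3
      by_cases hw : G.dist v w = d + 1
      · rw [hφ'' u w ha (by omega), hφ' u (by omega)]
        exact (heu' u (by omega) w k ha).2 hw (by omega)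
      · rw [hφ' w (by omega), hφ' u (by omega)]
        exact hmsg u w k ha h1 (by omega) h3
    refine ⟨φ', ?_, ?_, ?_, hmsg'⟩
    · rw [hφ' v (by simp), hv]
    · intro u hu
      by_cases hud : G.dist v u = d + 1
      · exact (msg_fst_eq (hmsg' (par u) u (P.r - (d + 1)) (hpar1 u hud).symm
          (by rw [hpar2 u hud]; omega) hu (by omega))).symm
      · rw [hφ' u (by omega)]; exact hlab u (by omega)
    · intro u hu
      rw [hφ' u (by omega)]
      by_cases hud : G.dist v u = d
      · exact (heu u hud).congr fun w hw => (hφ'' u w hw hud).symm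
      · refine (hbij u (by omega)).congr fun w hw => (hφ' w ?_).symm
        rcases (show G.Adj u w from hw).diff_dist_adj (u := v) with h3 | h3 | h3 <;> omega

/-- Balls of trees that are related by a map that is bijective on the neighbourhoods of the inner
nodes are isomorphic. -/
theorem labelledBall_isomorphic_of_bijOn {r : ℕ} {inp : V → I} {out : V → O}
    {inp' : V' → I} {out' : V' → O} (hG : G.IsTree) (hG' : G'.IsTree) {v : V} {φ : V → V'}
    (hlab : ∀ u, G.dist v u ≤ r → (inp' (φ u), out' (φ u)) = (inp u, out u))
    (hbij : ∀ u, G.dist v u < r → Set.BijOn φ (G.neighborSet u) (G'.neighborSet (φ u))) :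
    (labelledBall G inp out r v).Isomorphic (labelledBall G' inp' out' r (φ v)) := by
  have himg : ∀ m ≤ r, ∀ u', G'.dist (φ v) u' ≤ m ↔ ∃ u, G.dist v u ≤ m ∧ φ u = u' := by
    intro m hm u'
    have := edist_image_iff (G := G) (G' := G') (φ := φ) (v := v) (t := r) (fun u hu => by
      refine hbij u ?_
      cases r with
      | zero => simp at hu
      | succ r =>
        rw [edist_lt_natCast_succ_iff, edist_le_iff_dist_le hG.connected] at hu
        omega) m hm u'
    simpa only [edist_le_iff_dist_le hG.connected, edist_le_iff_dist_le hG'.connected] using this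
  -- two nodes with the same image are reached by geodesics with the same image
  have hinj : ∀ u w, G.dist v u ≤ r → G.dist v w ≤ r → φ u = φ w → u = w := by
    have hnb : ∀ (s : ℕ → V) (m : ℕ), s 0 = v → m ≤ r → NonBacktracking G s m →
        NonBacktracking G' (fun i => φ (s i)) m := by
      intro s m h0 hm hs
      have hd := hs.dist_eq hG.isAcyclic
      rw [h0] at hd
      refine ⟨fun i hi => (hbij (s i) (by rw [hd i hi.le]; omega)).mapsTo (hs.1 i hi), ?_⟩
      intro i hi e
      refine hs.2 i hi ((hbij (s (i + 1)) (by rw [hd (i + 1) (by omega)]; omega)).injOn ?_ ?_ e)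
      · exact (hs.1 i (by omega)).symm
      · exact hs.1 (i + 1) (by omega)
    intro u w hu hw e
    obtain ⟨s, hs0, hs1, hs⟩ := exists_nonBacktracking (hG.connected v u)
    obtain ⟨t, ht0, ht1, ht⟩ := exists_nonBacktracking (hG.connected v w)
    obtain ⟨hl, hst⟩ := (hnb s _ hs0 hu hs).unique hG'.isAcyclic (hnb t _ ht0 hw ht)
      (by simp only [hs0, ht0]) (by simp only [hs1, ht1, e])
    have key : ∀ i ≤ G.dist v u, s i = t i := by
      intro i
      induction i with
      | zero => intro _; rw [hs0, ht0]
      | succ i ih =>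
        intro hi
        have e1 := ih (by omega)
        have hd := hs.dist_eq hG.isAcyclic i (by omega)
        rw [hs0] at hd
        refine (hbij (s i) (by omega)).injOn (hs.1 i (by omega)) ?_ (hst (i + 1) hi)
        rw [e1]
        exact ht.1 i (by omega)
    rw [← hs1, ← ht1, key _ le_rfl, hl]
  have hadj : ∀ u w, G.dist v u ≤ r → G.dist v w ≤ r → (G'.Adj (φ u) (φ w) ↔ G.Adj u w) := by
    have haux : ∀ u w, G.dist v u < r → G.dist v w ≤ r → G'.Adj (φ u) (φ w) → G.Adj u w := by
      intro u w hu hw ha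
      obtain ⟨w1, hw1, e⟩ := (hbij u hu).surjOn ha
      have hw1d : G.dist v w1 ≤ r := by
        rcases (show G.Adj u w1 from hw1).diff_dist_adj (u := v) with h3 | h3 | h3 <;> omega
      rwa [← hinj w1 w hw1d hw e]
    have hlt : ∀ u, G.dist v u ≤ r → G'.dist (φ v) (φ u) < r → G.dist v u < r := by
      intro u hu hlt
      obtain ⟨u1, hu1, e⟩ := (himg (r - 1) (by omega) (φ u)).1 (by omega)
      rw [← hinj u1 u (by omega) hu e]
      omega
    intro u w hu hw
    constructor
    · intro ha
      have h1 := (himg r le_rfl (φ u)).2 ⟨u, hu, rfl⟩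
      have h2 := (himg r le_rfl (φ w)).2 ⟨w, hw, rfl⟩
      have h3 := hG'.dist_ne_of_adj (φ v) ha
      rcases lt_or_gt_of_ne h3 with h4 | h4
      · exact haux u w (hlt u hu (by omega)) hw ha
      · exact (haux w u (hlt w hw (by omega)) hu ha.symm).symm
    · intro ha
      have h3 := hG.dist_ne_of_adj v ha
      rcases lt_or_gt_of_ne h3 with h4 | h4
      · exact (hbij u (by omega)).mapsTo ha
      · exact ((hbij w (by omega)).mapsTo ha.symm).symm
  have hball : Set.BijOn φ {u : V | G.edist v u ≤ (r : ℕ∞)}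
      {u : V' | G'.edist (φ v) u ≤ (r : ℕ∞)} := by
    refine ⟨fun u hu => ?_, fun u hu w hw e => ?_, fun u' hu' => ?_⟩
    · exact (edist_le_iff_dist_le hG'.connected).2 ((himg r le_rfl _).2
        ⟨u, (edist_le_iff_dist_le hG.connected).1 hu, rfl⟩)
    · exact hinj u w ((edist_le_iff_dist_le hG.connected).1 hu)
        ((edist_le_iff_dist_le hG.connected).1 hw) e
    · obtain ⟨u, hu, rfl⟩ := (himg r le_rfl _).1 ((edist_le_iff_dist_le hG'.connected).1 hu')
      exact ⟨u, (edist_le_iff_dist_le hG.connected).2 hu, rfl⟩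
  have hd : ∀ u : {u : V | G.edist v u ≤ (r : ℕ∞)}, G.dist v u ≤ r := fun u =>
    (edist_le_iff_dist_le hG.connected).1 u.2
  refine ⟨⟨hball.equiv φ, ?_⟩, ?_, ?_, ?_⟩
  · intro u w
    exact hadj u.1 w.1 (hd u) (hd w)
  · rfl
  · intro u
    exact congrArg Prod.fst (hlab u.1 (hd u))
  · intro u
    exact congrArg Prod.snd (hlab u.1 (hd u))

/-- A labelling of a tree that extends to half-edge labels satisfying all node constraints is
valid. -/
theorem isValid_of_nodeOK {inp : V → I} {out : V → O} {x : V → V → EdgeLabel Δ (I × O) P.r}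
    (hG : G.IsTree) (hΔ : ∀ u, (G.neighborSet u).encard ≤ (Δ : ℕ∞))
    (h : ∀ v, NodeOK P Δ G inp out x v) : P.IsValid G inp out := by
  intro v
  obtain ⟨V', G', inp', out', v', e, hG', hΔ', hi, ho, ⟨H, hH, f, hf1, hf2, hf3⟩, he, hm⟩ :=
    EdgeOK.exists_bijOn (hΔ v) (h v)
  obtain ⟨φ, hφ1, hφ2, hφ3, -⟩ :=
    exists_covering_of_nodeOK hG hΔ h hΔ' hi ho he hm P.r le_rfl
  subst hφ1
  obtain ⟨g, hg1, hg2, hg3⟩ := labelledBall_isomorphic_of_bijOn hG hG' hφ2 hφ3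
  refine ⟨H, hH, g.trans f, ?_, fun u => ?_, fun u => ?_⟩
  · rw [← hf1, ← hg1]; rfl
  · rw [← hg2 u, ← hf2]; rfl
  · rw [← hg3 u, ← hf3]; rfl

end EdgeProblemValid

/-! ### Pumping words of relations -/

section Pump

variable {M : Type*}

/-- The composition of the first `s` relations of a sequence. -/
def prodRel (w : ℕ → M → M → Prop) : ℕ → M → M → Prop
  | 0 => Eq
  | s + 1 => fun p q => ∃ m, prodRel w s p m ∧ w s m q

theorem prodRel_iff (w : ℕ → M → M → Prop) (s : ℕ) (p q : M) :
    prodRel w s p q ↔ ∃ m : ℕ → M, m 0 = p ∧ m s = q ∧ ∀ i < s, w i (m i) (m (i + 1)) := by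
  induction s generalizing q with
  | zero =>
    constructor
    · rintro rfl; exact ⟨fun _ => p, rfl, rfl, by simp⟩
    · rintro ⟨m, rfl, rfl, -⟩; rfl
  | succ s ih =>
    constructor
    · rintro ⟨q', h1, h2⟩
      obtain ⟨m, hm0, hms, hm⟩ := (ih q').1 h1
      refine ⟨fun i => if i ≤ s then m i else q, by simpa using hm0, by simp, fun i hi => ?_⟩
      dsimp only
      rcases Nat.lt_succ_iff_lt_or_eq.1 hi with h | h
      · rw [if_pos h.le, if_pos (by omega)]; exact hm i h
      · subst h; rw [if_pos le_rfl, if_neg (by omega), hms]; exact h2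
    · rintro ⟨m, hm0, hms, hm⟩
      exact ⟨m s, (ih _).2 ⟨m, hm0, rfl, fun i hi => hm i (by omega)⟩, hms ▸ hm s (by omega)⟩

/-- A word of relations that is longer than the number of relations can be pumped to a prescribed
larger length without changing the composition: two prefixes have the same composition, so the
part between them can be repeated. The factor `h !` makes the new length independent of the length
of the repeated part. -/
theorem exists_pump [Finite M] {h : ℕ} (hh : Nat.card (M → M → Prop) ≤ h) (B : ℕ)
    (w : ℕ → M → M → Prop) :
    ∃ g : ℕ → ℕ, (∀ s < h + B * h.factorial, g s < h) ∧
      prodRel (fun s => w (g s)) (h + B * h.factorial) = prodRel w h := by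
  obtain ⟨i, j, hij, hjh, hP⟩ : ∃ i j, i < j ∧ j ≤ h ∧ prodRel w i = prodRel w j := by
    have hcard : Nat.card (M → M → Prop) < Nat.card (Fin (h + 1)) := by simpa using by omega
    obtain ⟨a, b, hab, he⟩ := Function.not_injective_iff.1
      (fun hinj : Function.Injective (fun a : Fin (h + 1) => prodRel w a) =>
        absurd (Nat.card_le_card_of_injective _ hinj) (by omega))
      |>.imp fun a => fun ⟨b, h1, h2⟩ => (⟨b, h2, h1⟩ : ∃ b, a ≠ b ∧ prodRel w a = prodRel w b)
    rcases lt_or_gt_of_ne hab with hlt | hlt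
    · exact ⟨a, b, hlt, by omega, he⟩
    · exact ⟨b, a, hlt, by omega, he.symm⟩
  obtain ⟨q, hq⟩ : (j - i) ∣ B * h.factorial :=
    (Nat.dvd_factorial (by omega) (by omega)).mul_left B
  obtain ⟨p, hp⟩ : ∃ p, j = i + p := ⟨j - i, by omega⟩
  subst hp
  rw [Nat.add_sub_cancel_left] at hq
  have hp0 : 0 < p := by omega
  rw [hq]
  set N := p * q with hN
  let g : ℕ → ℕ := fun s => if s < i then s else if s < i + N then i + (s - i) % p else s - N
  have hmod : ∀ s, (s - i) % p < p := fun s => Nat.mod_lt _ hp0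
  have hgh : ∀ s < h + N, g s < h := by
    intro s hs
    have := hmod s
    simp only [g]
    split_ifs <;> omega
  refine ⟨g, hgh, ?_⟩
  have g1 : ∀ s, s < i → g s = s := fun s hs => if_pos hs
  have g2 : ∀ s, i ≤ s → s < i + N → g s = i + (s - i) % p := fun s hs hs' => by
    simp only [g]; rw [if_neg (by omega), if_pos hs']
  have g3 : ∀ s, i + N ≤ s → g s = s - N := fun s hs => by
    simp only [g]; rw [if_neg (by omega), if_neg (by omega)]
  have hstep : ∀ s, prodRel w (g s + 1) = prodRel w (g (s + 1)) := by
    intro s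
    rcases lt_trichotomy (s + 1) i with h1 | h1 | h1
    · rw [g1 s (by omega), g1 _ h1]
    · rw [g1 s (by omega)]
      rcases Nat.eq_zero_or_pos N with h2 | h2
      · rw [g3 _ (by omega), h2, Nat.sub_zero]
      · rw [g2 _ (by omega) (by omega), h1, Nat.sub_self, Nat.zero_mod, Nat.add_zero]
    · have hsi : s + 1 - i = (s - i) + 1 := by omega
      have h3 := hmod s
      have hmod1 : (s - i) % p + 1 < p → (s - i + 1) % p = (s - i) % p + 1 := by
        intro h4
        rw [← Nat.mod_add_mod, Nat.mod_eq_of_lt h4]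
      by_cases h2 : s + 1 < i + N
      · rw [g2 s (by omega) (by omega), g2 _ (by omega) h2, hsi]
        by_cases h4 : (s - i) % p + 1 = p
        · have : (s - i + 1) % p = 0 := by
            rw [← Nat.mod_add_mod, h4, Nat.mod_self]
          rw [this, show i + (s - i) % p + 1 = i + p by omega]
          exact hP.symm
        · rw [hmod1 (by omega)]; congr 1
      · by_cases h5 : s < i + N
        · rw [g2 s (by omega) h5, g3 _ (by omega)]
          have h6 : (s - i) + 1 = p * q := by omega
          have : (s - i) % p + 1 = p := by
            by_contra h4
            have h7 := hmod1 (by omega)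
            rw [h6, Nat.mul_mod_right] at h7
            omega
          rw [show i + (s - i) % p + 1 = i + p by omega, ← hP]
          congr 1; omega
        · rw [g3 s (by omega), g3 _ (by omega)]; congr 1; omega
  have key : ∀ s, prodRel (fun s => w (g s)) s = prodRel w (g s) := by
    intro s
    induction s with
    | zero =>
      have : g 0 = 0 := by
        simp only [g, Nat.zero_sub, Nat.zero_mod]
        split_ifs <;> omega
      rw [this]; rfl
    | succ s ih =>
      rw [← hstep]
      funext a b
      simp only [prodRel, ih]
  rw [key]
  congr 1
  rw [g3 _ (by omega)]
  omega

end Pump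

/-! ### The core of a tree and the small trees hanging off it -/

section Core

variable {V : Type*} {G : SimpleGraph V} {τ : ℕ}

/-- No non-backtracking walk of `d` steps starts at `v` and avoids `u` in its first step: the
branch at `v` away from `u` has height less than `d`. -/
def Low (G : SimpleGraph V) : ℕ → V → V → Prop
  | 0, _, _ => False
  | d + 1, v, u => ∀ w, G.Adj v w → w ≠ u → Low G d w v

theorem Low.succ : ∀ {d : ℕ} {v u : V}, Low G d v u → Low G (d + 1) v u
  | 0, _, _, h => h.elim
  | _ + 1, _, _, h => fun w hw hne => (h w hw hne).succ

theorem Low.mono {d d' : ℕ} {v u : V} (h : Low G d v u) (hd : d ≤ d') : Low G d' v u := by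
  induction hd with
  | refl => exact h
  | step _ ih => exact ih.succ

/-- A walk that ends with a branch of height at least `t` starts a branch that is higher by the
number of steps. -/
theorem not_low_of_nonBacktracking {t : ℕ} :
    ∀ {m : ℕ} {s : ℕ → V}, NonBacktracking G s (m + 1) → ¬ Low G t (s (m + 1)) (s m) →
      ¬ Low G (m + t) (s 1) (s 0)
  | 0, _, _, h => by simpa using h
  | m + 1, s, hs, h => by
    intro hl
    rw [show m + 1 + t = (m + t) + 1 by omega] at hl
    have h1 := hs.shift (l := m + 1) (k := 1) (by omega)
    refine not_low_of_nonBacktracking (t := t) (m := m) h1 h ?_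
    exact hl (s 2) (hs.1 1 (by omega)) (fun e => hs.2 0 (by omega) e.symm)

/-- A branch that is not low contains a long walk. -/
theorem exists_nonBacktracking_of_not_low :
    ∀ {d : ℕ} {v u : V}, G.Adj u v → ¬ Low G d v u →
      ∃ s : ℕ → V, s 0 = u ∧ s 1 = v ∧ NonBacktracking G s (d + 1)
  | 0, v, u, ha, _ => by
    refine ⟨fun i => if i = 0 then u else v, by simp, by simp, fun i hi => ?_, fun i hi => by omega⟩
    obtain rfl : i = 0 := by omega
    simpa using ha
  | d + 1, v, u, ha, h => by
    simp only [Low, not_forall] at h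
    obtain ⟨w, hw, hne, hl⟩ := h
    obtain ⟨s, hs0, hs1, hs⟩ := exists_nonBacktracking_of_not_low hw hl
    refine ⟨fun i => if i = 0 then u else s (i - 1), by simp, by simpa using hs0,
      fun i hi => ?_, fun i hi => ?_⟩
    · rcases Nat.eq_zero_or_pos i with rfl | h0
      · simpa [hs0] using ha
      · have := hs.1 (i - 1) (by omega)
        rw [show i - 1 + 1 = i by omega] at this
        simpa [show i ≠ 0 by omega] using this
    · rcases Nat.eq_zero_or_pos i with rfl | h0
      · simpa [hs1] using hne.symm
      · have := hs.2 (i - 1) (by omega)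
        rw [show i - 1 + 2 = i + 1 by omega] at this
        simpa [show i ≠ 0 by omega] using this

/-- The core consists of the nodes that are not in a branch of height less than `τ`. -/
def Core (G : SimpleGraph V) (τ : ℕ) (v : V) : Prop := ∀ u, G.Adj v u → ¬ Low G τ v u

theorem core_of_not_low {v a b : V} {t : ℕ} (ha : G.Adj v a) (hb : G.Adj v b) (hab : a ≠ b)
    (h : ¬ Low G t a v) (h' : ¬ Low G t b v) (ht : τ ≤ t + 1) : Core G τ v := by
  intro u _ hl
  have hl' : Low G (t + 1) v u := hl.mono ht
  rcases eq_or_ne a u with e | e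
  · exact h' (hl' b hb fun e' => hab (e.trans e'.symm))
  · exact h (hl' a ha e)

/-- Every node of a path that is far from both ends is in the core. -/
theorem core_of_nonBacktracking (hτ : 1 ≤ τ) {s : ℕ → V} {m i : ℕ} (hs : NonBacktracking G s m)
    (hi : τ ≤ i) (hi' : i + τ ≤ m) : Core G τ (s i) := by
  have h1 := hs.1 i (by omega)
  have h2 := (hs.1 (i - 1) (by omega)).symm
  rw [show i - 1 + 1 = i by omega] at h2
  refine core_of_not_low (t := τ - 1) h1 h2 ?_ ?_ ?_ (by omega)
  · have := hs.2 (i - 1) (by omega)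
    rw [show i - 1 + 2 = i + 1 by omega] at this
    exact this.symm
  · have := not_low_of_nonBacktracking (t := 0) (m := τ - 1)
      (hs.shift (l := τ - 1 + 1) (k := i) (by omega)) (fun h => h)
    simpa [add_comm] using this
  · have := not_low_of_nonBacktracking (t := 0) (m := τ - 1)
      ((hs.mono (l := i) (by omega)).rev (l := τ - 1 + 1) (by omega)) (fun h => h)
    simpa using this

/-- The core is convex. -/
theorem core_of_core_ends {s : ℕ → V} {m : ℕ} (hs : NonBacktracking G s m)
    (h0 : Core G τ (s 0)) (hm : Core G τ (s m)) : ∀ i ≤ m, Core G τ (s i) := by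
  intro i hi
  rcases Nat.eq_zero_or_pos i with rfl | hpos
  · exact h0
  rcases eq_or_lt_of_le hi with rfl | hlt
  · exact hm
  have h1 := hs.1 i (by omega)
  have h2 := (hs.1 (i - 1) (by omega)).symm
  rw [show i - 1 + 1 = i by omega] at h2
  refine core_of_not_low (t := τ) h1 h2 ?_ ?_ ?_ (by omega)
  · have := hs.2 (i - 1) (by omega)
    rw [show i - 1 + 2 = i + 1 by omega] at this
    exact this.symm
  · have hlast := hs.1 (m - 1) (by omega)
    rw [show m - 1 + 1 = m by omega] at hlast
    have := not_low_of_nonBacktracking (t := τ) (m := m - i - 1)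
      (hs.shift (l := m - i - 1 + 1) (k := i) (by omega)) (by
        rw [show m - i - 1 + 1 + i = m by omega, show m - i - 1 + i = m - 1 by omega]
        exact hm _ hlast.symm)
    intro hl
    refine this (Low.mono ?_ (Nat.le_add_left _ _))
    simpa [add_comm] using hl
  · have hfirst := hs.1 0 (by omega)
    have := not_low_of_nonBacktracking (t := τ) (m := i - 1)
      ((hs.mono (l := i) (by omega)).rev (l := i - 1 + 1) (by omega)) (by
        rw [show i - (i - 1 + 1) = 0 by omega, show i - (i - 1) = 1 by omega]
        exact h0 _ hfirst)
    intro hl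
    refine this (Low.mono ?_ (Nat.le_add_left _ _))
    simpa using hl

theorem low_of_not_core (hτ : 1 ≤ τ) {u v : V} (hu : ¬ Core G τ u) (hv : Core G τ v)
    (ha : G.Adj u v) : Low G τ u v := by
  simp only [Core, not_forall, not_not] at hu
  obtain ⟨w, hw, hl⟩ := hu
  by_cases e : v = w
  · rwa [e]
  · exfalso
    obtain ⟨t, rfl⟩ : ∃ t, τ = t + 1 := ⟨τ - 1, by omega⟩
    exact hv u ha.symm (hl v ha e).succ

/-- `w` is reached from its predecessor `y` by a non-backtracking walk of `m` steps from `u`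
whose first step leaves the core. -/
inductive HangAt (G : SimpleGraph V) (τ : ℕ) (u : V) : ℕ → V → V → Prop
  | base {w : V} : G.Adj u w → ¬ Core G τ w → HangAt G τ u 1 u w
  | step {m : ℕ} {y w w' : V} : HangAt G τ u m y w → G.Adj w w' → w' ≠ y →
      HangAt G τ u (m + 1) w w'

/-- The tree hanging off the core at `u`, with `u` itself. -/
def hang (G : SimpleGraph V) (τ : ℕ) (u : V) : Set V := {w | w = u ∨ ∃ m y, HangAt G τ u m y w}

theorem mem_hang_self (u : V) : u ∈ hang G τ u := Or.inl rfl

/-- The branches that leave the core are low, so a hanging tree has depth at most `τ`, and the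
branches within it become lower from step to step. -/
theorem HangAt.spec (hτ : 1 ≤ τ) {u : V} (hu : Core G τ u) {m : ℕ} {y w : V}
    (h : HangAt G τ u m y w) :
    1 ≤ m ∧ m ≤ τ ∧ G.Adj y w ∧ Low G (τ + 1 - m) w y ∧ G.edist u w ≤ (m : ℕ∞) ∧
      y ∈ hang G τ u := by
  induction h with
  | base ha hc =>
    refine ⟨le_rfl, hτ, ha, ?_, ?_, mem_hang_self _⟩
    · simpa using low_of_not_core hτ hc hu ha.symm
    · simpa using (SimpleGraph.edist_eq_one_iff_adj.2 ha).le
  | @step m y w w' h ha hne ih =>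
    obtain ⟨h1, h2, h3, h4, h5, h6⟩ := ih
    rw [show τ + 1 - m = (τ - m) + 1 by omega] at h4
    have h7 := h4 w' ha hne
    refine ⟨by omega, ?_, ha, by rwa [show τ + 1 - (m + 1) = τ - m by omega],
      edist_le_of_adj h5 ha, Or.inr ⟨_, _, h⟩⟩
    by_contra hlt
    rw [show τ - m = 0 by omega] at h7
    exact h7

theorem HangAt.not_core (hτ : 1 ≤ τ) {u : V} (hu : Core G τ u) {m : ℕ} {y w : V}
    (h : HangAt G τ u m y w) : ¬ Core G τ w := by
  obtain ⟨h1, h2, h3, h4, -, -⟩ := h.spec hτ hu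
  exact fun hc => hc y h3.symm (h4.mono (by omega))

theorem eq_of_mem_hang_of_core (hτ : 1 ≤ τ) {u w : V} (hu : Core G τ u) (hw : w ∈ hang G τ u)
    (hc : Core G τ w) : w = u := by
  rcases hw with h | ⟨m, y, h⟩
  · exact h
  · exact absurd hc (h.not_core hτ hu)

/-- Only the root of a hanging tree has neighbours outside. -/
theorem mem_hang_of_adj (hτ : 1 ≤ τ) {u w w' : V} (hu : Core G τ u) (hw : w ∈ hang G τ u)
    (hne : w ≠ u) (ha : G.Adj w w') : w' ∈ hang G τ u := by
  rcases hw with h | ⟨m, y, h⟩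
  · exact absurd h hne
  · by_cases e : w' = y
    · rw [e]; exact (h.spec hτ hu).2.2.2.2.2
    · exact Or.inr ⟨_, _, h.step ha e⟩

theorem mem_hang_iff_of_adj (hτ : 1 ≤ τ) {u w : V} (hu : Core G τ u) (ha : G.Adj u w) :
    w ∈ hang G τ u ↔ ¬ Core G τ w := by
  constructor
  · intro h hc
    exact ha.ne (eq_of_mem_hang_of_core hτ hu h hc).symm
  · exact fun h => Or.inr ⟨_, _, .base ha h⟩

/-- Trees hanging off different core nodes are disjoint. -/
theorem eq_of_mem_hang (hτ : 1 ≤ τ) {u u' w : V} (hu : Core G τ u) (hu' : Core G τ u')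
    (h : w ∈ hang G τ u) (h' : w ∈ hang G τ u') : u = u' := by
  rcases h with rfl | ⟨m, y, h⟩
  · exact eq_of_mem_hang_of_core hτ hu' h' hu
  · induction h with
    | base ha hc =>
      refine eq_of_mem_hang_of_core hτ hu' (mem_hang_of_adj hτ hu' h' ?_ ha.symm) hu
      rintro rfl; exact hc hu'
    | @step m y w w' h ha hne ih =>
      refine ih (mem_hang_of_adj hτ hu' h' ?_ ha.symm)
      rintro rfl
      exact (h.step ha hne).not_core hτ hu hu'

theorem edist_le_of_mem_hang (hτ : 1 ≤ τ) {u w : V} (hu : Core G τ u) (hw : w ∈ hang G τ u) :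
    G.edist u w ≤ (τ : ℕ∞) := by
  rcases hw with rfl | ⟨m, y, h⟩
  · simp
  · obtain ⟨-, h2, -, -, h5, -⟩ := h.spec hτ hu
    exact edist_le_mono h5 h2

theorem reachable_of_mem_hang (hτ : 1 ≤ τ) {u w : V} (hu : Core G τ u) (hw : w ∈ hang G τ u) :
    G.Reachable u w := by
  refine SimpleGraph.reachable_of_edist_ne_top fun h => ?_
  have := edist_le_of_mem_hang hτ hu hw
  rw [h] at this
  simp at this

end Core

/-! ### Long paths of core nodes of core degree two -/

section Chain

variable {V : Type*} {G : SimpleGraph V} {τ e : ℕ}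

/-- `c` is a path in the core, with `c 0 = v`, such that for `|i| ≤ e` the only core neighbours of
`c i` are `c (i - 1)` and `c (i + 1)`. -/
structure IsChain (G : SimpleGraph V) (τ e : ℕ) (v : V) (c : ℤ → V) : Prop where
  zero : c 0 = v
  core : ∀ i : ℤ, -e ≤ i → i ≤ e → Core G τ (c i)
  nbr : ∀ i : ℤ, -e ≤ i → i ≤ e →
    ∀ u, (G.Adj (c i) u ∧ Core G τ u) ↔ (u = c (i - 1) ∨ u = c (i + 1))
  ne : ∀ i : ℤ, -e ≤ i → i ≤ e → c (i - 1) ≠ c (i + 1)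

theorem IsChain.adj {v : V} {c : ℤ → V} (h : IsChain G τ e v c) {i : ℤ} (hi : -(e + 1 : ℤ) ≤ i)
    (hi' : i ≤ e) : G.Adj (c i) (c (i + 1)) := by
  by_cases h1 : -(e : ℤ) ≤ i
  · exact (((h.nbr i h1 hi') (c (i + 1))).2 (Or.inr rfl)).1
  · have := (((h.nbr (i + 1) (by omega) (by omega)) (c i)).2 (Or.inl (by simp))).1
    exact this.symm

theorem IsChain.core' {v : V} {c : ℤ → V} (h : IsChain G τ e v c) {i : ℤ}
    (hi : -(e + 1 : ℤ) ≤ i) (hi' : i ≤ e + 1) : Core G τ (c i) := by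
  by_cases h1 : i ≤ e
  · by_cases h2 : -(e : ℤ) ≤ i
    · exact h.core i h2 h1
    · exact (((h.nbr (i + 1) (by omega) (by omega)) (c i)).2 (Or.inl (by simp))).2
  · exact (((h.nbr (i - 1) (by omega) (by omega)) (c i)).2 (Or.inr (by simp))).2

theorem IsChain.reverse {v : V} {c : ℤ → V} (h : IsChain G τ e v c) :
    IsChain G τ e v (fun i => c (-i)) where
  zero := by simpa using h.zero
  core i h1 h2 := h.core (-i) (by omega) (by omega)
  nbr i h1 h2 u := by
    rw [h.nbr (-i) (by omega) (by omega), show -(i - 1) = -i + 1 by omega,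
      show -(i + 1) = -i - 1 by omega, or_comm]
  ne i h1 h2 := by
    have := h.ne (-i) (by omega) (by omega)
    rw [show -(i - 1) = -i + 1 by omega, show -(i + 1) = -i - 1 by omega]
    exact this.symm

theorem IsChain.nonBacktracking {v : V} {c : ℤ → V} (h : IsChain G τ e v c) {a : ℤ} {m : ℕ}
    (ha : -(e + 1 : ℤ) ≤ a) (hm : a + m ≤ e + 1) : NonBacktracking G (fun k => c (a + k)) m := by
  refine ⟨fun i hi => ?_, fun i hi => ?_⟩
  · have := h.adj (i := a + i) (by omega) (by omega)
    rwa [show a + (i : ℤ) + 1 = a + ((i + 1 : ℕ) : ℤ) by push_cast; ring] at this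
  · have := h.ne (a + i + 1) (by omega) (by omega)
    rwa [show a + (i : ℤ) + 1 + 1 = a + ((i + 2 : ℕ) : ℤ) by push_cast; ring,
      show a + (i : ℤ) + 1 - 1 = a + i by ring] at this

theorem IsChain.inj (hG : G.IsAcyclic) {v : V} {c : ℤ → V} (h : IsChain G τ e v c) {i j : ℤ}
    (hi : -(e + 1 : ℤ) ≤ i) (hi' : i ≤ e + 1) (hj : -(e + 1 : ℤ) ≤ j) (hj' : j ≤ e + 1)
    (hij : c i = c j) : i = j := by
  have hnb := h.nonBacktracking (a := -(e + 1 : ℤ)) (m := 2 * e + 2) le_rfl (by push_cast; omega)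
  have := hnb.injOn hG (i := (i + (e + 1)).toNat) (j := (j + (e + 1)).toNat) (by omega) (by omega)
    (by
      rw [Int.toNat_of_nonneg (by omega), Int.toNat_of_nonneg (by omega)]
      rwa [show -(e + 1 : ℤ) + (i + (e + 1)) = i by ring,
        show -(e + 1 : ℤ) + (j + (e + 1)) = j by ring])
  omega

theorem IsChain.edist_le {v : V} {c : ℤ → V} (h : IsChain G τ e v c) {i : ℤ} {m : ℕ}
    (hm : m ≤ e + 1) (hi : -(m : ℤ) ≤ i) (hi' : i ≤ m) : G.edist v (c i) ≤ (m : ℕ∞) := by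
  have key : ∀ {c : ℤ → V}, IsChain G τ e v c → ∀ k : ℕ, k ≤ m → G.edist v (c k) ≤ (m : ℕ∞) := by
    intro c h k hk
    have hnb := h.nonBacktracking (a := 0) (m := m) (by omega) (by omega)
    have := hnb.edist_le k hk
    simp only [zero_add, Nat.cast_zero, h.zero] at this
    exact edist_le_mono this hk
  rcases le_total 0 i with h0 | h0
  · have := key h i.toNat (by omega)
    rwa [Int.toNat_of_nonneg h0] at this
  · have := key h.reverse (-i).toNat (by omega)
    rwa [Int.toNat_of_nonneg (by omega), neg_neg] at this

/-- A path in the core that starts along a chain follows the chain. -/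
theorem IsChain.eq_of_nonBacktracking {v : V} {c : ℤ → V} (h : IsChain G τ e v c) {s : ℕ → V}
    {m : ℕ} (hs : NonBacktracking G s m) (hcore : ∀ i ≤ m, Core G τ (s i)) (hm : m ≤ e + 1)
    (h0 : s 0 = v) (h1 : s 1 = c 1) : ∀ i ≤ m, s i = c i := by
  have key : ∀ i : ℕ, i + 1 ≤ m → s i = c i ∧ s (i + 1) = c (i + 1) := by
    intro i
    induction i with
    | zero => intro _; exact ⟨by rw [h0]; exact h.zero.symm, by simpa using h1⟩
    | succ i ih =>
      intro hi
      obtain ⟨e1, e2⟩ := ih (by omega)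
      have e2' : s (i + 1) = c ((i + 1 : ℕ) : ℤ) := by rw [e2]; push_cast; rfl
      refine ⟨e2', ?_⟩
      have ha := hs.1 (i + 1) (by omega)
      rw [e2'] at ha
      rcases (h.nbr ((i + 1 : ℕ) : ℤ) (by omega) (by omega) _).1 ⟨ha, hcore _ (by omega)⟩ with h3 | h3
      · exfalso
        refine hs.2 i (by omega) ?_
        rw [e1, h3]; push_cast; congr 1; ring
      · rw [h3]
  intro i hi
  cases i with
  | zero => rw [h0]; exact h.zero.symm
  | succ i => rw [(key i hi).2]; push_cast; rfl

/-- The core nodes near the middle of a chain are on the chain. -/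
theorem IsChain.exists_eq_of_core {v z : V} {c : ℤ → V} (h : IsChain G τ e v c)
    (hv : Core G τ v) (hz : Core G τ z) {m : ℕ} (hm : m ≤ e) (hd : G.edist v z ≤ (m : ℕ∞)) :
    ∃ i : ℤ, -(m : ℤ) ≤ i ∧ i ≤ m ∧ z = c i := by
  have hr : G.Reachable v z := SimpleGraph.reachable_of_edist_ne_top fun ht => by
    rw [ht] at hd; simp at hd
  rw [← hr.coe_dist_eq_edist] at hd
  have hd' : G.dist v z ≤ m := by exact_mod_cast hd
  obtain ⟨s, hs0, hs1, hs⟩ := exists_nonBacktracking hr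
  have hcore := core_of_core_ends hs (by rwa [hs0]) (by rwa [hs1])
  rcases Nat.eq_zero_or_pos (G.dist v z) with h0 | h0
  · refine ⟨0, by omega, by omega, ?_⟩
    rw [h.zero, ← hs0, ← hs1, h0]
  have hk : ∀ {c : ℤ → V}, IsChain G τ e v c → s 1 = c 1 → z = c (G.dist v z) := by
    intro c h h1
    have := h.eq_of_nonBacktracking hs hcore (by omega) hs0 h1 _ le_rfl
    rwa [hs1] at this
  have ha := hs.1 0 (by omega)
  rw [hs0, ← h.zero] at ha
  rcases (h.nbr 0 (by omega) (by omega) _).1 ⟨ha, hcore 1 (by omega)⟩ with h3 | h3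
  · refine ⟨-(G.dist v z), by omega, by omega, ?_⟩
    exact hk h.reverse (by simpa using h3)
  · exact ⟨G.dist v z, by omega, by omega, hk h (by simpa using h3)⟩

/-- A path in the core through the middle of a chain runs along the chain, in one of the two
directions. -/
theorem IsChain.follow {v : V} {c : ℤ → V} (h : IsChain G τ e v c) {s : ℕ → V} {L i m : ℕ}
    (hs : NonBacktracking G s L) (hv : s i = v) (hm1 : 1 ≤ m) (hm : m ≤ e + 1) (hi : m ≤ i)
    (hi' : i + m ≤ L) (hcore : ∀ j, i ≤ j + m → j ≤ i + m → Core G τ (s j)) :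
    (∀ k ≤ m, s (i + k) = c k ∧ s (i - k) = c (-k)) ∨
      (∀ k ≤ m, s (i + k) = c (-k) ∧ s (i - k) = c k) := by
  have hf : NonBacktracking G (fun k => s (i + k)) m := by
    have := hs.shift (l := m) (k := i) (by omega)
    simpa only [add_comm] using this
  have hb : NonBacktracking G (fun k => s (i - k)) m := (hs.mono (l := i) (by omega)).rev hi
  have hne := hs.2 (i - 1) (by omega)
  rw [show i - 1 + 2 = i + 1 by omega] at hne
  have hn1 := (h.nbr 0 (by omega) (by omega) (s (i + 1))).1
    ⟨by rw [h.zero, ← hv]; exact hs.1 i (by omega), hcore _ (by omega) (by omega)⟩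
  have hn2 := (h.nbr 0 (by omega) (by omega) (s (i - 1))).1
    ⟨by
      rw [h.zero, ← hv]
      have := (hs.1 (i - 1) (by omega)).symm
      rwa [show i - 1 + 1 = i by omega] at this, hcore _ (by omega) (by omega)⟩
  simp only [zero_sub, zero_add] at hn1 hn2
  have key : ∀ {c : ℤ → V}, IsChain G τ e v c → s (i + 1) = c 1 → s (i - 1) = c (-1) →
      ∀ k ≤ m, s (i + k) = c k ∧ s (i - k) = c (-k) := by
    intro c h h1 h2 k hk
    exact ⟨h.eq_of_nonBacktracking hf (fun j hj => hcore _ (by omega) (by omega)) hm hv h1 k hk,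
      h.reverse.eq_of_nonBacktracking hb (fun j hj => hcore _ (by omega) (by omega)) hm hv h2 k hk⟩
  rcases hn1 with h1 | h1
  · right
    have h2 : s (i - 1) = c 1 := hn2.resolve_left fun h2 => hne (h2.trans h1.symm)
    have := key h.reverse h1 (by simpa using h2)
    simpa only [neg_neg] using this
  · left
    exact key h h1 (hn2.resolve_right fun h2 => hne (h2.trans h1.symm))

end Chain

/-! ### Cutting the long paths of the core -/

section Cut

variable {G : SimpleGraph ℕ} {τ e b : ℕ}

/-- A ruling set among the middles of chains, computed from the binary digits of the identifiers:
in step `j` the nodes whose digit `j` is one give way to nearby nodes whose digit `j` is zero and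
whose higher digits are the same. -/
def Ruling (G : SimpleGraph ℕ) (τ e : ℕ) : ℕ → ℕ → Prop
  | 0, v => ∃ c, IsChain G τ e v c
  | j + 1, v => Ruling G τ e j v ∧ (v / 2 ^ j % 2 = 0 ∨
      ∀ u, Ruling G τ e j u → G.edist v u ≤ (e : ℕ∞) → u / 2 ^ (j + 1) = v / 2 ^ (j + 1) →
        u / 2 ^ j % 2 = 1)

theorem Ruling.exists_chain : ∀ {j v : ℕ}, Ruling G τ e j v → ∃ c, IsChain G τ e v c
  | 0, _, h => h
  | _ + 1, _, h => Ruling.exists_chain h.1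

theorem Ruling.core {j v : ℕ} (h : Ruling G τ e j v) : Core G τ v := by
  obtain ⟨c, hc⟩ := h.exists_chain
  rw [← hc.zero]
  exact hc.core 0 (by omega) (by omega)

/-- After `j` steps, remaining nodes that are close to each other differ in a digit from the `j`-th
one on. Once all digits have been used, they are far apart. -/
theorem Ruling.eq_of_edist_le_of_div_eq {j : ℕ} : ∀ {u v : ℕ}, Ruling G τ e j u →
    Ruling G τ e j v → u / 2 ^ j = v / 2 ^ j → G.edist u v ≤ (e : ℕ∞) → u = v := by
  induction j with
  | zero => intro u v _ _ h _; simpa using h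
  | succ j ih =>
    intro u v hu hv h hd
    have hd' : G.edist v u ≤ (e : ℕ∞) := by rwa [SimpleGraph.edist_comm]
    have e1 : ∀ x : ℕ, x / 2 ^ j = 2 * (x / 2 ^ (j + 1)) + x / 2 ^ j % 2 := by
      intro x
      rw [pow_succ, ← Nat.div_div_eq_div_mul]
      omega
    have e2 : u / 2 ^ j % 2 = v / 2 ^ j % 2 := by
      rcases hu.2 with h1 | h1
      · rcases hv.2 with h2 | h2
        · omega
        · have := h2 u hu.1 hd' h; omega
      · have h3 := h1 v hv.1 hd h.symm
        rcases hv.2 with h2 | h2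
        · omega
        · have := h2 u hu.1 hd' h; omega
    exact ih hu.1 hv.1 (by rw [e1 u, e1 v, h, e2]) hd

/-- Every node that gives way in a step has a remaining node near by. -/
theorem Ruling.step {j v : ℕ} (h : Ruling G τ e j v) :
    ∃ u, Ruling G τ e (j + 1) u ∧ G.edist v u ≤ (e : ℕ∞) := by
  by_cases hv : Ruling G τ e (j + 1) v
  · exact ⟨v, hv, by simp⟩
  · simp only [Ruling, h, true_and, not_or, not_forall] at hv
    obtain ⟨-, u, hu, hd, -, hb⟩ := hv
    exact ⟨u, ⟨hu, Or.inl (by omega)⟩, hd⟩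

/-- The chain around a cut node; its direction is an arbitrary but fixed choice. -/
noncomputable def chainAt (G : SimpleGraph ℕ) (τ e v : ℕ) : ℤ → ℕ :=
  Classical.epsilon (IsChain G τ e v)

theorem Ruling.isChain {j v : ℕ} (h : Ruling G τ e j v) : IsChain G τ e v (chainAt G τ e v) :=
  Classical.epsilon_spec h.exists_chain

/-- `u w` is one of the edges at which the tree is cut. -/
def IsCut (G : SimpleGraph ℕ) (τ e b u w : ℕ) : Prop :=
  ∃ v, Ruling G τ e b v ∧ ((u = chainAt G τ e v 0 ∧ w = chainAt G τ e v 1) ∨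
    (u = chainAt G τ e v 1 ∧ w = chainAt G τ e v 0))

theorem IsCut.symm {u w : ℕ} (h : IsCut G τ e b u w) : IsCut G τ e b w u := by
  obtain ⟨v, hv, h⟩ := h
  exact ⟨v, hv, h.symm.imp (fun h => ⟨h.2, h.1⟩) fun h => ⟨h.2, h.1⟩⟩

/-- The graph without the edges at which it is cut. -/
def cutGraph (G : SimpleGraph ℕ) (τ e b : ℕ) : SimpleGraph ℕ where
  Adj u w := G.Adj u w ∧ ¬ IsCut G τ e b u w
  symm := ⟨fun _ _ h => ⟨h.1.symm, fun h' => h.2 h'.symm⟩⟩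
  loopless := ⟨fun _ h => h.1.ne rfl⟩

theorem cutGraph_le : cutGraph G τ e b ≤ G := fun _ _ h => h.1

/-- Every long path that is not cut has many nodes in the middle with a third core neighbour. -/
theorem exists_core_nbr_of_nonBacktracking (hτ : 1 ≤ τ) {s : ℕ → ℕ} {L i : ℕ}
    (hs : NonBacktracking (cutGraph G τ e b) s L) (hi : τ + b * e + e + 2 ≤ i)
    (hi' : i + (τ + b * e + e + 2) ≤ L) :
    ∃ i' q, i ≤ i' + e ∧ i' ≤ i + e ∧ G.Adj (s i') q ∧ Core G τ q ∧ q ≠ s (i' - 1) ∧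
      q ≠ s (i' + 1) := by
  have hsG : NonBacktracking G s L := ⟨fun j hj => (hs.1 j hj).1, hs.2⟩
  have hcore : ∀ j, τ ≤ j → j + τ ≤ L → Core G τ (s j) := fun j h1 h2 =>
    core_of_nonBacktracking hτ hsG h1 h2
  by_contra! hcon
  -- otherwise the path is a chain around its `i`-th node, and there is a cut node near by
  have h0 : Ruling G τ e 0 (s i) := by
    refine ⟨fun j => s (i + j).toNat, by simp, fun j h1 h2 => hcore _ (by omega) (by omega), ?_, ?_⟩
    · intro j h1 h2 u
      have e1 : (i + (j - 1)).toNat = (i + j).toNat - 1 := by omega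
      have e2 : (i + (j + 1)).toNat = (i + j).toNat + 1 := by omega
      rw [e1, e2]
      constructor
      · rintro ⟨ha, hc⟩
        by_cases hu : u = s ((i + j).toNat - 1)
        · exact Or.inl hu
        · exact Or.inr (hcon _ u (by omega) (by omega) ha hc hu)
      · rintro (rfl | rfl)
        · have := (hsG.1 ((i + j).toNat - 1) (by omega)).symm
          rw [show (i + j).toNat - 1 + 1 = (i + j).toNat by omega] at this
          exact ⟨this, hcore _ (by omega) (by omega)⟩
        · exact ⟨hsG.1 _ (by omega), hcore _ (by omega) (by omega)⟩
    · intro j h1 h2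
      have := hsG.2 ((i + j).toNat - 1) (by omega)
      rwa [show (i + j).toNat - 1 + 2 = (i + (j + 1)).toNat by omega,
        show (i + j).toNat - 1 = (i + (j - 1)).toNat by omega] at this
  have hrule : ∀ j ≤ b, ∃ i', i ≤ i' + j * e ∧ i' ≤ i + j * e ∧ Ruling G τ e j (s i') := by
    intro j
    induction j with
    | zero => intro _; exact ⟨i, by omega, by omega, h0⟩
    | succ j ih =>
      intro hj
      obtain ⟨i', h1, h2, h3⟩ := ih (by omega)
      have hje : (j + 1) * e ≤ b * e := Nat.mul_le_mul_right e hj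
      have hje' : (j + 1) * e = j * e + e := by ring
      obtain ⟨u, hu, hd⟩ := h3.step
      obtain ⟨c, hc⟩ := h3.exists_chain
      obtain ⟨l, hl1, hl2, rfl⟩ := hc.exists_eq_of_core h3.core hu.core le_rfl hd
      rcases hc.follow (m := e + 1) hsG rfl (by omega) le_rfl (by omega) (by omega)
        (fun k hk hk' => hcore _ (by omega) (by omega)) with hf | hf
      · rcases le_total 0 l with h | h
        · have := (hf l.toNat (by omega)).1
          rw [Int.toNat_of_nonneg h] at this
          exact ⟨i' + l.toNat, by omega, by omega, this ▸ hu⟩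
        · have := (hf (-l).toNat (by omega)).2
          rw [Int.toNat_of_nonneg (by omega), neg_neg] at this
          exact ⟨i' - (-l).toNat, by omega, by omega, this ▸ hu⟩
      · rcases le_total 0 l with h | h
        · have := (hf l.toNat (by omega)).2
          rw [Int.toNat_of_nonneg h] at this
          exact ⟨i' - l.toNat, by omega, by omega, this ▸ hu⟩
        · have := (hf (-l).toNat (by omega)).1
          rw [Int.toNat_of_nonneg (by omega), neg_neg] at this
          exact ⟨i' + (-l).toNat, by omega, by omega, this ▸ hu⟩
  obtain ⟨i', h1, h2, h3⟩ := hrule b le_rfl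
  have hc := h3.isChain
  have hcut : ∀ w, w = chainAt G τ e (s i') 1 → IsCut G τ e b (s i') w := fun w hw =>
    ⟨s i', h3, Or.inl ⟨hc.zero.symm, hw⟩⟩
  rcases hc.follow (m := 1) hsG rfl (by omega) (by omega) (by omega) (by omega)
    (fun k hk hk' => hcore _ (by omega) (by omega)) with hf | hf
  · exact (hs.1 i' (by omega)).2 (hcut _ (hf 1 le_rfl).1)
  · have := (hs.1 (i' - 1) (by omega)).symm
    rw [show i' - 1 + 1 = i' by omega] at this
    exact this.2 (hcut _ (hf 1 le_rfl).2)

/-- The pieces into which the tree is cut have small diameter: a long path that is not cut has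
many nodes with a third core neighbour, each of which is the root of a branch with more than `τ`
nodes. -/
theorem length_lt_of_nonBacktracking_cutGraph (hτ : 1 ≤ τ) (hG : G.IsAcyclic) {S : Finset ℕ}
    (hS : ∀ u w, G.Adj u w → u ∈ S) {s : ℕ → ℕ} {L q : ℕ}
    (hs : NonBacktracking (cutGraph G τ e b) s L) (hq : S.card < q * (τ + 1)) :
    L < 2 * (τ + b * e + e + 2) + (2 * e + 1) * q := by
  by_contra! hL
  set A := τ + b * e + e + 2 with hA
  have hsG : NonBacktracking G s L := ⟨fun j hj => (hs.1 j hj).1, hs.2⟩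
  have hidx : ∀ a : Fin q, A + (2 * e + 1) * a + e + A ≤ L := by
    intro a
    have : (2 * e + 1) * (a + 1) ≤ (2 * e + 1) * q := Nat.mul_le_mul_left _ a.2
    have h2 : (2 * e + 1) * ((a : ℕ) + 1) = (2 * e + 1) * a + (2 * e + 1) := by ring
    omega
  -- a branch in each of `q` disjoint stretches of `2 * e + 1` nodes
  have hex : ∀ a : Fin q, ∃ (i : ℕ) (t : ℕ → ℕ), A + (2 * e + 1) * a ≤ i ∧
      i ≤ A + (2 * e + 1) * a + 2 * e ∧ NonBacktracking G t (τ + 1) ∧ t 0 = s i ∧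
      t 1 ≠ s (i - 1) ∧ t 1 ≠ s (i + 1) := by
    intro a
    obtain ⟨i, x, h1, h2, h3, h4, h5, h6⟩ := exists_core_nbr_of_nonBacktracking hτ hs
      (i := A + (2 * e + 1) * a + e) (by omega) (by have := hidx a; omega)
    obtain ⟨t, ht0, ht1, ht⟩ := exists_nonBacktracking_of_not_low h3 (h4 _ h3.symm)
    exact ⟨i, t, by omega, by omega, ht, ht0, by rwa [ht1], by rwa [ht1]⟩
  choose i t hi1 hi2 ht ht0 ht1 ht2 using hex
  have hiL : ∀ a, i a ≤ L := fun a => by have := hidx a; have := hi2 a; omega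
  have happ := fun a : Fin q => (hsG.mono (hiL a)).append (ht a) (ht0 a) (fun _ _ => (ht1 a).symm)
  -- the nodes of the `q` branches are distinct: each is reached from the start of the path by only
  -- one non-backtracking walk, which shows where the branch leaves the path
  let F : Fin q × Fin (τ + 1) → S := fun p => ⟨t p.1 (p.2 + 1),
    hS _ _ ((ht p.1).1 p.2 p.2.2).symm⟩
  have hF : Function.Injective F := by
    have key : ∀ p p', F p = F p' → i p.1 + (p.2 + 1) = i p'.1 + (p'.2 + 1) ∧
        ¬ i p.1 < i p'.1 := by
      intro p p' hpp
      have hpp' : t p.1 (p.2 + 1) = t p'.1 (p'.2 + 1) := congrArg Subtype.val hpp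
      obtain ⟨h1, h2⟩ := ((happ p.1).mono (l := i p.1 + (p.2 + 1)) (by omega)).unique hG
        ((happ p'.1).mono (l := i p'.1 + (p'.2 + 1)) (by omega)) (by simp)
        (by simpa using hpp')
      refine ⟨h1, fun hlt => ?_⟩
      have h3 := h2 (i p.1 + 1) (by omega)
      rw [if_neg (by omega), if_pos (by omega), Nat.add_sub_cancel_left] at h3
      exact ht2 _ h3
    intro p p' hpp
    obtain ⟨h1, h2⟩ := key p p' hpp
    obtain ⟨-, h3⟩ := key p' p hpp.symm
    have e1 : i p.1 = i p'.1 := by omega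
    have e2 : p.1 = p'.1 := by
      have a1 := hi1 p.1
      have a2 := hi2 p.1
      have a3 := hi1 p'.1
      have a4 := hi2 p'.1
      rcases lt_trichotomy (p.1 : ℕ) p'.1 with h | h | h
      · have : (2 * e + 1) * ((p.1 : ℕ) + 1) ≤ (2 * e + 1) * p'.1 := Nat.mul_le_mul_left _ h
        have h5 : (2 * e + 1) * ((p.1 : ℕ) + 1) = (2 * e + 1) * p.1 + (2 * e + 1) := by ring
        omega
      · exact Fin.ext h
      · have : (2 * e + 1) * ((p'.1 : ℕ) + 1) ≤ (2 * e + 1) * p.1 := Nat.mul_le_mul_left _ h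
        have h5 : (2 * e + 1) * ((p'.1 : ℕ) + 1) = (2 * e + 1) * p'.1 + (2 * e + 1) := by ring
        omega
    exact Prod.ext e2 (Fin.ext (by omega))
  have hcard := Fintype.card_le_of_injective F hF
  rw [Fintype.card_prod, Fintype.card_fin, Fintype.card_fin, Fintype.card_coe] at hcard
  omega

end Cut

/-! ### Relations defined by blocks, and gluing -/

section Block

variable {I O : Type*} {P : LCL I O} {Δ τ : ℕ}

/-- The labels that the two core edges at `u` can have together: `p` is the pair of labels of the
edge to `y`, read towards `u`, and `q` that of the edge to `z`, read away from `u`. -/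
def BlockRel {V : Type*} (P : LCL I O) (Δ : ℕ) (G : SimpleGraph V) (inp : V → I) (τ : ℕ)
    (u y z : V) (p q : EdgeLabel Δ (I × O) P.r × EdgeLabel Δ (I × O) P.r) : Prop :=
  ∃ (out : V → O) (x : V → V → EdgeLabel Δ (I × O) P.r),
    (∀ w ∈ hang G τ u, NodeOK P Δ G inp out x w) ∧ (x y u, x u y) = p ∧ (x u z, x z u) = q

open Classical in
/-- The map that sends a set of nodes to a copy of it, the further node `z` to `b`, and everything
else to `a`. -/
noncomputable def blockMap {V W : Type*} (H : Set V) (j : V → W) (z : V) (a b : W) (w : V) : W :=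
  if w ∈ H then j w else if w = z then b else a

variable {V W : Type*} {G : SimpleGraph V} {S : SimpleGraph W}

/-- A copy of a hanging tree whose root has one further neighbour on either side looks locally
like the hanging tree itself. -/
theorem bijOn_blockMap (hτ : 1 ≤ τ) {u y z : V} (hu : Core G τ u)
    (hnbr : ∀ w, (G.Adj u w ∧ Core G τ w) ↔ (w = y ∨ w = z)) (hyz : y ≠ z) {j : V → W} {a b : W}
    (hj : Set.InjOn j (hang G τ u))
    (hS : ∀ w ∈ hang G τ u, w ≠ u → S.neighborSet (j w) = j '' G.neighborSet w)
    (hSu : S.neighborSet (j u) = j '' {w | w ∈ hang G τ u ∧ G.Adj u w} ∪ {a, b})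
    (ha : ∀ w ∈ hang G τ u, j w ≠ a) (hb : ∀ w ∈ hang G τ u, j w ≠ b) (hab : a ≠ b) :
    ∀ w ∈ hang G τ u,
      Set.BijOn (blockMap (hang G τ u) j z a b) (G.neighborSet w) (S.neighborSet (j w)) := by
  classical
  have hin : ∀ w ∈ hang G τ u, blockMap (hang G τ u) j z a b w = j w := fun w hw => if_pos hw
  have hy := (hnbr y).2 (Or.inl rfl)
  have hz := (hnbr z).2 (Or.inr rfl)
  have hyH : y ∉ hang G τ u := fun h => (mem_hang_iff_of_adj hτ hu hy.1).1 h hy.2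
  have hzH : z ∉ hang G τ u := fun h => (mem_hang_iff_of_adj hτ hu hz.1).1 h hz.2
  have hEz : blockMap (hang G τ u) j z a b z = b := by simp [blockMap, hzH]
  have hEy : blockMap (hang G τ u) j z a b y = a := by simp [blockMap, hyH, hyz]
  intro w hw
  by_cases hwu : w = u
  · subst hwu
    rw [hSu]
    have hcase : ∀ w', G.Adj w w' → w' ∈ hang G τ w ∨ w' = y ∨ w' = z := by
      intro w' ha'
      by_cases hc : Core G τ w'
      · exact Or.inr ((hnbr w').1 ⟨ha', hc⟩)
      · exact Or.inl ((mem_hang_iff_of_adj hτ hu ha').2 hc)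
    refine ⟨?_, ?_, ?_⟩
    · intro w' ha'
      rcases hcase w' ha' with h | rfl | rfl
      · rw [hin _ h]; exact Or.inl ⟨w', ⟨h, ha'⟩, rfl⟩
      · rw [hEy]; simp
      · rw [hEz]; simp
    · intro w1 h1 w2 h2 heq
      rcases hcase w1 h1 with h1' | rfl | rfl <;> rcases hcase w2 h2 with h2' | rfl | rfl
      · rw [hin _ h1', hin _ h2'] at heq; exact hj h1' h2' heq
      · rw [hin _ h1', hEy] at heq; exact absurd heq (ha _ h1')
      · rw [hin _ h1', hEz] at heq; exact absurd heq (hb _ h1')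
      · rw [hin _ h2', hEy] at heq; exact absurd heq.symm (ha _ h2')
      · rfl
      · rw [hEz, hEy] at heq; exact absurd heq hab
      · rw [hin _ h2', hEz] at heq; exact absurd heq.symm (hb _ h2')
      · rw [hEz, hEy] at heq; exact absurd heq.symm hab
      · rfl
    · rintro _ (⟨w', ⟨h1, h2⟩, rfl⟩ | rfl | rfl)
      · exact ⟨w', h2, hin _ h1⟩
      · exact ⟨y, hy.1, hEy⟩
      · exact ⟨z, hz.1, hEz⟩
  · rw [hS w hw hwu]
    have hsub : ∀ w' ∈ G.neighborSet w, w' ∈ hang G τ u := fun w' h =>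
      mem_hang_of_adj hτ hu hw hwu h
    have h1 : Set.BijOn j (G.neighborSet w) (j '' G.neighborSet w) :=
      (hj.mono hsub).bijOn_image
    exact h1.congr fun w' h => (hin w' (hsub w' h)).symm

/-- A solution around a copy of a hanging tree shows that the labels of the two edges at its root
are compatible. -/
theorem blockRel_of_nodeOK (hτ : 1 ≤ τ) {u y z : V} (hu : Core G τ u)
    (hnbr : ∀ w, (G.Adj u w ∧ Core G τ w) ↔ (w = y ∨ w = z)) (hyz : y ≠ z) {j : V → W} {a b : W}
    (hbij : ∀ w ∈ hang G τ u,
      Set.BijOn (blockMap (hang G τ u) j z a b) (G.neighborSet w) (S.neighborSet (j w)))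
    {inp : V → I} {inpS : W → I} {outS : W → O} {xS : W → W → EdgeLabel Δ (I × O) P.r}
    (hinp : ∀ w ∈ hang G τ u, inpS (j w) = inp w)
    (hok : ∀ w ∈ hang G τ u, NodeOK P Δ S inpS outS xS (j w)) :
    BlockRel P Δ G inp τ u y z (xS a (j u), xS (j u) a) (xS (j u) b, xS b (j u)) := by
  classical
  have hin : ∀ w ∈ hang G τ u, blockMap (hang G τ u) j z a b w = j w := fun w hw => if_pos hw
  have hy := (hnbr y).2 (Or.inl rfl)
  have hz := (hnbr z).2 (Or.inr rfl)
  have hyH : y ∉ hang G τ u := fun h => (mem_hang_iff_of_adj hτ hu hy.1).1 h hy.2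
  have hzH : z ∉ hang G τ u := fun h => (mem_hang_iff_of_adj hτ hu hz.1).1 h hz.2
  have hEz : blockMap (hang G τ u) j z a b z = b := by simp [blockMap, hzH]
  have hEy : blockMap (hang G τ u) j z a b y = a := by simp [blockMap, hyH, hyz]
  set E := blockMap (hang G τ u) j z a b with hE
  refine ⟨fun w => outS (E w), fun w w' => xS (E w) (E w'), fun w hw => ?_, ?_, ?_⟩
  · refine (nodeOK_iff_of_bijOn (φ := E) (hbij w hw) (hinp w hw) ?_ ?_).1 (hok w hw)
    · rw [hin w hw]
    · intro w' _
      rw [hin w hw]; exact ⟨rfl, rfl⟩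
  · dsimp only; rw [hEy, hin u (mem_hang_self u)]
  · dsimp only; rw [hEz, hin u (mem_hang_self u)]

/-- Solutions on the parts of a partition that agree on the edges between the parts can be glued. -/
theorem exists_nodeOK_of_parts {ι : Type*} {inp : V → I} (K : Set V) (β : V → ι)
    (out : ι → V → O) (x : ι → V → V → EdgeLabel Δ (I × O) P.r)
    (hok : ∀ w ∈ K, NodeOK P Δ G inp (out (β w)) (x (β w)) w)
    (hx : ∀ w ∈ K, ∀ u ∈ K, G.Adj w u → x (β u) u w = x (β w) u w) :
    ∃ (out' : V → O) (x' : V → V → EdgeLabel Δ (I × O) P.r),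
      (∀ w ∈ K, NodeOK P Δ G inp out' x' w) ∧ (∀ w, out' w = out (β w) w) ∧
      ∀ w ∈ K, ∀ u, G.Adj w u → x' w u = x (β w) w u ∧ x' u w = x (β w) u w := by
  classical
  have key : ∀ w ∈ K, ∀ u, G.Adj w u →
      (if w ∈ K then x (β w) w u else x (β u) w u) = x (β w) w u ∧
      (if u ∈ K then x (β u) u w else x (β w) u w) = x (β w) u w := by
    intro w hw u ha
    refine ⟨if_pos hw, ?_⟩
    split_ifs with hu
    · exact hx w hw u hu ha
    · rfl
  exact ⟨fun w => out (β w) w, fun u w => if u ∈ K then x (β u) u w else x (β w) u w,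
    fun w hw => (hok w hw).congr rfl (key w hw), fun w => rfl, key⟩

end Block

/-! ### Strips and spiders -/

section Strip

variable {V ι : Type*} {G : SimpleGraph V}

/-- Copies of the graphs that `G` induces on `H 0, H 1, …`, successive copies being joined by an
edge between the nodes `ρ t ∈ H t`. -/
def stripGraph (G : SimpleGraph V) (H : ℕ → Set V) (ρ : ℕ → V) : SimpleGraph (ℕ × V) where
  Adj p p' := (p.1 = p'.1 ∧ p.2 ∈ H p.1 ∧ p'.2 ∈ H p.1 ∧ G.Adj p.2 p'.2) ∨
    (p'.1 = p.1 + 1 ∧ p.2 = ρ p.1 ∧ p'.2 = ρ p'.1) ∨ (p.1 = p'.1 + 1 ∧ p.2 = ρ p.1 ∧ p'.2 = ρ p'.1)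
  symm := ⟨by
    rintro ⟨t, w⟩ ⟨t', w'⟩ h
    dsimp only at h ⊢
    rcases h with ⟨rfl, h1, h2, h3⟩ | ⟨h1, h2, h3⟩ | ⟨h1, h2, h3⟩
    · exact Or.inl ⟨rfl, h2, h1, h3.symm⟩
    · exact Or.inr (Or.inr ⟨h1, h3, h2⟩)
    · exact Or.inr (Or.inl ⟨h1, h3, h2⟩)⟩
  loopless := ⟨by
    rintro ⟨t, w⟩ h
    dsimp only at h
    rcases h with ⟨_, _, _, h3⟩ | ⟨h1, _⟩ | ⟨h1, _⟩
    · exact h3.ne rfl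
    · omega
    · omega⟩

variable {H : ℕ → Set V} {ρ : ℕ → V}

theorem stripGraph_adj {t t' : ℕ} {w w' : V} : (stripGraph G H ρ).Adj (t, w) (t', w') ↔
    (t = t' ∧ w ∈ H t ∧ w' ∈ H t ∧ G.Adj w w') ∨ (t' = t + 1 ∧ w = ρ t ∧ w' = ρ t') ∨
      (t = t' + 1 ∧ w = ρ t ∧ w' = ρ t') := Iff.rfl

theorem neighborSet_stripGraph_of_ne {t : ℕ} {w : V} (hw : w ∈ H t) (hne : w ≠ ρ t)
    (hcl : ∀ w', G.Adj w w' → w' ∈ H t) :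
    (stripGraph G H ρ).neighborSet (t, w) = (fun w' => (t, w')) '' G.neighborSet w := by
  ext ⟨t', w'⟩
  simp only [SimpleGraph.mem_neighborSet, stripGraph_adj, Set.mem_image, Prod.mk.injEq]
  constructor
  · rintro (⟨rfl, _, _, h⟩ | ⟨_, h, _⟩ | ⟨_, h, _⟩)
    · exact ⟨w', h, rfl, rfl⟩
    · exact absurd h hne
    · exact absurd h hne
  · rintro ⟨w'', h, rfl, rfl⟩
    exact Or.inl ⟨rfl, hw, hcl _ h, h⟩

theorem neighborSet_stripGraph_root {t : ℕ} (ht : 1 ≤ t) (hρ : ρ t ∈ H t) :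
    (stripGraph G H ρ).neighborSet (t, ρ t) =
      (fun w' => (t, w')) '' {w | w ∈ H t ∧ G.Adj (ρ t) w} ∪
        {(t - 1, ρ (t - 1)), (t + 1, ρ (t + 1))} := by
  ext ⟨t', w'⟩
  simp only [SimpleGraph.mem_neighborSet, stripGraph_adj, Set.mem_image, Prod.mk.injEq,
    Set.mem_union, Set.mem_insert_iff, Set.mem_singleton_iff, Set.mem_ofPred_eq]
  constructor
  · rintro (⟨rfl, _, h, h'⟩ | ⟨rfl, _, rfl⟩ | ⟨h, _, rfl⟩)
    · exact Or.inl ⟨w', ⟨h, h'⟩, rfl, rfl⟩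
    · exact Or.inr (Or.inr ⟨rfl, rfl⟩)
    · obtain rfl : t' = t - 1 := by omega
      exact Or.inr (Or.inl ⟨rfl, rfl⟩)
  · rintro (⟨w'', ⟨h, h'⟩, rfl, rfl⟩ | ⟨rfl, rfl⟩ | ⟨rfl, rfl⟩)
    · exact Or.inl ⟨rfl, hρ, h, h'⟩
    · exact Or.inr (Or.inr ⟨by omega, trivial, rfl⟩)
    · exact Or.inr (Or.inl ⟨rfl, trivial, rfl⟩)

/-- A central piece `B₀` with edges `G₀`, and for every `a ∈ 𝒜` a strip of length `len a` whose
first root is joined to the node `att a` of the central piece. -/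
def spider (G G₀ : SimpleGraph V) (B₀ : Set V) (𝒜 : Set ι) (att : ι → V) (H : ι → ℕ → Set V)
    (ρ : ι → ℕ → V) (len : ι → ℕ) : SimpleGraph (V ⊕ (ι × ℕ × V)) where
  Adj x y := match x, y with
    | .inl w, .inl w' => w ∈ B₀ ∧ w' ∈ B₀ ∧ G₀.Adj w w'
    | .inl w, .inr (a, t, w') => a ∈ 𝒜 ∧ t = 0 ∧ w = att a ∧ w' = ρ a 0
    | .inr (a, t, w'), .inl w => a ∈ 𝒜 ∧ t = 0 ∧ w = att a ∧ w' = ρ a 0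
    | .inr (a, t, w), .inr (a', t', w') => a = a' ∧ a ∈ 𝒜 ∧ t < len a ∧ t' < len a ∧
        (stripGraph G (H a) (ρ a)).Adj (t, w) (t', w')
  symm := ⟨by
    rintro (w | ⟨a, t, w⟩) (w' | ⟨a', t', w'⟩) h
    · exact ⟨h.2.1, h.1, h.2.2.symm⟩
    · exact h
    · exact h
    · obtain ⟨rfl, h1, h2, h3, h4⟩ := h
      exact ⟨rfl, h1, h3, h2, h4.symm⟩⟩
  loopless := ⟨by
    rintro (w | ⟨a, t, w⟩) h
    · exact h.2.2.ne rfl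
    · exact h.2.2.2.2.ne rfl⟩

/-- The nodes of a spider. -/
def spiderNodes (B₀ : Set V) (𝒜 : Set ι) (H : ι → ℕ → Set V) (len : ι → ℕ) :
    Set (V ⊕ (ι × ℕ × V)) :=
  {x | match x with
    | .inl w => w ∈ B₀
    | .inr (a, t, w) => a ∈ 𝒜 ∧ t < len a ∧ w ∈ H a t}

variable {G₀ : SimpleGraph V} {B₀ : Set V} {𝒜 : Set ι} {att : ι → V}
  {H : ι → ℕ → Set V} {ρ : ι → ℕ → V} {len : ι → ℕ}

theorem inr_mem_spiderNodes {a : ι} {w : V} {t : ℕ} :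
    (.inr (a, t, w) : V ⊕ (ι × ℕ × V)) ∈ spiderNodes B₀ 𝒜 H len ↔
      a ∈ 𝒜 ∧ t < len a ∧ w ∈ H a t := Iff.rfl

theorem spider_inr_inl {a : ι} {w w' : V} {t : ℕ} :
    (spider G G₀ B₀ 𝒜 att H ρ len).Adj (.inr (a, t, w')) (.inl w) ↔
      a ∈ 𝒜 ∧ t = 0 ∧ w = att a ∧ w' = ρ a 0 := Iff.rfl

theorem spider_inr_inr {a a' : ι} {w w' : V} {t t' : ℕ} :
    (spider G G₀ B₀ 𝒜 att H ρ len).Adj (.inr (a, t, w)) (.inr (a', t', w')) ↔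
      a = a' ∧ a ∈ 𝒜 ∧ t < len a ∧ t' < len a ∧
        (stripGraph G (H a) (ρ a)).Adj (t, w) (t', w') := Iff.rfl

/-- The root of the copy before the `t`-th one in the strip `a`. -/
def spiderPrev (att : ι → V) (ρ : ι → ℕ → V) (a : ι) (t : ℕ) : V ⊕ (ι × ℕ × V) :=
  if t = 0 then .inl (att a) else .inr (a, t - 1, ρ a (t - 1))

theorem neighborSet_spider_of_ne {a : ι} {w : V} {t : ℕ} (ha : a ∈ 𝒜) (ht : t < len a)
    (hρ : ρ a t ∈ H a t) (hw : w ∈ H a t) (hne : w ≠ ρ a t)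
    (hcl : ∀ w', G.Adj w w' → w' ∈ H a t) :
    (spider G G₀ B₀ 𝒜 att H ρ len).neighborSet (.inr (a, t, w)) =
      (fun w' => .inr (a, t, w')) '' G.neighborSet w := by
  ext x
  rcases x with w' | ⟨a', t', w'⟩
  · simp only [SimpleGraph.mem_neighborSet, spider_inr_inl, Set.mem_image, reduceCtorEq, and_false,
      exists_false, iff_false]
    rintro ⟨_, rfl, _, h⟩
    exact hne h
  · simp only [SimpleGraph.mem_neighborSet, spider_inr_inr, stripGraph_adj, Set.mem_image,
      Sum.inr.injEq, Prod.mk.injEq]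
    constructor
    · rintro ⟨rfl, _, _, _, ⟨rfl, _, _, h⟩ | ⟨_, h, _⟩ | ⟨_, h, _⟩⟩
      · exact ⟨w', h, rfl, rfl, rfl⟩
      · exact absurd h hne
      · exact absurd h hne
    · rintro ⟨w'', h, rfl, rfl, rfl⟩
      exact ⟨rfl, ha, ht, ht, Or.inl ⟨rfl, hw, hcl _ h, h⟩⟩

theorem neighborSet_spider_root {a : ι} {t : ℕ} (ha : a ∈ 𝒜) (ht : t + 1 < len a)
    (hρ : ρ a t ∈ H a t) :
    (spider G G₀ B₀ 𝒜 att H ρ len).neighborSet (.inr (a, t, ρ a t)) =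
      (fun w' => .inr (a, t, w')) '' {w | w ∈ H a t ∧ G.Adj (ρ a t) w} ∪
        {spiderPrev att ρ a t, .inr (a, t + 1, ρ a (t + 1))} := by
  ext x
  rcases x with w' | ⟨a', t', w'⟩
  · simp only [SimpleGraph.mem_neighborSet, spider_inr_inl, Set.mem_image, reduceCtorEq, and_false,
      exists_false, Set.mem_union, false_or, Set.mem_insert_iff, Set.mem_singleton_iff, or_false,
      spiderPrev]
    constructor
    · rintro ⟨_, rfl, rfl, _⟩; simp
    · intro h
      split_ifs at h with h0
      exact ⟨ha, h0, Sum.inl.inj h, by rw [h0]⟩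
  · simp only [SimpleGraph.mem_neighborSet, spider_inr_inr, stripGraph_adj, Set.mem_image,
      Set.mem_union, Set.mem_insert_iff, Set.mem_singleton_iff, Set.mem_ofPred_eq,
      Sum.inr.injEq, Prod.mk.injEq, spiderPrev]
    constructor
    · rintro ⟨rfl, _, _, _, ⟨rfl, _, h, h'⟩ | ⟨rfl, _, rfl⟩ | ⟨h, _, rfl⟩⟩
      · exact Or.inl ⟨w', ⟨h, h'⟩, rfl, rfl, rfl⟩
      · exact Or.inr (Or.inr ⟨rfl, rfl, rfl⟩)
      · refine Or.inr (Or.inl ?_)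
        rw [if_neg (by omega), show t' = t - 1 by omega]
    · rintro (⟨w'', ⟨h, h'⟩, rfl, rfl, rfl⟩ | h | ⟨rfl, rfl, rfl⟩)
      · exact ⟨rfl, ha, by omega, by omega, Or.inl ⟨rfl, hρ, h, h'⟩⟩
      · split_ifs at h with h0
        simp only [Sum.inr.injEq, Prod.mk.injEq] at h
        obtain ⟨rfl, rfl, rfl⟩ := h
        exact ⟨rfl, ha, by omega, by omega, Or.inr (Or.inr ⟨by omega, trivial, rfl⟩)⟩
      · exact ⟨rfl, ha, by omega, by omega, Or.inr (Or.inl ⟨rfl, trivial, rfl⟩)⟩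

/-- A spider is a tree: ranked by the number of the block and then by the distance from the root of
the block, every node but one has exactly one neighbour of smaller rank. -/
theorem isTree_spider (hG : G.IsAcyclic) (hG₀ : G₀.IsAcyclic) {r : V} (hr : r ∈ B₀)
    (hB₀ : ∀ w ∈ B₀, G₀.Reachable r w) (hB₀' : ∀ w ∈ B₀, ∀ w', G₀.Adj w w' → w' ∈ B₀)
    (hatt : ∀ a ∈ 𝒜, att a ∈ B₀) (hρ : ∀ a ∈ 𝒜, ∀ t < len a, ρ a t ∈ H a t)
    (hH : ∀ a ∈ 𝒜, ∀ t < len a, ∀ w ∈ H a t, G.Reachable (ρ a t) w ∧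
      (w ≠ ρ a t → ∀ w', G.Adj w w' → w' ∈ H a t)) :
    ((spider G G₀ B₀ 𝒜 att H ρ len).induce (spiderNodes B₀ 𝒜 H len)).IsTree := by
  let rk : V ⊕ (ι × ℕ × V) → ℕ ×ₗ ℕ := fun x => match x with
    | .inl w => toLex (0, G₀.dist r w)
    | .inr (a, t, w) => toLex (t + 1, G.dist (ρ a t) w)
  have hle : ∀ {i j i' j' : ℕ}, (toLex (i, j) : ℕ ×ₗ ℕ) ≤ toLex (i', j') ↔
      i < i' ∨ i = i' ∧ j ≤ j' := fun {i j i' j'} => Prod.Lex.toLex_le_toLex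
  have hlt : ∀ {i j i' j' : ℕ}, (toLex (i, j) : ℕ ×ₗ ℕ) < toLex (i', j') ↔
      i < i' ∨ i = i' ∧ j < j' := fun {i j i' j'} => Prod.Lex.toLex_lt_toLex
  refine isTree_of_rank (fun x => rk x.1) ⟨.inl r, hr⟩ ?_ ?_
  · rintro ⟨x, hx⟩ ⟨y, hy⟩ ⟨y', hy'⟩ h h' hk hk'
    refine Subtype.ext ?_
    change (spider G G₀ B₀ 𝒜 att H ρ len).Adj x y at h
    change (spider G G₀ B₀ 𝒜 att H ρ len).Adj x y' at h'
    dsimp only at hk hk' ⊢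
    rcases x with w | ⟨a, t, w⟩
    · -- only neighbours in the central piece can have smaller rank
      have hcase : ∀ y, (spider G G₀ B₀ 𝒜 att H ρ len).Adj (.inl w) y → rk y ≤ rk (.inl w) →
          ∃ z, y = .inl z ∧ G₀.Adj w z ∧ G₀.dist r z ≤ G₀.dist r w := by
        rintro (z | ⟨a', t', z⟩) hz hzk
        · have := hle.1 hzk
          exact ⟨z, rfl, hz.2.2, by omega⟩
        · have := hle.1 hzk
          omega
      obtain ⟨z, rfl, hz1, hz2⟩ := hcase y h hk
      obtain ⟨z', rfl, hz1', hz2'⟩ := hcase y' h' hk'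
      rw [eq_of_adj_of_dist_le hG₀ (hB₀ w hx) hz1 hz1' hz2 hz2']
    · obtain ⟨ha, ht, hw⟩ := hx
      have hcase : ∀ y, (spider G G₀ B₀ 𝒜 att H ρ len).Adj (.inr (a, t, w)) y →
          rk y ≤ rk (.inr (a, t, w)) →
          (∃ z, y = .inr (a, t, z) ∧ G.Adj w z ∧ G.dist (ρ a t) z ≤ G.dist (ρ a t) w) ∨
          (w = ρ a t ∧ y = spiderPrev att ρ a t) := by
        rintro (z | ⟨a', t', z⟩) hz hzk
        · obtain ⟨_, rfl, rfl, rfl⟩ := hz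
          exact Or.inr ⟨rfl, by simp [spiderPrev]⟩
        · obtain ⟨rfl, _, _, _, hs⟩ := hz
          have hzk' := hle.1 hzk
          rcases stripGraph_adj.1 hs with ⟨rfl, h1, h2, h3⟩ | ⟨h1, h2, h3⟩ | ⟨h1, h2, h3⟩
          · exact Or.inl ⟨z, rfl, h3, by omega⟩
          · omega
          · refine Or.inr ⟨h2, ?_⟩
            simp only [spiderPrev]
            rw [if_neg (by omega), h3, show t' = t - 1 by omega]
      have hno : ∀ z, w = ρ a t → G.Adj w z → ¬ G.dist (ρ a t) z ≤ G.dist (ρ a t) w := by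
        rintro z rfl h1 h2
        rw [SimpleGraph.dist_self] at h2
        have := SimpleGraph.dist_eq_one_iff_adj.2 h1
        omega
      rcases hcase y h hk with ⟨z, rfl, h1, h2⟩ | ⟨h1, h2⟩ <;>
        rcases hcase y' h' hk' with ⟨z', rfl, h1', h2'⟩ | ⟨h1', h2'⟩
      · rw [eq_of_adj_of_dist_le hG (hH a ha t ht w hw).1 h1 h1' h2 h2']
      · exact absurd h2 (hno z h1' h1)
      · exact absurd h2' (hno z' h1 h1')
      · rw [h2, h2']
  · rintro ⟨x, hx⟩ hne
    have hne' : x ≠ .inl r := fun h => hne (Subtype.ext h)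
    suffices hsuf : ∃ y ∈ spiderNodes B₀ 𝒜 H len,
        (spider G G₀ B₀ 𝒜 att H ρ len).Adj x y ∧ rk y < rk x by
      obtain ⟨y, hy, h1, h2⟩ := hsuf
      exact ⟨⟨y, hy⟩, h1, h2⟩
    rcases x with w | ⟨a, t, w⟩
    · obtain ⟨y, hy, hd⟩ := exists_adj_dist_lt (hB₀ w hx) (fun h => hne' (by rw [h]))
      have hyB := hB₀' w hx y hy
      exact ⟨.inl y, hyB, ⟨hx, hyB, hy⟩, hlt.2 (Or.inr ⟨rfl, hd⟩)⟩
    · obtain ⟨ha, ht, hw⟩ := hx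
      by_cases hwr : w = ρ a t
      · subst hwr
        rcases Nat.eq_zero_or_pos t with rfl | h0
        · exact ⟨.inl (att a), hatt a ha, ⟨ha, rfl, rfl, rfl⟩, hlt.2 (Or.inl (by omega))⟩
        · refine ⟨.inr (a, t - 1, ρ a (t - 1)), ⟨ha, by omega, hρ a ha _ (by omega)⟩,
            ⟨rfl, ha, ht, by omega, ?_⟩, hlt.2 (Or.inl (by omega))⟩
          exact stripGraph_adj.2 (Or.inr (Or.inr ⟨by omega, rfl, rfl⟩))
      · obtain ⟨h1, h2⟩ := hH a ha t ht w hw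
        obtain ⟨y, hy, hd⟩ := exists_adj_dist_lt h1 hwr
        have hyH := h2 hwr y hy
        refine ⟨.inr (a, t, y), ⟨ha, ht, hyH⟩, ⟨rfl, ha, ht, ht, ?_⟩, hlt.2 (Or.inr ⟨rfl, hd⟩)⟩
        exact stripGraph_adj.2 (Or.inl ⟨rfl, hw, hyH, hy⟩)

end Strip

/-! ### The pieces of a cut tree and their arms -/

section Arm

theorem IsChain.mono {V : Type*} {G : SimpleGraph V} {τ e e' : ℕ} {v : V} {c : ℤ → V}
    (h : IsChain G τ e v c) (he : e' ≤ e) : IsChain G τ e' v c :=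
  ⟨h.zero, fun i h1 h2 => h.core i (by omega) (by omega),
    fun i h1 h2 => h.nbr i (by omega) (by omega), fun i h1 h2 => h.ne i (by omega) (by omega)⟩

theorem IsChain.reflect {V : Type*} {G : SimpleGraph V} {τ e : ℕ} {v : V} {c : ℤ → V}
    (h : IsChain G τ (e + 1) v c) : IsChain G τ e (c 1) (fun i => c (1 - i)) where
  zero := by simp
  core i h1 h2 := h.core (1 - i) (by push_cast; omega) (by push_cast; omega)
  nbr i h1 h2 u := by
    rw [h.nbr (1 - i) (by push_cast; omega) (by push_cast; omega),
      show 1 - (i - 1) = 1 - i + 1 by omega, show 1 - (i + 1) = 1 - i - 1 by omega, or_comm]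
  ne i h1 h2 := by
    have := h.ne (1 - i) (by push_cast; omega) (by push_cast; omega)
    rw [show 1 - (i - 1) = 1 - i + 1 by omega, show 1 - (i + 1) = 1 - i - 1 by omega]
    exact this.symm

/-- The two sides `(v, true)` and `(v, false)` of the cut edge of `v` parametrize the chain at `v`
in the two directions, such that the end of the cut edge on the side in question is at `0` and the
other end is at `1`. Distinct cut nodes have distance more than `2 * h + 2`, which keeps the first
`h` nodes of different arms apart. -/
noncomputable def arm (G : SimpleGraph ℕ) (τ h : ℕ) (α : ℕ × Bool) (i : ℤ) : ℕ :=
  chainAt G τ (2 * h + 2) α.1 (if α.2 then i else 1 - i)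

/-- The other side of a cut edge. -/
def opp (α : ℕ × Bool) : ℕ × Bool := (α.1, !α.2)

/-- `α` is a side of a cut edge. -/
def IsArm (G : SimpleGraph ℕ) (τ h b : ℕ) (α : ℕ × Bool) : Prop := Ruling G τ (2 * h + 2) b α.1

/-- The first `h` nodes of an arm, with the trees that hang off the core there. -/
def nearBlock (G : SimpleGraph ℕ) (τ h : ℕ) (α : ℕ × Bool) : Set ℕ :=
  {w | ∃ s < h, w ∈ hang G τ (arm G τ h α (-(s : ℤ)))}

/-- The graph without the edges between the near blocks of the arms and the rest. -/
def baseGraph (G : SimpleGraph ℕ) (τ h b : ℕ) : SimpleGraph ℕ where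
  Adj u w := G.Adj u w ∧ ∀ α, IsArm G τ h b α →
    ¬ ((u = arm G τ h α (-(h : ℤ)) ∧ w = arm G τ h α (1 - h)) ∨
      (u = arm G τ h α (1 - h) ∧ w = arm G τ h α (-(h : ℤ))))
  symm := ⟨fun _ _ h => ⟨h.1.symm, fun α hα h' => h.2 α hα (h'.symm.imp And.symm And.symm)⟩⟩
  loopless := ⟨fun _ h => h.1.ne rfl⟩

theorem baseGraph_le {G : SimpleGraph ℕ} {τ h b : ℕ} : baseGraph G τ h b ≤ G := fun _ _ h => h.1

/-- The nodes of the base that contains `r`, and the near blocks of the arms attached to it. -/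
def piece (G : SimpleGraph ℕ) (τ h b r : ℕ) : Set ℕ :=
  {w | (baseGraph G τ h b).Reachable r w ∨
    ∃ α, IsArm G τ h b α ∧ (baseGraph G τ h b).Reachable r (arm G τ h α (-(h : ℤ))) ∧
      w ∈ nearBlock G τ h α}

/-- The assumptions on a network whose nodes are their identifiers, together with the parameters:
`τ` is the height below which branches are pruned, `h` is the length of the near blocks, and the
identifiers have `b` digits. -/
structure Admissible (G : SimpleGraph ℕ) (Δ τ h b : ℕ) : Prop where
  acyclic : G.IsAcyclic
  degree : ∀ v, (G.neighborSet v).encard ≤ (Δ : ℕ∞)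
  one_le_τ : 1 ≤ τ
  one_le_h : 1 ≤ h
  ident : ∀ u w, G.Adj u w → 1 ≤ u ∧ u < 2 ^ b

variable {G : SimpleGraph ℕ} {Δ τ h b r : ℕ} {α β : ℕ × Bool}

theorem arm_opp (i : ℤ) : arm G τ h (opp α) i = arm G τ h α (1 - i) := by
  rcases α with ⟨v, _ | _⟩ <;> simp [arm, opp]

theorem IsArm.opp (hα : IsArm G τ h b α) : IsArm G τ h b (opp α) := hα

/-- The arm is a chain around the end of the cut edge on its own side; one node is lost where the
chain of the cut node is reversed. -/
theorem IsArm.isChain (hα : IsArm G τ h b α) :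
    IsChain G τ (2 * h + 1) (arm G τ h α 0) (arm G τ h α) := by
  have hc := Ruling.isChain hα
  rcases α with ⟨v, _ | _⟩
  · have := IsChain.reflect (e := 2 * h + 1) hc
    have h0 : arm G τ h (v, false) = fun i => chainAt G τ (2 * h + 2) v (1 - i) := by
      funext i; simp [arm]
    rw [h0]
    exact this
  · have := hc.mono (e' := 2 * h + 1) (by omega)
    have h0 := this.zero
    simp only [arm, if_true]
    rwa [h0]

theorem IsArm.core (hα : IsArm G τ h b α) {i : ℤ} (h1 : -(2 * h + 2 : ℤ) ≤ i)
    (h2 : i ≤ 2 * h + 2) : Core G τ (arm G τ h α i) :=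
  hα.isChain.core' (by push_cast; omega) (by push_cast; omega)

theorem IsArm.core_neg (hα : IsArm G τ h b α) {s : ℕ} (hs : s ≤ h) :
    Core G τ (arm G τ h α (-(s : ℤ))) := hα.core (by omega) (by omega)

theorem IsArm.nbr_neg (hα : IsArm G τ h b α) {s : ℕ} (hs : s ≤ h) (w : ℕ) :
    (G.Adj (arm G τ h α (-(s : ℤ))) w ∧ Core G τ w) ↔
      (w = arm G τ h α (1 - s) ∨ w = arm G τ h α (-(s : ℤ) - 1)) := by
  rw [hα.isChain.nbr (-(s : ℤ)) (by push_cast; omega) (by push_cast; omega), or_comm,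
    show (1 : ℤ) - s = -s + 1 by ring]

theorem IsArm.ne_neg (hα : IsArm G τ h b α) {s : ℕ} (hs : s ≤ h) :
    arm G τ h α (1 - s) ≠ arm G τ h α (-(s : ℤ) - 1) := by
  have := hα.isChain.ne (-(s : ℤ)) (by push_cast; omega) (by push_cast; omega)
  rw [show (1 : ℤ) - s = -s + 1 by ring]
  exact this.symm

theorem IsArm.edist_le (hα : IsArm G τ h b α) {i : ℤ} (h1 : -(h : ℤ) ≤ i) (h2 : i ≤ h + 1) :
    G.edist α.1 (arm G τ h α i) ≤ ((h + 1 : ℕ) : ℕ∞) := by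
  refine (Ruling.isChain hα).edist_le (by omega) ?_ ?_ <;> split_ifs <;> push_cast <;> omega

theorem exists_arm_of_isCut {u w : ℕ} (hc : IsCut G τ (2 * h + 2) b u w) :
    ∃ α, IsArm G τ h b α ∧ u = arm G τ h α 0 ∧ w = arm G τ h α 1 := by
  obtain ⟨v, hv, ⟨rfl, rfl⟩ | ⟨rfl, rfl⟩⟩ := hc
  · exact ⟨(v, true), hv, by simp [arm], by simp [arm]⟩
  · exact ⟨(v, false), hv, by simp [arm], by simp [arm]⟩

theorem IsArm.isCut (hα : IsArm G τ h b α) :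
    IsCut G τ (2 * h + 2) b (arm G τ h α 0) (arm G τ h α 1) := by
  refine ⟨α.1, hα, ?_⟩
  rcases α with ⟨v, _ | _⟩ <;> simp [arm]

theorem IsArm.edist_one_le (hα : IsArm G τ h b α) :
    G.edist (arm G τ h α 0) α.1 ≤ ((1 : ℕ) : ℕ∞) := by
  rw [SimpleGraph.edist_comm]
  refine (Ruling.isChain hα).edist_le (by omega) ?_ ?_ <;> split_ifs <;> simp

/-- The trees hanging off the first nodes of the arms are pairwise disjoint. -/
theorem Admissible.eq_of_mem_hang_arm (hG : Admissible G Δ τ h b) (hα : IsArm G τ h b α)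
    (hβ : IsArm G τ h b β) {s t : ℕ} (hs : s ≤ h) (ht : t ≤ h) {w : ℕ}
    (h1 : w ∈ hang G τ (arm G τ h α (-(s : ℤ)))) (h2 : w ∈ hang G τ (arm G τ h β (-(t : ℤ)))) :
    α = β ∧ s = t := by
  have hlt : ∀ {γ}, IsArm G τ h b γ → γ.1 / 2 ^ b = 0 := by
    intro γ hγ
    have hc := Ruling.isChain hγ
    have := hc.adj (i := 0) (by omega) (by omega)
    rw [hc.zero] at this
    exact Nat.div_eq_of_lt (hG.ident _ _ this).2
  have hroot := eq_of_mem_hang hG.one_le_τ (hα.core_neg hs) (hβ.core_neg ht) h1 h2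
  have hd : G.edist α.1 β.1 ≤ ((2 * h + 2 : ℕ) : ℕ∞) := by
    have d1 := hα.edist_le (i := -(s : ℤ)) (by omega) (by omega)
    have d2 := hβ.edist_le (i := -(t : ℤ)) (by omega) (by omega)
    rw [hroot] at d1
    rw [SimpleGraph.edist_comm] at d2
    exact edist_le_mono (edist_le_add d1 d2) (by omega)
  have hv : α.1 = β.1 := Ruling.eq_of_edist_le_of_div_eq hα hβ
    ((hlt hα).trans (hlt hβ).symm) hd
  by_cases hs' : α.2 = β.2
  · obtain rfl : α = β := Prod.ext hv hs'
    have := hα.isChain.inj hG.acyclic (by push_cast; omega) (by push_cast; omega)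
      (by push_cast; omega) (by push_cast; omega) hroot
    exact ⟨rfl, by omega⟩
  · obtain rfl : β = opp α := Prod.ext hv.symm (by
      cases h : α.2 <;> cases h' : β.2 <;> simp_all [opp])
    rw [arm_opp] at hroot
    have := hα.isChain.inj hG.acyclic (by push_cast; omega) (by push_cast; omega)
      (by push_cast; omega) (by push_cast; omega) hroot
    omega

theorem Admissible.eq_of_mem_nearBlock (hG : Admissible G Δ τ h b) (hα : IsArm G τ h b α)
    (hβ : IsArm G τ h b β) {w : ℕ} (h1 : w ∈ nearBlock G τ h α) (h2 : w ∈ nearBlock G τ h β) :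
    α = β := by
  obtain ⟨s, hs, h1⟩ := h1
  obtain ⟨t, ht, h2⟩ := h2
  exact (hG.eq_of_mem_hang_arm hα hβ hs.le ht.le h1 h2).1

theorem Admissible.arm_notMem_nearBlock (hG : Admissible G Δ τ h b) (hα : IsArm G τ h b α)
    (hβ : IsArm G τ h b β) : arm G τ h α (-(h : ℤ)) ∉ nearBlock G τ h β := by
  rintro ⟨t, ht, h2⟩
  have := (hG.eq_of_mem_hang_arm hα hβ le_rfl ht.le (mem_hang_self _) h2).2
  omega

/-- The neighbours of the nodes of a near block. -/
theorem Admissible.adj_hang_arm (hG : Admissible G Δ τ h b) (hα : IsArm G τ h b α) {s w w' : ℕ}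
    (hs : s ≤ h) (hw : w ∈ hang G τ (arm G τ h α (-(s : ℤ)))) (ha : G.Adj w w') :
    w' ∈ hang G τ (arm G τ h α (-(s : ℤ))) ∨ (w = arm G τ h α (-(s : ℤ)) ∧
      (w' = arm G τ h α (1 - s) ∨ w' = arm G τ h α (-(s : ℤ) - 1))) := by
  by_cases hne : w = arm G τ h α (-(s : ℤ))
  · subst hne
    by_cases hc : Core G τ w'
    · exact Or.inr ⟨rfl, (hα.nbr_neg hs w').1 ⟨ha, hc⟩⟩
    · exact Or.inl ((mem_hang_iff_of_adj hG.one_le_τ (hα.core_neg hs) ha).2 hc)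
  · exact Or.inl (mem_hang_of_adj hG.one_le_τ (hα.core_neg hs) hw hne ha)

theorem Admissible.mem_nearBlock_of_baseGraph_adj (hG : Admissible G Δ τ h b)
    (hα : IsArm G τ h b α) {w w' : ℕ} (hw : w ∈ nearBlock G τ h α)
    (ha : (baseGraph G τ h b).Adj w w') :
    w' ∈ nearBlock G τ h α ∨ w' ∈ nearBlock G τ h (opp α) := by
  obtain ⟨s, hs, hw⟩ := hw
  have h1 := hG.one_le_h
  rcases hG.adj_hang_arm hα hs.le hw ha.1 with h | ⟨rfl, rfl | rfl⟩
  · exact Or.inl ⟨s, hs, h⟩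
  · rcases Nat.eq_zero_or_pos s with rfl | h0
    · refine Or.inr ⟨0, h1, ?_⟩
      rw [arm_opp]
      exact mem_hang_self _
    · refine Or.inl ⟨s - 1, by omega, ?_⟩
      rw [show -((s - 1 : ℕ) : ℤ) = 1 - s by omega]
      exact mem_hang_self _
  · by_cases he : s + 1 = h
    · refine absurd (Or.inr ⟨?_, ?_⟩) (ha.2 α hα) <;> congr 1 <;> omega
    · refine Or.inl ⟨s + 1, by omega, ?_⟩
      rw [show -((s + 1 : ℕ) : ℤ) = -s - 1 by omega]
      exact mem_hang_self _

/-- The base of a node outside all near blocks meets no near block. -/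
theorem Admissible.notMem_nearBlock_of_reachable (hG : Admissible G Δ τ h b)
    (hr : ∀ α, IsArm G τ h b α → r ∉ nearBlock G τ h α) {w : ℕ}
    (hw : (baseGraph G τ h b).Reachable r w) :
    ∀ α, IsArm G τ h b α → w ∉ nearBlock G τ h α := by
  obtain ⟨p⟩ := hw
  induction p with
  | nil => exact hr
  | cons ha p ih =>
    refine ih fun α hα hw => ?_
    rcases hG.mem_nearBlock_of_baseGraph_adj hα hw ha.symm with h | h
    · exact hr α hα h
    · exact hr _ hα.opp h

theorem Admissible.mem_nearBlock (hG : Admissible G Δ τ h b) :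
    arm G τ h α (1 - h) ∈ nearBlock G τ h α := by
  have h1 := hG.one_le_h
  refine ⟨h - 1, by omega, ?_⟩
  rw [show -((h - 1 : ℕ) : ℤ) = 1 - h by omega]
  exact mem_hang_self _

/-- Only the attaching edges of arms leave a base. -/
theorem Admissible.adj_base (hG : Admissible G Δ τ h b)
    (hr : ∀ α, IsArm G τ h b α → r ∉ nearBlock G τ h α) {w w' : ℕ}
    (hw : (baseGraph G τ h b).Reachable r w) (ha : G.Adj w w') :
    (baseGraph G τ h b).Adj w w' ∨
      ∃ α, IsArm G τ h b α ∧ w = arm G τ h α (-(h : ℤ)) ∧ w' = arm G τ h α (1 - h) := by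
  by_contra! hcon
  obtain ⟨h1, h2⟩ := hcon
  refine h1 ⟨ha, fun α hα => ?_⟩
  rintro (⟨h3, h4⟩ | ⟨h3, h4⟩)
  · exact h2 α hα h3 h4
  · exact hG.notMem_nearBlock_of_reachable hr hw α hα (h3 ▸ hG.mem_nearBlock)

/-- The two arms at a cut edge are not attached to the same base. -/
theorem Admissible.not_reachable_opp (hG : Admissible G Δ τ h b) (hα : IsArm G τ h b α) :
    ¬ (baseGraph G τ h b).Reachable (arm G τ h α (-(h : ℤ))) (arm G τ h (opp α) (-(h : ℤ))) := by
  intro hr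
  have h1 := hG.one_le_h
  obtain ⟨s, hs0, hs1, hs⟩ := exists_nonBacktracking hr
  have hsG : NonBacktracking G s _ := ⟨fun i hi => (hs.1 i hi).1, hs.2⟩
  have ht := hα.isChain.nonBacktracking (a := -(h : ℤ)) (m := 2 * h + 1) (by push_cast; omega)
    (by push_cast; omega)
  obtain ⟨e1, e2⟩ := hsG.unique hG.acyclic ht (by simpa using hs0) (by
    rw [hs1, arm_opp]; congr 1; push_cast; ring)
  have e3 := e2 1 (by omega)
  have ha := hs.1 0 (by omega)
  rw [hs0, zero_add, e3] at ha
  refine ha.2 α hα (Or.inl ⟨rfl, ?_⟩)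
  congr 1
  push_cast; ring

theorem Admissible.mem_piece_of_cutGraph_adj (hG : Admissible G Δ τ h b)
    (hr : ∀ α, IsArm G τ h b α → r ∉ nearBlock G τ h α) {w w' : ℕ} (hw : w ∈ piece G τ h b r)
    (ha : (cutGraph G τ (2 * h + 2) b).Adj w w') : w' ∈ piece G τ h b r := by
  have h1 := hG.one_le_h
  rcases hw with hw | ⟨α, hα, hB, s, hs, hw⟩
  · rcases hG.adj_base hr hw ha.1 with hb | ⟨α, hα, rfl, rfl⟩
    · exact Or.inl (hw.trans hb.reachable)
    · exact Or.inr ⟨α, hα, hw, hG.mem_nearBlock⟩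
  · rcases hG.adj_hang_arm hα hs.le hw ha.1 with hh | ⟨rfl, rfl | rfl⟩
    · exact Or.inr ⟨α, hα, hB, s, hs, hh⟩
    · rcases Nat.eq_zero_or_pos s with rfl | h0
      · exact absurd (by simpa using hα.isCut) ha.2
      · refine Or.inr ⟨α, hα, hB, s - 1, by omega, ?_⟩
        rw [show -((s - 1 : ℕ) : ℤ) = 1 - s by omega]
        exact mem_hang_self _
    · by_cases he : s + 1 = h
      · left
        rwa [show -(s : ℤ) - 1 = -h by omega]
      · refine Or.inr ⟨α, hα, hB, s + 1, by omega, ?_⟩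
        rw [show -((s + 1 : ℕ) : ℤ) = -s - 1 by omega]
        exact mem_hang_self _

/-- Every component that is left after cutting lies in a piece. -/
theorem Admissible.exists_piece (hG : Admissible G Δ τ h b) (v : ℕ) :
    ∃ r, (∀ α, IsArm G τ h b α → r ∉ nearBlock G τ h α) ∧
      ∀ w, (cutGraph G τ (2 * h + 2) b).Reachable v w → w ∈ piece G τ h b r := by
  obtain ⟨r, hr, hv⟩ : ∃ r, (∀ α, IsArm G τ h b α → r ∉ nearBlock G τ h α) ∧
      v ∈ piece G τ h b r := by
    by_cases hv : ∃ α, IsArm G τ h b α ∧ v ∈ nearBlock G τ h α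
    · obtain ⟨α, hα, hv⟩ := hv
      exact ⟨_, fun β hβ => hG.arm_notMem_nearBlock hα hβ, Or.inr ⟨α, hα, .refl _, hv⟩⟩
    · push Not at hv
      exact ⟨v, hv, Or.inl (.refl _)⟩
  refine ⟨r, hr, ?_⟩
  rintro w ⟨p⟩
  induction p with
  | nil => exact hv
  | cons ha p ih => exact ih (hG.mem_piece_of_cutGraph_adj hr hv ha)

end Arm

/-! ### Running an algorithm on a set of nodes -/

section Induce

variable {I O : Type*} {P : LCL I O} {Δ k : ℕ} {A : LocalAlgorithm I O} {t : ℕ → ℕ}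

theorem bijOn_val_induce {W : Type*} {S : SimpleGraph W} {N : Set W}
    (hcl : ∀ x ∈ N, ∀ y, S.Adj x y → y ∈ N) (x : N) :
    Set.BijOn Subtype.val ((S.induce N).neighborSet x) (S.neighborSet x.1) :=
  ⟨fun _ h => h, Subtype.val_injective.injOn, fun y h => ⟨⟨y, hcl x x.2 y h⟩, h, rfl⟩⟩

/-- An algorithm can be run on a tree that is given as a set of nodes of some graph. -/
theorem nodeOK_of_solvedBy {W : Type} {S : SimpleGraph W} {N : Set W}
    (hcl : ∀ x ∈ N, ∀ y, S.Adj x y → y ∈ N) (hfin : N.Finite) (hT : (S.induce N).IsTree)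
    (hdeg : ∀ x ∈ N, (S.neighborSet x).encard ≤ (Δ : ℕ∞))
    (hA : P.SolvedBy (treesOfDegreeAtMost Δ) k A t) {ident : W → ℕ} (hid : Set.InjOn ident N)
    (hid' : ∀ x ∈ N, 1 ≤ ident x ∧ ident x ≤ N.ncard ^ k) (inp : W → I) {out : W → O}
    (hout : out = fun x => A N.ncard (localView S ident inp (t N.ncard) x)) :
    ∀ x ∈ N, NodeOK P Δ S inp out (msgLabel Δ S (fun x => (inp x, out x)) P.r) x := by
  have := hfin.fintype
  have hcard : Fintype.card N = N.ncard := by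
    rw [← Nat.card_eq_fintype_card, Nat.card_coe_set_eq]
  have hb := bijOn_val_induce hcl
  have hview : ∀ x : N, localView S ident inp (t N.ncard) x.1 =
      localView (S.induce N) (fun y => ident y.1) (fun y => inp y.1) (t N.ncard) x := fun x =>
    localView_eq_of_bijOn (φ := Subtype.val) fun u _ => ⟨hb u, rfl, rfl⟩
  have hdeg' : ∀ x : N, ((S.induce N).neighborSet x).encard ≤ (Δ : ℕ∞) := fun x => by
    have := hdeg x x.2
    rwa [← (hb x).image_eq, (hb x).injOn.encard_image] at this
  have hval := hA N (S.induce N) ⟨hT, hdeg'⟩ (fun y => ident y.1)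
    ⟨fun y z h => Subtype.ext (hid y.2 z.2 h), fun y => by rw [hcard]; exact hid' y y.2⟩
    (fun y => inp y.1)
  rw [hcard] at hval
  have ho : (fun x : N => out x.1) = fun x : N => A N.ncard
      (localView (S.induce N) (fun y => ident y.1) (fun y => inp y.1) (t N.ncard) x) := by
    funext x; rw [hout]; dsimp only; rw [hview]
  rw [← ho] at hval
  intro x hx
  refine (nodeOK_iff_of_bijOn (φ := Subtype.val) (hb ⟨x, hx⟩) rfl rfl fun u hu => ?_).2
    (nodeOK_of_isValid hT hdeg' hval ⟨x, hx⟩)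
  constructor <;> funext d
  · exact msg_eq_of_bijOn d ⟨x, hx⟩ u (fun w _ => ⟨hb w, rfl⟩) hu
  · exact msg_eq_of_bijOn d u ⟨x, hx⟩ (fun w _ => ⟨hb w, rfl⟩) hu.symm

/-- Identifiers that are given on a part of a finite set can be continued to a numbering of the
whole set. -/
theorem exists_ident_extension {W : Type*} {N N₀ : Set W} (hfin : N.Finite) (h₀ : N₀ ⊆ N)
    {f : W → ℕ} (hf : Set.InjOn f N₀) (hf' : ∀ x ∈ N₀, 1 ≤ f x ∧ f x ≤ N.ncard) :
    ∃ g : W → ℕ, Set.InjOn g N ∧ (∀ x ∈ N, 1 ≤ g x ∧ g x ≤ N.ncard) ∧ ∀ x ∈ N₀, g x = f x := by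
  classical
  have := hfin.fintype
  have hcard : Fintype.card N = (Finset.Icc 1 N.ncard).card := by
    rw [← Nat.card_eq_fintype_card, Nat.card_coe_set_eq, Nat.card_Icc]; omega
  obtain ⟨g, hg⟩ := Finset.exists_equiv_extend_of_card_eq hcard
    (s := Finset.univ.filter fun x : N => x.1 ∈ N₀) (f := fun x => f x.1)
    (by
      intro y hy
      obtain ⟨x, hx, rfl⟩ := Finset.mem_image.1 hy
      exact Finset.mem_Icc.2 (hf' _ (Finset.mem_filter.1 hx).2))
    (by
      intro x hx y hy hxy
      simp only [Finset.coe_filter, Finset.mem_univ, true_and, Set.mem_ofPred_eq] at hx hy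
      exact Subtype.ext (hf hx hy hxy))
  refine ⟨fun x => if hx : x ∈ N then g ⟨x, hx⟩ else 0, ?_, ?_, ?_⟩
  · intro x hx y hy hxy
    simp only [hx, hy, dif_pos] at hxy
    simpa using g.injective (Subtype.ext hxy)
  · intro x hx
    simp only [hx, dif_pos]
    exact Finset.mem_Icc.1 (g ⟨x, hx⟩).2
  · intro x hx
    simp only [h₀ hx, dif_pos]
    exact hg ⟨x, h₀ hx⟩ (by simpa using hx)

theorem mul_add_inj {X a a' w w' : ℕ} (hw : w < X) (hw' : w' < X)
    (h : a * X + w = a' * X + w') : a = a' ∧ w = w' := by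
  have h1 := congrArg (· / X) h
  have h2 := congrArg (· % X) h
  have hX : 0 < X := by omega
  simp only [mul_comm _ X, Nat.mul_add_div hX, Nat.div_eq_of_lt hw, Nat.div_eq_of_lt hw',
    Nat.mul_add_mod, Nat.mod_eq_of_lt hw, Nat.mod_eq_of_lt hw'] at h1 h2
  exact ⟨by omega, h2⟩

end Induce

/-! ### Pumped strips and the labels of the cut edges -/

section Strips

/-- The problem, with the parameters of the construction: the degree bound `Δ`, the pruning height
`τ`, the length `h` of the near blocks, the number `b` of digits of the identifiers, and what an
algorithm does in `T` rounds on networks of one fixed size. -/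
structure Params (I O : Type*) where
  P : LCL I O
  Δ : ℕ
  τ : ℕ
  h : ℕ
  b : ℕ
  T : ℕ
  A : View I → O

variable {I O : Type*} (D : Params I O) (G : SimpleGraph ℕ) (inp : ℕ → I)

/-- The labels of half-edges. -/
abbrev Params.Label := EdgeLabel D.Δ (I × O) D.P.r

/-- How many blocks a pumped near block consists of: enough for the ends of the strip to be farther
from its middle edge than the labels of that edge depend on. -/
def Params.halfLen : ℕ := D.h + (D.T + D.P.r + 3) * D.h.factorial

open Classical in
/-- The compatibility relations of the successive blocks of an arm, from the cut edge on. Only the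
first `h` of them matter. -/
noncomputable def nearWord (α : ℕ × Bool) (s : ℕ) :
    D.Label × D.Label → D.Label × D.Label → Prop :=
  if s < D.h then BlockRel D.P D.Δ G inp D.τ (arm G D.τ D.h α (-(s : ℤ)))
    (arm G D.τ D.h α (1 - s)) (arm G D.τ D.h α (-(s : ℤ) - 1))
  else fun _ _ => False

/-- The property of a sequence of block indices that the pumped sequence of blocks admits the same
pairs of labels at its ends as the original one. -/
def IsPump (α : ℕ × Bool) (g : ℕ → ℕ) : Prop :=
  (∀ s < D.halfLen, g s < D.h) ∧
    prodRel (fun s => nearWord D G inp α (g s)) D.halfLen = prodRel (nearWord D G inp α) D.h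

/-- A fixed choice of a pumped sequence. -/
noncomputable def pump (α : ℕ × Bool) : ℕ → ℕ := Classical.epsilon (IsPump D G inp α)

/-- The roots of the pumped strip around a cut edge: the pumped near block of `α`, in reverse
order, followed by that of the other side. -/
noncomputable def stripRoot (α : ℕ × Bool) (t : ℕ) : ℕ :=
  if t < D.halfLen then arm G D.τ D.h α (-(pump D G inp α (D.halfLen - 1 - t) : ℤ))
  else arm G D.τ D.h (opp α) (-(pump D G inp (opp α) (t - D.halfLen) : ℤ))

/-- The strip around the cut edge of `v`, made of the pumped near blocks of its two sides. -/
noncomputable def cutStrip (v : ℕ) : SimpleGraph (ℕ × ℕ) :=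
  stripGraph G (fun t => hang G D.τ (stripRoot D G inp (v, true) t)) (stripRoot D G inp (v, true))

/-- The identifiers used in the strip around the cut edge of `v`: the position in the strip (counted
from one), the node `v`, and the original node, as digits to base `2 ^ b`. They are larger than all
identifiers of the original network, and depend on the cut edge, so that several strips can be used
together. -/
def stripIdent (b v : ℕ) (p : ℕ × ℕ) : ℕ := ((p.1 + 1) * 2 ^ b + v) * 2 ^ b + p.2

/-- The input labels, and the output labels that the algorithm computes, in the strip around the
cut edge of `v`. -/
noncomputable def stripLabel (v : ℕ) (p : ℕ × ℕ) : I × O :=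
  (inp p.2, D.A (localView (cutStrip D G inp v) (stripIdent D.b v) (fun q => inp q.2) D.T p))

/-- The labels of the two halves of the cut edge of `v`: those of the middle edge of the strip. -/
noncomputable def cutLabel (v : ℕ) : D.Label × D.Label :=
  (msgLabel D.Δ (cutStrip D G inp v) (stripLabel D G inp v) D.P.r
      (D.halfLen - 1, stripRoot D G inp (v, true) (D.halfLen - 1))
      (D.halfLen, stripRoot D G inp (v, true) D.halfLen),
    msgLabel D.Δ (cutStrip D G inp v) (stripLabel D G inp v) D.P.r
      (D.halfLen, stripRoot D G inp (v, true) D.halfLen)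
      (D.halfLen - 1, stripRoot D G inp (v, true) (D.halfLen - 1)))

/-- The labels of the cut edge, read from the side `α`. -/
noncomputable def armLabel (α : ℕ × Bool) : D.Label × D.Label :=
  if α.2 then cutLabel D G inp α.1 else (cutLabel D G inp α.1).swap

/-- Positions in the strip around a cut edge, counted from the side `α`. -/
def stripPos (α : ℕ × Bool) (t : ℕ) : ℕ :=
  if α.2 = true ∨ 2 * D.halfLen ≤ t then t else 2 * D.halfLen - 1 - t

variable {D G inp} {α : ℕ × Bool}

theorem stripPos_inj {t t' : ℕ} (h : stripPos D α t = stripPos D α t') : t = t' := by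
  rcases α with ⟨v, _ | _⟩ <;> simp only [stripPos, reduceCtorEq, false_or, true_or, if_true] at h
  · split_ifs at h <;> omega
  · exact h

theorem stripRoot_stripPos {t : ℕ} (ht : t < 2 * D.halfLen) :
    stripRoot D G inp (α.1, true) (stripPos D α t) = stripRoot D G inp α t := by
  rcases α with ⟨v, _ | _⟩
  · have e1 : opp (v, false) = (v, true) := rfl
    have e2 : opp (v, true) = (v, false) := rfl
    have e3 : stripPos D (v, false) t = 2 * D.halfLen - 1 - t := if_neg (by simp; omega)
    rw [e3]
    simp only [stripRoot, e1, e2]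
    by_cases h : t < D.halfLen
    · rw [if_neg (by omega), if_pos h, show 2 * D.halfLen - 1 - t - D.halfLen =
        D.halfLen - 1 - t by omega]
    · rw [if_pos (by omega), if_neg h, show D.halfLen - 1 - (2 * D.halfLen - 1 - t) =
        t - D.halfLen by omega]
  · simp [stripPos]

theorem isPump_pump [Finite I] [Finite O]
    (hD : Nat.card (D.Label × D.Label → D.Label × D.Label → Prop) ≤ D.h)
    (α : ℕ × Bool) : IsPump D G inp α (pump D G inp α) :=
  Classical.epsilon_spec (exists_pump hD _ _)

theorem exists_stripRoot_eq (hp : ∀ α, IsPump D G inp α (pump D G inp α)) {t : ℕ}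
    (ht : t < 2 * D.halfLen) :
    ∃ β s, β.1 = α.1 ∧ s < D.h ∧ stripRoot D G inp α t = arm G D.τ D.h β (-(s : ℤ)) := by
  unfold stripRoot
  split_ifs with h
  · exact ⟨α, _, rfl, (hp α).1 _ (by omega), rfl⟩
  · exact ⟨opp α, _, rfl, (hp (opp α)).1 _ (by omega), rfl⟩

end Strips

/-! ### The network that replaces a piece -/

section Network

variable {I O : Type*} (D : Params I O) (G : SimpleGraph ℕ) (inp : ℕ → I) (r : ℕ)

/-- The base of `r`. -/
def base : Set ℕ := {w | (baseGraph G D.τ D.h D.b).Reachable r w}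

/-- The arms that are attached to the base of `r`. -/
def arms : Set (ℕ × Bool) := {α | IsArm G D.τ D.h D.b α ∧ arm G D.τ D.h α (-(D.h : ℤ)) ∈ base D G r}

/-- The root of the `t`-th block of an arm of the network: after the pumped strip, there are only
padding nodes. -/
noncomputable def blockRoot (α : ℕ × Bool) (t : ℕ) : ℕ :=
  if t < 2 * D.halfLen then stripRoot D G inp α t else arm G D.τ D.h α 0

/-- The `t`-th block of an arm of the network. -/
noncomputable def block (α : ℕ × Bool) (t : ℕ) : Set ℕ :=
  if t < 2 * D.halfLen then hang G D.τ (stripRoot D G inp α t) else {arm G D.τ D.h α 0}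

/-- The number of blocks of an arm of the network: the strip, one padding node, and `q` further
ones on the arm `α₁`. The padding node takes the place of the second core neighbour of the last
root of the strip. -/
def armLength (α₁ : ℕ × Bool) (q : ℕ) (α : ℕ × Bool) : ℕ :=
  2 * D.halfLen + 1 + if α = α₁ then q else 0

/-- The network that replaces a piece: the near blocks are replaced by the pumped strips around
the cut edges, and there is a padding of arbitrary length. -/
noncomputable def network (α₁ : ℕ × Bool) (q : ℕ) : SimpleGraph (ℕ ⊕ ((ℕ × Bool) × ℕ × ℕ)) :=
  spider G (baseGraph G D.τ D.h D.b) (base D G r) (arms D G r)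
    (fun α => arm G D.τ D.h α (-(D.h : ℤ))) (block D G inp) (blockRoot D G inp) (armLength D α₁ q)

/-- The nodes of the network that replaces a piece. -/
def networkNodes (α₁ : ℕ × Bool) (q : ℕ) : Set (ℕ ⊕ ((ℕ × Bool) × ℕ × ℕ)) :=
  spiderNodes (base D G r) (arms D G r) (block D G inp) (armLength D α₁ q)

/-- The root of the arm block preceding the `t`-th one. -/
noncomputable abbrev prevRoot (α : ℕ × Bool) (t : ℕ) : ℕ ⊕ ((ℕ × Bool) × ℕ × ℕ) :=
  spiderPrev (fun α => arm G D.τ D.h α (-(D.h : ℤ))) (blockRoot D G inp) α t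

/-- The input labels of the network. -/
def networkInp : ℕ ⊕ ((ℕ × Bool) × ℕ × ℕ) → I
  | .inl w => inp w
  | .inr (_, _, w) => inp w

/-- The arm that a node outside the base belongs to, if it is adjacent to the base. -/
noncomputable def armOf (w : ℕ) : ℕ × Bool :=
  Classical.epsilon fun α => IsArm G D.τ D.h D.b α ∧ w = arm G D.τ D.h α (1 - D.h)

open Classical in
/-- The map from the base and its neighbours to the network. -/
noncomputable def baseMap (w : ℕ) : ℕ ⊕ ((ℕ × Bool) × ℕ × ℕ) :=
  if w ∈ base D G r then .inl w else .inr (armOf D G w, 0, blockRoot D G inp (armOf D G w) 0)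

/-- The map from the arm `α` of the network to the strip around the cut edge. -/
def stripMap (α : ℕ × Bool) : ℕ ⊕ ((ℕ × Bool) × ℕ × ℕ) → ℕ × ℕ
  | .inl w => (0, w)
  | .inr (_, t, w) => (stripPos D α t, w)

variable {D G inp r} {α₁ α : ℕ × Bool} {q : ℕ}

theorem Admissible.armOf_eq (hG : Admissible G D.Δ D.τ D.h D.b) (hα : IsArm G D.τ D.h D.b α) :
    armOf D G (arm G D.τ D.h α (1 - D.h)) = α := by
  have h : IsArm G D.τ D.h D.b (armOf D G (arm G D.τ D.h α (1 - D.h))) ∧ _ =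
      arm G D.τ D.h (armOf D G (arm G D.τ D.h α (1 - D.h))) (1 - D.h) :=
    Classical.epsilon_spec (p := fun β => IsArm G D.τ D.h D.b β ∧
      arm G D.τ D.h α (1 - D.h) = arm G D.τ D.h β (1 - D.h)) ⟨α, hα, rfl⟩
  have h2 := hG.mem_nearBlock (α := armOf D G (arm G D.τ D.h α (1 - D.h)))
  rw [← h.2] at h2
  exact hG.eq_of_mem_nearBlock h.1 hα h2 hG.mem_nearBlock

theorem halfLen_lt : D.T + D.P.r + 2 < D.halfLen := by
  have h1 := Nat.mul_le_mul_left (D.T + D.P.r + 3) (Nat.factorial_pos D.h)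
  unfold Params.halfLen
  omega

theorem blockRoot_of_lt {t : ℕ} (ht : t < 2 * D.halfLen) :
    blockRoot D G inp α t = stripRoot D G inp α t := if_pos ht

theorem block_of_lt {t : ℕ} (ht : t < 2 * D.halfLen) :
    block D G inp α t = hang G D.τ (stripRoot D G inp α t) := if_pos ht

theorem blockRoot_mem_block (t : ℕ) : blockRoot D G inp α t ∈ block D G inp α t := by
  unfold blockRoot block
  split_ifs
  · exact mem_hang_self _
  · rfl

theorem core_stripRoot (hα : IsArm G D.τ D.h D.b α)
    (hp : ∀ α, IsPump D G inp α (pump D G inp α)) {t : ℕ} (ht : t < 2 * D.halfLen) :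
    Core G D.τ (stripRoot D G inp α t) := by
  obtain ⟨β, s, h1, h2, h3⟩ := exists_stripRoot_eq hp ht (α := α)
  have hβ : IsArm G D.τ D.h D.b β := by unfold IsArm; rw [h1]; exact hα
  rw [h3]
  exact hβ.core_neg h2.le

/-- The network is a legitimate input for the algorithm, together with the degree bound
`Admissible.encard_neighborSet_network`. -/
theorem Admissible.isTree_network (hG : Admissible G D.Δ D.τ D.h D.b)
    (hp : ∀ α, IsPump D G inp α (pump D G inp α)) :
    ((network D G inp r α₁ q).induce (networkNodes D G inp r α₁ q)).IsTree := by
  refine isTree_spider (r := r) hG.acyclic (hG.acyclic.anti baseGraph_le)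
    (SimpleGraph.Reachable.refl r) (fun w hw => hw) (fun w hw w' ha => hw.trans ha.reachable)
    (fun α hα => hα.2) (fun α _ t _ => blockRoot_mem_block t) ?_
  intro α hα t _ w hw
  by_cases h : t < 2 * D.halfLen
  · rw [blockRoot_of_lt h, block_of_lt h] at *
    have hc := core_stripRoot hα.1 hp h
    exact ⟨reachable_of_mem_hang hG.one_le_τ hc hw,
      fun hne w' ha => mem_hang_of_adj hG.one_le_τ hc hw hne ha⟩
  · have : blockRoot D G inp α t = arm G D.τ D.h α 0 := if_neg h
    have h2 : block D G inp α t = {arm G D.τ D.h α 0} := if_neg h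
    rw [h2] at hw
    obtain rfl : w = _ := hw
    rw [this]
    exact ⟨.refl _, fun h => absurd rfl h⟩

theorem network_closed : ∀ x ∈ networkNodes D G inp r α₁ q, ∀ y,
    (network D G inp r α₁ q).Adj x y → y ∈ networkNodes D G inp r α₁ q := by
  rintro (w | ⟨α, t, w⟩) hx (w' | ⟨α', t', w'⟩) ha
  · exact ha.2.1
  · obtain ⟨h1, rfl, _, rfl⟩ := ha
    exact ⟨h1, by unfold armLength; omega, blockRoot_mem_block 0⟩
  · obtain ⟨h1, rfl, rfl, _⟩ := ha
    exact h1.2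
  · obtain ⟨rfl, h1, h2, h3, h4⟩ := ha
    refine ⟨h1, h3, ?_⟩
    rcases stripGraph_adj.1 h4 with ⟨rfl, _, h, _⟩ | ⟨_, _, rfl⟩ | ⟨_, _, rfl⟩
    · exact h
    · exact blockRoot_mem_block _
    · exact blockRoot_mem_block _

theorem Admissible.baseMap_of_adj (hG : Admissible G D.Δ D.τ D.h D.b)
    (hr : ∀ α, IsArm G D.τ D.h D.b α → r ∉ nearBlock G D.τ D.h α) {w u : ℕ} (hw : w ∈ base D G r)
    (ha : G.Adj w u) :
    (u ∈ base D G r ∧ (baseGraph G D.τ D.h D.b).Adj w u ∧ baseMap D G inp r u = .inl u) ∨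
    ∃ α ∈ arms D G r, w = arm G D.τ D.h α (-(D.h : ℤ)) ∧ u = arm G D.τ D.h α (1 - D.h) ∧
      baseMap D G inp r u = .inr (α, 0, blockRoot D G inp α 0) := by
  rcases hG.adj_base hr hw ha with h | ⟨α, hα, rfl, rfl⟩
  · have hu : u ∈ base D G r := SimpleGraph.Reachable.trans hw h.reachable
    exact Or.inl ⟨hu, h, if_pos hu⟩
  · refine Or.inr ⟨α, ⟨hα, hw⟩, rfl, rfl, ?_⟩
    have : arm G D.τ D.h α (1 - D.h) ∉ base D G r := fun h =>
      hG.notMem_nearBlock_of_reachable hr h α hα hG.mem_nearBlock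
    rw [baseMap, if_neg this, hG.armOf_eq hα]

/-- Around the base, the network looks like the original graph. -/
theorem Admissible.bijOn_baseMap (hG : Admissible G D.Δ D.τ D.h D.b)
    (hr : ∀ α, IsArm G D.τ D.h D.b α → r ∉ nearBlock G D.τ D.h α) {w : ℕ} (hw : w ∈ base D G r) :
    Set.BijOn (baseMap D G inp r) (G.neighborSet w)
      ((network D G inp r α₁ q).neighborSet (.inl w)) := by
  refine ⟨fun u ha => ?_, fun u ha u' ha' he => ?_, ?_⟩
  · rcases hG.baseMap_of_adj (inp := inp) hr hw ha with ⟨h1, h2, h3⟩ | ⟨α, h1, h2, h3, h4⟩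
    · rw [h3]; exact ⟨hw, h1, h2⟩
    · rw [h4]; exact ⟨h1, rfl, h2, rfl⟩
  · rcases hG.baseMap_of_adj (inp := inp) hr hw ha with ⟨h1, h2, h3⟩ | ⟨α, h1, h2, h3, h4⟩ <;>
      rcases hG.baseMap_of_adj (inp := inp) hr hw ha' with
        ⟨h1', h2', h3'⟩ | ⟨α', h1', h2', h3', h4'⟩
    · rw [h3, h3'] at he; exact Sum.inl.inj he
    · rw [h3, h4'] at he; cases he
    · rw [h4, h3'] at he; cases he
    · rw [h4, h4'] at he
      simp only [Sum.inr.injEq, Prod.mk.injEq] at he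
      rw [h3, h3', he.1]
  · rintro (u | ⟨α, t, u⟩) ha
    · obtain ⟨_, h1, h2⟩ := ha
      exact ⟨u, h2.1, if_pos h1⟩
    · obtain ⟨h1, rfl, rfl, rfl⟩ := ha
      have hadj : G.Adj (arm G D.τ D.h α (-(D.h : ℤ))) (arm G D.τ D.h α (1 - D.h)) :=
        ((h1.1.nbr_neg le_rfl _).2 (Or.inl rfl)).1
      have : arm G D.τ D.h α (1 - D.h) ∉ base D G r := fun h =>
        hG.notMem_nearBlock_of_reachable hr h α h1.1 hG.mem_nearBlock
      refine ⟨_, hadj, ?_⟩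
      rw [baseMap, if_neg this, hG.armOf_eq h1.1]

/-- Around a block of a strip, the network looks like the original graph around that block. -/
theorem Admissible.bijOn_blockMap (hG : Admissible G D.Δ D.τ D.h D.b) (hα : α ∈ arms D G r)
    {t s : ℕ} (ht : t < 2 * D.halfLen) {β : ℕ × Bool} (hβ : IsArm G D.τ D.h D.b β) (hs : s ≤ D.h)
    (he : stripRoot D G inp α t = arm G D.τ D.h β (-(s : ℤ))) :
    ∀ w ∈ hang G D.τ (arm G D.τ D.h β (-(s : ℤ))),
      Set.BijOn (blockMap (hang G D.τ (arm G D.τ D.h β (-(s : ℤ))))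
          (fun w => (.inr (α, t, w) : ℕ ⊕ ((ℕ × Bool) × ℕ × ℕ))) (arm G D.τ D.h β (-(s : ℤ) - 1))
          (.inr (α, t + 1, blockRoot D G inp α (t + 1))) (prevRoot D G inp α t))
        (G.neighborSet w) ((network D G inp r α₁ q).neighborSet (.inr (α, t, w))) := by
  have hlen : t + 1 < armLength D α₁ q α := by unfold armLength; omega
  have hmem := fun t => blockRoot_mem_block (D := D) (G := G) (inp := inp) (α := α) t
  refine TreeGap.bijOn_blockMap hG.one_le_τ (hβ.core_neg hs) (hβ.nbr_neg hs) (hβ.ne_neg hs)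
    ?_ ?_ ?_ ?_ ?_ ?_
  · intro w _ w' _ h
    simpa using h
  · intro w hw hne
    refine neighborSet_spider_of_ne hα (by omega) (hmem t) ?_ ?_ ?_
    · rw [block_of_lt ht, he]; exact hw
    · rw [blockRoot_of_lt ht, he]; exact hne
    · intro w' ha
      rw [block_of_lt ht, he]
      exact mem_hang_of_adj hG.one_le_τ (hβ.core_neg hs) hw hne ha
  · have h1 := neighborSet_spider_root (G := G) (G₀ := baseGraph G D.τ D.h D.b) (B₀ := base D G r)
      (att := fun α => arm G D.τ D.h α (-(D.h : ℤ))) hα hlen (hmem t)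
    rw [block_of_lt ht, blockRoot_of_lt ht, he] at h1
    rw [Set.pair_comm]
    exact h1
  · intro w _ h
    simp at h
  · intro w _ h
    unfold prevRoot spiderPrev at h
    split_ifs at h
    simp only [Sum.inr.injEq, Prod.mk.injEq] at h
    omega
  · intro h
    unfold prevRoot spiderPrev at h
    split_ifs at h
    simp only [Sum.inr.injEq, Prod.mk.injEq] at h
    omega

theorem Admissible.encard_neighborSet_network (hG : Admissible G D.Δ D.τ D.h D.b)
    (hr : ∀ α, IsArm G D.τ D.h D.b α → r ∉ nearBlock G D.τ D.h α)
    (hp : ∀ α, IsPump D G inp α (pump D G inp α)) :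
    ∀ x ∈ networkNodes D G inp r α₁ q,
      ((network D G inp r α₁ q).neighborSet x).encard ≤ (D.Δ : ℕ∞) := by
  have key : ∀ {w : ℕ} {x} {f : ℕ → ℕ ⊕ ((ℕ × Bool) × ℕ × ℕ)},
      Set.BijOn f (G.neighborSet w) ((network D G inp r α₁ q).neighborSet x) →
      ((network D G inp r α₁ q).neighborSet x).encard ≤ (D.Δ : ℕ∞) := by
    intro w x f h
    rw [← h.image_eq, h.injOn.encard_image]
    exact hG.degree w
  rintro (w | ⟨α, t, w⟩) hx
  · exact key (hG.bijOn_baseMap hr hx)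
  · obtain ⟨hα, hlen, hw⟩ := hx
    by_cases ht : t < 2 * D.halfLen
    · rw [block_of_lt ht] at hw
      obtain ⟨β, s, h1, h2, h3⟩ := exists_stripRoot_eq hp ht (α := α)
      have hβ : IsArm G D.τ D.h D.b β := by unfold IsArm; rw [h1]; exact hα.1
      rw [h3] at hw
      exact key (hG.bijOn_blockMap hα ht hβ h2.le h3 w hw)
    · -- a padding node has at most two neighbours, and core nodes have at least two
      have hsub : (network D G inp r α₁ q).neighborSet (.inr (α, t, w)) ⊆
          {.inr (α, t - 1, blockRoot D G inp α (t - 1)),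
            .inr (α, t + 1, blockRoot D G inp α (t + 1))} := by
        have hb : block D G inp α t = {arm G D.τ D.h α 0} := if_neg ht
        have hl := halfLen_lt (D := D)
        rintro (u | ⟨β, t', u⟩) ha
        · obtain ⟨_, rfl, _⟩ := ha
          omega
        · obtain ⟨rfl, _, _, _, h⟩ := ha
          rcases stripGraph_adj.1 h with ⟨rfl, h1, h2, h3⟩ | ⟨rfl, _, rfl⟩ | ⟨h, _, rfl⟩
          · rw [hb] at h1 h2
            rw [h1, h2] at h3
            exact absurd rfl h3.ne
          · exact Or.inr rfl
          · obtain rfl : t' = t - 1 := by omega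
            exact Or.inl rfl
      have h2 : ({arm G D.τ D.h α (1 - (0 : ℕ)), arm G D.τ D.h α (-((0 : ℕ) : ℤ) - 1)} : Set ℕ) ⊆
          G.neighborSet (arm G D.τ D.h α (-((0 : ℕ) : ℤ))) := by
        intro u hu
        exact ((hα.1.nbr_neg (Nat.zero_le _) u).2 hu).1
      calc _ ≤ _ := Set.encard_le_encard hsub
        _ ≤ 2 := (Set.encard_insert_le _ _).trans (by rw [Set.encard_singleton]; norm_num)
        _ = _ := (Set.encard_pair (hα.1.ne_neg (Nat.zero_le _))).symm
        _ ≤ _ := Set.encard_le_encard h2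
        _ ≤ _ := hG.degree _

/-- Within an arm of the network, the position changes by at most one in each step. -/
theorem exists_of_edist_network_le {t w m : ℕ} (hw : w ∈ block D G inp α t) :
    m ≤ t → ∀ y, (network D G inp r α₁ q).edist (.inr (α, t, w)) y ≤ (m : ℕ∞) →
      ∃ t' w', y = .inr (α, t', w') ∧ t ≤ t' + m ∧ t' ≤ t + m ∧ w' ∈ block D G inp α t' := by
  induction m with
  | zero =>
    intro _ y hy
    rw [edist_le_zero_iff] at hy
    exact ⟨t, w, hy, by omega, by omega, hw⟩
  | succ m ih =>
    intro hm y hy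
    rcases edist_le_succ_iff.1 hy with rfl | ⟨z, hz, ha⟩
    · exact ⟨t, w, rfl, by omega, by omega, hw⟩
    · obtain ⟨t', w', rfl, h1, h2, h3⟩ := ih (by omega) z hz
      rcases y with u | ⟨β, t'', u⟩
      · obtain ⟨_, rfl, _⟩ := ha
        omega
      · obtain ⟨rfl, _, _, _, h⟩ := ha
        rcases stripGraph_adj.1 h with ⟨rfl, _, h5, h6⟩ | ⟨rfl, _, rfl⟩ | ⟨h, _, rfl⟩
        · exact ⟨t', u, rfl, by omega, by omega, h5⟩
        · exact ⟨_, _, rfl, by omega, by omega, blockRoot_mem_block _⟩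
        · exact ⟨_, _, rfl, by omega, by omega, blockRoot_mem_block _⟩

/-- Away from the ends of the strip, an arm of the network looks like the strip around the cut edge.
-/
theorem Admissible.bijOn_stripMap (hG : Admissible G D.Δ D.τ D.h D.b) (hα : α ∈ arms D G r)
    (hp : ∀ α, IsPump D G inp α (pump D G inp α)) {t w : ℕ} (h1 : 1 ≤ t)
    (ht : t + 1 < 2 * D.halfLen) (hw : w ∈ block D G inp α t) :
    Set.BijOn (stripMap D α) ((network D G inp r α₁ q).neighborSet (.inr (α, t, w)))
      ((cutStrip D G inp α.1).neighborSet (stripPos D α t, w)) := by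
  have ht' : t < 2 * D.halfLen := by omega
  have hc := core_stripRoot hα.1 hp ht'
  have hroot := stripRoot_stripPos (D := D) (G := G) (inp := inp) (α := α) ht'
  have hlen : t + 1 < armLength D α₁ q α := by unfold armLength; omega
  have hmem := fun t => blockRoot_mem_block (D := D) (G := G) (inp := inp) (α := α) t
  rw [block_of_lt ht'] at hw
  have hinj : Set.InjOn (stripMap D α)
      ((network D G inp r α₁ q).neighborSet (.inr (α, t, w))) := by
    have : ∀ y, (network D G inp r α₁ q).Adj (.inr (α, t, w)) y → ∃ t' w', y = .inr (α, t', w') := by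
      rintro (u | ⟨β, t', u⟩) ha
      · obtain ⟨_, rfl, _⟩ := ha
        omega
      · obtain ⟨rfl, _⟩ := ha
        exact ⟨_, _, rfl⟩
    intro x hx y hy hxy
    obtain ⟨t1, w1, rfl⟩ := this x hx
    obtain ⟨t2, w2, rfl⟩ := this y hy
    simp only [stripMap, Prod.mk.injEq] at hxy
    rw [stripPos_inj hxy.1, hxy.2]
  have himg : stripMap D α '' ((network D G inp r α₁ q).neighborSet (.inr (α, t, w))) =
      (cutStrip D G inp α.1).neighborSet (stripPos D α t, w) := by
    by_cases hne : w = stripRoot D G inp α t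
    · have e1 := neighborSet_spider_root (G := G) (G₀ := baseGraph G D.τ D.h D.b)
        (B₀ := base D G r) (att := fun α => arm G D.τ D.h α (-(D.h : ℤ))) hα hlen (hmem t)
      have hpos : 1 ≤ stripPos D α t := by unfold stripPos; split_ifs <;> omega
      have e2 := neighborSet_stripGraph_root (G := G)
        (H := fun t => hang G D.τ (stripRoot D G inp (α.1, true) t))
        (ρ := stripRoot D G inp (α.1, true)) hpos (mem_hang_self _)
      rw [hroot] at e2
      rw [block_of_lt ht', blockRoot_of_lt ht'] at e1
      subst hne
      refine (congrArg (stripMap D α '' ·) e1).trans (Eq.trans ?_ e2.symm)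
      rw [Set.image_union, Set.image_image, Set.image_pair]
      refine congrArg₂ _ rfl ?_
      have r1 := stripRoot_stripPos (D := D) (G := G) (inp := inp) (α := α) (t := t - 1) (by omega)
      have r2 := stripRoot_stripPos (D := D) (G := G) (inp := inp) (α := α) (t := t + 1) (by omega)
      rw [spiderPrev, if_neg (by omega), blockRoot_of_lt (by omega), blockRoot_of_lt (by omega)]
      simp only [stripMap]
      rw [← r1, ← r2]
      rcases α with ⟨v, _ | _⟩
      · have p : ∀ t < 2 * D.halfLen, stripPos D (v, false) t = 2 * D.halfLen - 1 - t :=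
          fun t ht => if_neg (by simp; omega)
        rw [p (t - 1) (by omega), p (t + 1) (by omega), p t ht',
          show 2 * D.halfLen - 1 - (t - 1) = 2 * D.halfLen - 1 - t + 1 by omega,
          show 2 * D.halfLen - 1 - (t + 1) = 2 * D.halfLen - 1 - t - 1 by omega]
        exact Set.pair_comm _ _
      · simp [stripPos]
    · have e1 := neighborSet_spider_of_ne (G := G) (G₀ := baseGraph G D.τ D.h D.b)
        (B₀ := base D G r) (att := fun α => arm G D.τ D.h α (-(D.h : ℤ))) (w := w) hα
        (t := t) (len := armLength D α₁ q) (by omega)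
        (hmem t) (by rwa [block_of_lt ht']) (by rwa [blockRoot_of_lt ht']) (by
          intro w' ha
          rw [block_of_lt ht']
          exact mem_hang_of_adj hG.one_le_τ hc hw hne ha)
      have e2 := neighborSet_stripGraph_of_ne (G := G) (w := w) (t := stripPos D α t)
        (H := fun t => hang G D.τ (stripRoot D G inp (α.1, true) t))
        (ρ := stripRoot D G inp (α.1, true)) (by rwa [hroot]) (by rwa [hroot]) (by
          intro w' ha
          rw [hroot]
          exact mem_hang_of_adj hG.one_le_τ hc hw hne ha)
      refine (congrArg (stripMap D α '' ·) e1).trans (Eq.trans ?_ e2.symm)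
      rw [Set.image_image]
      rfl
  rw [← himg]
  exact hinj.bijOn_image

/-- Around the middle of an arm, the algorithm sees the strip around the cut edge. -/
theorem Admissible.msgLabel_network (hG : Admissible G D.Δ D.τ D.h D.b) (hα : α ∈ arms D G r)
    (hp : ∀ α, IsPump D G inp α (pump D G inp α)) {ident : ℕ ⊕ ((ℕ × Bool) × ℕ × ℕ) → ℕ}
    (hid : ∀ α ∈ arms D G r, ∀ t < 2 * D.halfLen, ∀ w ∈ block D G inp α t,
      ident (.inr (α, t, w)) = stripIdent D.b α.1 (stripPos D α t, w))
    {out : ℕ ⊕ ((ℕ × Bool) × ℕ × ℕ) → O} (hout : out = fun x =>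
      D.A (localView (network D G inp r α₁ q) ident (networkInp inp) D.T x)) :
    (msgLabel D.Δ (network D G inp r α₁ q) (fun x => (networkInp inp x, out x)) D.P.r
        (.inr (α, D.halfLen - 1, blockRoot D G inp α (D.halfLen - 1)))
        (.inr (α, D.halfLen, blockRoot D G inp α D.halfLen)),
      msgLabel D.Δ (network D G inp r α₁ q) (fun x => (networkInp inp x, out x)) D.P.r
        (.inr (α, D.halfLen, blockRoot D G inp α D.halfLen))
        (.inr (α, D.halfLen - 1, blockRoot D G inp α (D.halfLen - 1)))) = armLabel D G inp α := by
  have hl := halfLen_lt (D := D)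
  -- the algorithm does not see the ends of the strip from the blocks in its middle
  have hview : ∀ t w, w ∈ block D G inp α t → D.T + 1 ≤ t → t + D.T + 1 < 2 * D.halfLen →
      localView (cutStrip D G inp α.1) (stripIdent D.b α.1) (fun p => inp p.2) D.T
        (stripMap D α (.inr (α, t, w))) =
      localView (network D G inp r α₁ q) ident (networkInp inp) D.T (.inr (α, t, w)) := by
    intro t w hw h1 h2
    refine localView_eq_of_bijOn fun u hu => ?_
    obtain ⟨t', w', rfl, h3, h4, h5⟩ := exists_of_edist_network_le hw (by omega) u hu
    exact ⟨hG.bijOn_stripMap hα hp (by omega) (by omega) h5,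
      (hid α hα t' (by omega) w' h5).symm, rfl⟩
  -- hence the messages on the middle edge are those in the strip around the cut edge
  have hmsg : ∀ t t', D.halfLen ≤ t + 1 → t ≤ D.halfLen →
      (network D G inp r α₁ q).Adj (.inr (α, t, blockRoot D G inp α t))
        (.inr (α, t', blockRoot D G inp α t')) →
      msgLabel D.Δ (cutStrip D G inp α.1) (stripLabel D G inp α.1) D.P.r
        (stripPos D α t, blockRoot D G inp α t) (stripPos D α t', blockRoot D G inp α t') =
      msgLabel D.Δ (network D G inp r α₁ q) (fun x => (networkInp inp x, out x)) D.P.r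
        (.inr (α, t, blockRoot D G inp α t)) (.inr (α, t', blockRoot D G inp α t')) := by
    intro t t' h1 h2 ha
    funext d
    refine msg_eq_of_bijOn (φ := stripMap D α) (lab' := stripLabel D G inp α.1) d _ _
      (fun w hw => ?_) ha
    have hd := d.2
    obtain ⟨t'', w'', rfl, h3, h4, h5⟩ := exists_of_edist_network_le (blockRoot_mem_block t)
      (by omega) w hw
    refine ⟨hG.bijOn_stripMap hα hp (by omega) (by omega) h5, ?_⟩
    rw [stripLabel, hview t'' w'' h5 (by omega) (by omega), hout]
    rfl
  have hadj : (network D G inp r α₁ q).Adj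
      (.inr (α, D.halfLen - 1, blockRoot D G inp α (D.halfLen - 1)))
      (.inr (α, D.halfLen, blockRoot D G inp α D.halfLen)) :=
    ⟨rfl, hα, by unfold armLength; omega, by unfold armLength; omega,
      stripGraph_adj.2 (Or.inr (Or.inl ⟨by omega, rfl, rfl⟩))⟩
  rw [← hmsg _ _ (by omega) (by omega) hadj, ← hmsg _ _ (by omega) (by omega) hadj.symm,
    blockRoot_of_lt (by omega), blockRoot_of_lt (by omega),
    ← stripRoot_stripPos (α := α) (t := D.halfLen - 1) (by omega),
    ← stripRoot_stripPos (α := α) (t := D.halfLen) (by omega)]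
  rcases α with ⟨v, _ | _⟩
  · have p : ∀ t < 2 * D.halfLen, stripPos D (v, false) t = 2 * D.halfLen - 1 - t :=
      fun t ht => if_neg (by simp; omega)
    rw [p _ (by omega), p _ (by omega),
      show 2 * D.halfLen - 1 - (D.halfLen - 1) = D.halfLen by omega,
      show 2 * D.halfLen - 1 - D.halfLen = D.halfLen - 1 by omega]
    rfl
  · simp [stripPos, armLabel, cutLabel]

end Network

/-! ### Solutions on a piece -/

section Solution

variable {I O : Type*} {D : Params I O} {G : SimpleGraph ℕ} {inp : ℕ → I} {r : ℕ}
  {α₁ α : ℕ × Bool} {q : ℕ}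

/-- Identifiers for the network that do not depend on its size. -/
def networkIdent (D : Params I O) : ℕ ⊕ ((ℕ × Bool) × ℕ × ℕ) → ℕ
  | .inl w => w
  | .inr (α, t, w) => stripIdent D.b α.1 (stripPos D α t, w)

theorem Admissible.ident_of_reachable {Δ τ h b : ℕ} (hG : Admissible G Δ τ h b) {u w z : ℕ}
    (hw : G.Reachable u w) (hu : G.Adj u z) : 1 ≤ w ∧ w < 2 ^ b := by
  by_cases e : w = u
  · rw [e]; exact hG.ident _ _ hu
  · obtain ⟨y, hy, -⟩ := exists_adj_dist_lt hw e
    exact hG.ident _ _ hy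

theorem IsArm.adj_zero {τ h b : ℕ} (hα : IsArm G τ h b α) :
    G.Adj (arm G τ h α 0) (arm G τ h α 1) := by
  have := ((hα.nbr_neg (Nat.zero_le _) _).2 (Or.inl rfl)).1
  simpa using this

theorem Admissible.ident_block (hG : Admissible G D.Δ D.τ D.h D.b)
    (hp : ∀ α, IsPump D G inp α (pump D G inp α)) (hα : α ∈ arms D G r) {t w : ℕ}
    (hw : w ∈ block D G inp α t) : 1 ≤ w ∧ w < 2 ^ D.b := by
  by_cases ht : t < 2 * D.halfLen
  · rw [block_of_lt ht] at hw
    obtain ⟨β, s, h1, h2, h3⟩ := exists_stripRoot_eq hp ht (α := α)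
    have hβ : IsArm G D.τ D.h D.b β := by unfold IsArm; rw [h1]; exact hα.1
    rw [h3] at hw
    exact hG.ident_of_reachable (reachable_of_mem_hang hG.one_le_τ (hβ.core_neg h2.le) hw)
      ((hβ.nbr_neg h2.le _).2 (Or.inl rfl)).1
  · obtain rfl : w = arm G D.τ D.h α 0 := by
      have : block D G inp α t = {arm G D.τ D.h α 0} := if_neg ht
      rw [this] at hw
      exact hw
    exact hG.ident _ _ hα.1.adj_zero

theorem Admissible.ident_base (hG : Admissible G D.Δ D.τ D.h D.b) (hα : α ∈ arms D G r) {w : ℕ}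
    (hw : w ∈ base D G r) : 1 ≤ w ∧ w < 2 ^ D.b :=
  hG.ident_of_reachable
    ((SimpleGraph.Reachable.trans (SimpleGraph.Reachable.symm hα.2) hw).mono baseGraph_le)
    ((hα.1.nbr_neg le_rfl _).2 (Or.inl rfl)).1

theorem Admissible.ident_arm (hG : Admissible G D.Δ D.τ D.h D.b) (hα : α ∈ arms D G r) :
    α.1 < 2 ^ D.b := by
  have hc := Ruling.isChain hα.1
  have := hc.adj (i := 0) (by omega) (by omega)
  rw [hc.zero] at this
  exact (hG.ident _ _ this).2

/-- The identifiers in the network are distinct. Two arms at the same cut edge would use the same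
ones, but they belong to different pieces. -/
theorem Admissible.injOn_networkIdent (hG : Admissible G D.Δ D.τ D.h D.b)
    (hp : ∀ α, IsPump D G inp α (pump D G inp α)) :
    Set.InjOn (networkIdent D) (networkNodes D G inp r α₁ q) := by
  have hmix : ∀ w α t w', w ∈ base D G r → α ∈ arms D G r →
      networkIdent D (.inl w) ≠ networkIdent D (.inr (α, t, w')) := by
    intro w α t w' hw hα he
    have h1 := (hG.ident_base hα hw).2
    simp only [networkIdent, stripIdent] at he
    have h2 : 1 * 2 ^ D.b ≤ (stripPos D α t + 1) * 2 ^ D.b := Nat.mul_le_mul_right _ (by omega)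
    have h3 : ((stripPos D α t + 1) * 2 ^ D.b + α.1) * 1 ≤
        ((stripPos D α t + 1) * 2 ^ D.b + α.1) * 2 ^ D.b :=
      Nat.mul_le_mul_left _ Nat.one_le_two_pow
    omega
  rintro (w | ⟨α, t, w⟩) hx (w' | ⟨α', t', w'⟩) hy he
  · exact congrArg _ he
  · exact absurd he (hmix _ _ _ _ hx hy.1)
  · exact absurd he.symm (hmix _ _ _ _ hy hx.1)
  · obtain ⟨hα, _, hw⟩ := hx
    obtain ⟨hα', _, hw'⟩ := hy
    obtain ⟨h1, h2⟩ := mul_add_inj (hG.ident_block hp hα hw).2 (hG.ident_block hp hα' hw').2 he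
    obtain ⟨h3, h4⟩ := mul_add_inj (hG.ident_arm hα) (hG.ident_arm hα') h1
    dsimp only at h2 h3
    have hαα : α = α' := by
      by_contra hne
      have : α' = opp α := Prod.ext h4.symm (by
        have : α.2 ≠ α'.2 := fun h => hne (Prod.ext h4 h)
        revert this
        cases h5 : α.2 <;> cases h6 : α'.2 <;> simp [opp, h5])
      subst this
      exact hG.not_reachable_opp hα.1
        (SimpleGraph.Reachable.trans (SimpleGraph.Reachable.symm hα.2) hα'.2)
    subst hαα
    obtain rfl : t = t' := stripPos_inj (D := D) (α := α) (by omega)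
    rw [h2]

theorem Admissible.networkIdent_mem (hG : Admissible G D.Δ D.τ D.h D.b)
    (hp : ∀ α, IsPump D G inp α (pump D G inp α)) (hα₁ : α₁ ∈ arms D G r) :
    ∀ x ∈ networkNodes D G inp r α₁ q, 1 ≤ networkIdent D x ∧
      networkIdent D x ≤ (2 * D.halfLen + q + 2) * 2 ^ D.b * 2 ^ D.b := by
  rintro (w | ⟨α, t, w⟩) hx
  · have h1 := hG.ident_base hα₁ hx
    refine ⟨h1.1, ?_⟩
    calc w ≤ 1 * 2 ^ D.b := by omega
      _ ≤ _ := Nat.mul_le_mul_right _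
        (Nat.mul_pos (by omega) (by positivity))
  · obtain ⟨hα, ht, hw⟩ := hx
    have h1 := hG.ident_block hp hα hw
    have h2 := hG.ident_arm hα
    have h3 : stripPos D α t + 1 ≤ 2 * D.halfLen + q + 1 := by
      unfold armLength at ht
      unfold stripPos
      split_ifs at * <;> omega
    refine ⟨by simp only [networkIdent, stripIdent]; omega, ?_⟩
    simp only [networkIdent, stripIdent]
    calc ((stripPos D α t + 1) * 2 ^ D.b + α.1) * 2 ^ D.b + w
        ≤ ((stripPos D α t + 1) * 2 ^ D.b + α.1 + 1) * 2 ^ D.b := by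
          rw [Nat.succ_mul (_ + α.1)]; omega
      _ ≤ (2 * D.halfLen + q + 2) * 2 ^ D.b * 2 ^ D.b := by
        refine Nat.mul_le_mul_right _ ?_
        calc _ ≤ (stripPos D α t + 1 + 1) * 2 ^ D.b := by rw [Nat.succ_mul (_ + 1)]; omega
          _ ≤ _ := Nat.mul_le_mul_right _ (by omega)

theorem networkNodes_succ (hα₁ : α₁ ∈ arms D G r) (q : ℕ) :
    networkNodes D G inp r α₁ (q + 1) =
      insert (.inr (α₁, 2 * D.halfLen + 1 + q, arm G D.τ D.h α₁ 0))
        (networkNodes D G inp r α₁ q) := by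
  have hb : ∀ q, block D G inp α₁ (2 * D.halfLen + 1 + q) = {arm G D.τ D.h α₁ 0} := fun q =>
    if_neg (by omega)
  ext (w | ⟨α, t, w⟩)
  · simp only [networkNodes, Set.mem_insert_iff, reduceCtorEq, false_or]
    rfl
  · simp only [networkNodes, inr_mem_spiderNodes, Set.mem_insert_iff, Sum.inr.injEq,
      Prod.mk.injEq, armLength]
    by_cases hα : α = α₁
    · subst hα
      simp only [if_true]
      by_cases ht : t = 2 * D.halfLen + 1 + q
      · subst ht
        simp only [hb, Set.mem_singleton_iff]
        constructor
        · exact fun h => Or.inl ⟨trivial, trivial, h.2.2⟩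
        · rintro (⟨_, _, rfl⟩ | ⟨_, h, _⟩)
          · exact ⟨hα₁, by omega, rfl⟩
          · omega
      · constructor
        · exact fun h => Or.inr ⟨h.1, by omega, h.2.2⟩
        · rintro (⟨_, h, _⟩ | h)
          · exact absurd h ht
          · exact ⟨h.1, by omega, h.2.2⟩
    · simp [hα]

/-- Every large number of nodes can be reached by padding. -/
theorem Admissible.exists_network (hG : Admissible G D.Δ D.τ D.h D.b)
    (hp : ∀ α, IsPump D G inp α (pump D G inp α)) (hα₁ : α₁ ∈ arms D G r) {N : ℕ}
    (hN : (2 * D.halfLen + 2) * 2 ^ D.b * 2 ^ D.b ≤ N) :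
    ∃ q, (networkNodes D G inp r α₁ q).Finite ∧ (networkNodes D G inp r α₁ q).ncard = N ∧
      ∃ ident : ℕ ⊕ ((ℕ × Bool) × ℕ × ℕ) → ℕ, Set.InjOn ident (networkNodes D G inp r α₁ q) ∧
        (∀ x ∈ networkNodes D G inp r α₁ q, 1 ≤ ident x ∧ ident x ≤ N) ∧
        ∀ α ∈ arms D G r, ∀ t < 2 * D.halfLen, ∀ w ∈ block D G inp α t,
          ident (.inr (α, t, w)) = stripIdent D.b α.1 (stripPos D α t, w) := by
  have hfin : ∀ q, (networkNodes D G inp r α₁ q).Finite := fun q =>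
    Set.Finite.of_injOn (t := Set.Icc 1 ((2 * D.halfLen + q + 2) * 2 ^ D.b * 2 ^ D.b))
      (hG.networkIdent_mem hp hα₁) (hG.injOn_networkIdent hp) (Set.finite_Icc _ _)
  have h0 : (networkNodes D G inp r α₁ 0).ncard ≤ N := by
    refine le_trans (Set.ncard_le_ncard_of_injOn (networkIdent D)
      (t := Set.Icc 1 ((2 * D.halfLen + 0 + 2) * 2 ^ D.b * 2 ^ D.b))
      (hG.networkIdent_mem hp hα₁) (hG.injOn_networkIdent hp) (Set.finite_Icc _ _)) ?_
    rw [← Nat.card_coe_set_eq, Nat.card_eq_fintype_card, Fintype.card_Icc, Nat.card_Icc]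
    simpa using hN
  have hsucc : ∀ q, (networkNodes D G inp r α₁ q).ncard =
      (networkNodes D G inp r α₁ 0).ncard + q := by
    intro q
    induction q with
    | zero => rfl
    | succ q ih =>
      rw [networkNodes_succ hα₁, Set.ncard_insert_of_notMem _ (hfin q), ih, add_assoc]
      rintro ⟨_, h, _⟩
      simp [armLength] at h
  have hsub : networkNodes D G inp r α₁ 0 ⊆
      networkNodes D G inp r α₁ (N - (networkNodes D G inp r α₁ 0).ncard) := by
    rintro (w | ⟨α, t, w⟩) hx
    · exact hx
    · obtain ⟨h1, h2, h3⟩ := hx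
      refine ⟨h1, lt_of_lt_of_le h2 ?_, h3⟩
      unfold armLength
      split_ifs <;> omega
  have hcard : (networkNodes D G inp r α₁
      (N - (networkNodes D G inp r α₁ 0).ncard)).ncard = N := by
    rw [hsucc]; omega
  refine ⟨N - (networkNodes D G inp r α₁ 0).ncard, hfin _, hcard, ?_⟩
  obtain ⟨g, h1, h2, h3⟩ := exists_ident_extension (hfin _) hsub
    (hG.injOn_networkIdent hp) (fun x hx => ⟨(hG.networkIdent_mem hp hα₁ x hx).1, by
      rw [hcard]
      exact (hG.networkIdent_mem hp hα₁ x hx).2.trans hN⟩)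
  rw [hcard] at h2
  exact ⟨g, h1, h2, fun α hα t ht w hw => h3 _ ⟨hα, by unfold armLength; omega, hw⟩⟩

/-- The pumped near block of an arm can be exchanged for the real one. -/
theorem Admissible.exists_near_solution (hG : Admissible G D.Δ D.τ D.h D.b)
    (hp : ∀ α, IsPump D G inp α (pump D G inp α)) (hα : α ∈ arms D G r)
    {out : ℕ ⊕ ((ℕ × Bool) × ℕ × ℕ) → O}
    {x : ℕ ⊕ ((ℕ × Bool) × ℕ × ℕ) → ℕ ⊕ ((ℕ × Bool) × ℕ × ℕ) → D.Label}
    (hok : ∀ y ∈ networkNodes D G inp r α₁ q,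
      NodeOK D.P D.Δ (network D G inp r α₁ q) (networkInp inp) out x y) :
    ∃ (m : ℕ → D.Label × D.Label) (o' : ℕ → ℕ → O) (x' : ℕ → ℕ → ℕ → D.Label),
      (∀ s < D.h, ∀ w ∈ hang G D.τ (arm G D.τ D.h α (-(s : ℤ))),
        NodeOK D.P D.Δ G inp (o' s) (x' s) w) ∧
      (∀ s < D.h,
        (x' s (arm G D.τ D.h α (1 - s)) (arm G D.τ D.h α (-(s : ℤ))),
          x' s (arm G D.τ D.h α (-(s : ℤ))) (arm G D.τ D.h α (1 - s))) = m s ∧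
        (x' s (arm G D.τ D.h α (-(s : ℤ))) (arm G D.τ D.h α (-(s : ℤ) - 1)),
          x' s (arm G D.τ D.h α (-(s : ℤ) - 1)) (arm G D.τ D.h α (-(s : ℤ)))) = m (s + 1)) ∧
      m 0 = (x (.inr (α, D.halfLen, blockRoot D G inp α D.halfLen))
          (.inr (α, D.halfLen - 1, blockRoot D G inp α (D.halfLen - 1))),
        x (.inr (α, D.halfLen - 1, blockRoot D G inp α (D.halfLen - 1)))
          (.inr (α, D.halfLen, blockRoot D G inp α D.halfLen))) ∧
      m D.h = (x (.inr (α, 0, blockRoot D G inp α 0)) (.inl (arm G D.τ D.h α (-(D.h : ℤ)))),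
        x (.inl (arm G D.τ D.h α (-(D.h : ℤ)))) (.inr (α, 0, blockRoot D G inp α 0))) := by
  have hl := halfLen_lt (D := D)
  let R : ℕ → ℕ ⊕ ((ℕ × Bool) × ℕ × ℕ) := fun t => .inr (α, t, blockRoot D G inp α t)
  let m₀ : ℕ → D.Label × D.Label := fun s =>
    (x (R (D.halfLen - s)) (prevRoot D G inp α (D.halfLen - s)),
      x (prevRoot D G inp α (D.halfLen - s)) (R (D.halfLen - s)))
  have hprev : ∀ t, prevRoot D G inp α (t + 1) = R t := fun t => by
    simp [prevRoot, spiderPrev, R]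
  have hrel : prodRel (fun s => nearWord D G inp α (pump D G inp α s)) D.halfLen (m₀ 0)
      (m₀ D.halfLen) := by
    rw [prodRel_iff]
    refine ⟨m₀, rfl, rfl, fun s hs => ?_⟩
    obtain ⟨t, ht⟩ : ∃ t, D.halfLen - s = t + 1 := ⟨D.halfLen - s - 1, by omega⟩
    have hg := (hp α).1 s hs
    have hroot : stripRoot D G inp α t = arm G D.τ D.h α (-(pump D G inp α s : ℤ)) := by
      rw [stripRoot, if_pos (by omega), show D.halfLen - 1 - t = s by omega]
    have htl : t < 2 * D.halfLen := by omega
    have hbij := hG.bijOn_blockMap (α₁ := α₁) (q := q) hα htl hα.1 hg.le hroot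
    have hbl := blockRel_of_nodeOK (P := D.P) (Δ := D.Δ) hG.one_le_τ (hα.1.core_neg hg.le)
      (hα.1.nbr_neg hg.le) (hα.1.ne_neg hg.le) hbij (inp := inp) (inpS := networkInp inp)
      (outS := out) (xS := x) (fun _ _ => rfl)
      (fun w hw => hok _ ⟨hα, by unfold armLength; omega, by rwa [block_of_lt htl, hroot]⟩)
    have e1 : (.inr (α, t, arm G D.τ D.h α (-(pump D G inp α s : ℤ))) :
        ℕ ⊕ ((ℕ × Bool) × ℕ × ℕ)) = R t := by
      simp only [R]; rw [blockRoot_of_lt htl, hroot]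
    rw [e1] at hbl
    have e2 : D.halfLen - (s + 1) = t := by omega
    simp only [nearWord, if_pos hg, m₀, e2, ht, hprev]
    exact hbl
  rw [(hp α).2, prodRel_iff] at hrel
  obtain ⟨m, hm0, hmh, hm⟩ := hrel
  have hex : ∀ s, ∃ (o' : ℕ → O) (x' : ℕ → ℕ → D.Label), s < D.h →
      (∀ w ∈ hang G D.τ (arm G D.τ D.h α (-(s : ℤ))), NodeOK D.P D.Δ G inp o' x' w) ∧
      (x' (arm G D.τ D.h α (1 - s)) (arm G D.τ D.h α (-(s : ℤ))),
          x' (arm G D.τ D.h α (-(s : ℤ))) (arm G D.τ D.h α (1 - s))) = m s ∧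
        (x' (arm G D.τ D.h α (-(s : ℤ))) (arm G D.τ D.h α (-(s : ℤ) - 1)),
          x' (arm G D.τ D.h α (-(s : ℤ) - 1)) (arm G D.τ D.h α (-(s : ℤ)))) = m (s + 1) := by
    intro s
    by_cases hs : s < D.h
    · have := hm s hs
      rw [nearWord, if_pos hs] at this
      obtain ⟨o', x', h⟩ := this
      exact ⟨o', x', fun _ => h⟩
    · exact ⟨fun _ => out (.inl 0), fun _ _ => x (.inl 0) (.inl 0), fun h => absurd h hs⟩
  choose o' x' h' using hex
  refine ⟨m, o', x', fun s hs => (h' s hs).1, fun s hs => (h' s hs).2, ?_, ?_⟩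
  · rw [hm0]
    simp only [m₀, Nat.sub_zero, prevRoot, spiderPrev, R]
    rw [if_neg (by omega)]
  · rw [hmh]
    simp only [m₀, Nat.sub_self, prevRoot, spiderPrev, R, if_true]

/-- A piece with at least one arm has a solution that carries the prescribed labels on the cut
edges. -/
theorem Admissible.exists_solution_of_arm (hG : Admissible G D.Δ D.τ D.h D.b)
    (hr : ∀ α, IsArm G D.τ D.h D.b α → r ∉ nearBlock G D.τ D.h α)
    (hp : ∀ α, IsPump D G inp α (pump D G inp α)) (hα₁ : α₁ ∈ arms D G r) {N k : ℕ} (hk : 1 ≤ k)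
    (hN : (2 * D.halfLen + 2) * 2 ^ D.b * 2 ^ D.b ≤ N) {A : LocalAlgorithm I O} {t : ℕ → ℕ}
    (hA : D.P.SolvedBy (treesOfDegreeAtMost D.Δ) k A t) (hDA : D.A = A N) (hDT : D.T = t N) :
    ∃ (out : ℕ → O) (x : ℕ → ℕ → D.Label),
      (∀ w ∈ piece G D.τ D.h D.b r, NodeOK D.P D.Δ G inp out x w) ∧
      ∀ α ∈ arms D G r, (x (arm G D.τ D.h α 0) (arm G D.τ D.h α 1),
        x (arm G D.τ D.h α 1) (arm G D.τ D.h α 0)) = armLabel D G inp α := by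
  classical
  have h1 := hG.one_le_h
  obtain ⟨q, hfin, hcard, ident, hid1, hid2, hid3⟩ := hG.exists_network hp hα₁ hN
  set outS : ℕ ⊕ ((ℕ × Bool) × ℕ × ℕ) → O := fun x =>
    D.A (localView (network D G inp r α₁ q) ident (networkInp inp) D.T x) with houtS
  set xS := msgLabel D.Δ (network D G inp r α₁ q) (fun x => (networkInp inp x, outS x)) D.P.r
    with hxS
  have hok := nodeOK_of_solvedBy network_closed hfin (hG.isTree_network hp)
    (hG.encard_neighborSet_network hr hp) hA hid1
    (fun x hx => ⟨(hid2 x hx).1, (hid2 x hx).2.trans (by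
      rw [hcard]; exact Nat.le_self_pow (by omega) N)⟩) (networkInp inp) (out := outS)
    (by rw [hcard, houtS, hDA, hDT])
  -- the run on the network has the prescribed labels on the middle edges, and it can be continued
  -- from there, and from the base, to the original near blocks
  have hcut : ∀ α ∈ arms D G r, _ := fun α hα => hG.msgLabel_network hα hp hid3 houtS
  have hnear : ∀ α, ∃ (m : ℕ → D.Label × D.Label) (o' : ℕ → ℕ → O) (x' : ℕ → ℕ → ℕ → D.Label),
      α ∈ arms D G r → _ := fun α => by
    by_cases hα : α ∈ arms D G r
    · obtain ⟨m, o', x', h⟩ := hG.exists_near_solution hp hα hok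
      exact ⟨m, o', x', fun _ => h⟩
    · exact ⟨fun _ => (xS (.inl 0) (.inl 0), xS (.inl 0) (.inl 0)), fun _ _ => outS (.inl 0),
        fun _ _ _ => xS (.inl 0) (.inl 0), fun h => absurd h hα⟩
  choose m o' x' hm using hnear
  -- the partition of the piece into the base and the hanging trees of the near blocks
  have hidx : ∃ β : ℕ → Option ((ℕ × Bool) × ℕ), (∀ w ∈ base D G r, β w = none) ∧
      ∀ α ∈ arms D G r, ∀ s < D.h, ∀ w ∈ hang G D.τ (arm G D.τ D.h α (-(s : ℤ))),
        β w = some (α, s) := by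
    refine ⟨fun w => if w ∈ base D G r then none else some (Classical.epsilon fun p =>
      p.1 ∈ arms D G r ∧ p.2 < D.h ∧ w ∈ hang G D.τ (arm G D.τ D.h p.1 (-(p.2 : ℤ)))),
      fun w hw => if_pos hw, fun α hα s hs w hw => ?_⟩
    have hnb : w ∉ base D G r := fun h =>
      hG.notMem_nearBlock_of_reachable hr h α hα.1 ⟨s, hs, hw⟩
    have hsp := Classical.epsilon_spec (p := fun p : (ℕ × Bool) × ℕ => p.1 ∈ arms D G r ∧
      p.2 < D.h ∧ w ∈ hang G D.τ (arm G D.τ D.h p.1 (-(p.2 : ℤ)))) ⟨(α, s), hα, hs, hw⟩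
    have := hG.eq_of_mem_hang_arm hsp.1.1 hα.1 hsp.2.1.le hs.le hsp.2.2 hw
    dsimp only
    rw [if_neg hnb]
    exact congrArg some (Prod.ext this.1 this.2)
  obtain ⟨β, hβ0, hβ1⟩ := hidx
  let out : Option ((ℕ × Bool) × ℕ) → ℕ → O := fun i => match i with
    | none => fun w => outS (baseMap D G inp r w)
    | some (α, s) => o' α s
  let x : Option ((ℕ × Bool) × ℕ) → ℕ → ℕ → D.Label := fun i => match i with
    | none => fun w u => xS (baseMap D G inp r w) (baseMap D G inp r u)
    | some (α, s) => x' α s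
  have hself : ∀ (α : ℕ × Bool) (i : ℤ), arm G D.τ D.h α i ∈ hang G D.τ (arm G D.τ D.h α i) :=
    fun _ _ => mem_hang_self _
  have hb : ∀ w ∈ base D G r, baseMap D G inp r w = .inl w := fun w hw => if_pos hw
  have hE : ∀ α ∈ arms D G r, baseMap D G inp r (arm G D.τ D.h α (1 - D.h)) =
      .inr (α, 0, blockRoot D G inp α 0) := by
    intro α hα
    have : arm G D.τ D.h α (1 - D.h) ∉ base D G r := fun h =>
      hG.notMem_nearBlock_of_reachable hr h α hα.1 hG.mem_nearBlock
    rw [baseMap, if_neg this, hG.armOf_eq hα.1]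
  have cast1 : ∀ s : ℕ, (1 : ℤ) - ((s + 1 : ℕ) : ℤ) = -(s : ℤ) := fun s => by push_cast; ring
  have cast2 : ∀ s : ℕ, -(s : ℤ) - 1 = -((s + 1 : ℕ) : ℤ) := fun s => by push_cast; ring
  obtain ⟨h', hh'⟩ : ∃ h', D.h = h' + 1 := ⟨D.h - 1, by omega⟩
  have hend : ∀ α ∈ arms D G r, β (arm G D.τ D.h α (1 - D.h)) = some (α, h') := by
    intro α hα
    refine hβ1 α hα h' (by omega) _ ?_
    have e : (1 : ℤ) - D.h = -(h' : ℤ) := by omega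
    rw [e]
    exact hself _ _
  -- the labels agree at the edges where arms are attached
  have hattach : ∀ α ∈ arms D G r,
      x none (arm G D.τ D.h α (1 - D.h)) (arm G D.τ D.h α (-(D.h : ℤ))) =
        x (some (α, h')) (arm G D.τ D.h α (1 - D.h)) (arm G D.τ D.h α (-(D.h : ℤ))) ∧
      x none (arm G D.τ D.h α (-(D.h : ℤ))) (arm G D.τ D.h α (1 - D.h)) =
        x (some (α, h')) (arm G D.τ D.h α (-(D.h : ℤ))) (arm G D.τ D.h α (1 - D.h)) := by
    intro α hα
    obtain ⟨-, h2, -, h4⟩ := hm α hα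
    have h5 := (h2 h' (by omega)).2
    rw [← hh', h4] at h5
    have e1 : (1 : ℤ) - D.h = -(h' : ℤ) := by omega
    have e2 : -(D.h : ℤ) = -(h' : ℤ) - 1 := by omega
    simp only [x]
    rw [hE α hα, hb _ hα.2, e1]
    rw [← e2] at h5
    exact ⟨(congrArg Prod.fst h5).symm, (congrArg Prod.snd h5).symm⟩
  have hpart : ∀ w ∈ piece G D.τ D.h D.b r,
      NodeOK D.P D.Δ G inp (out (β w)) (x (β w)) w := by
    rintro w (hw | ⟨α, hα, hB, s, hs, hw⟩)
    · rw [hβ0 w hw]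
      refine (nodeOK_iff_of_bijOn (φ := baseMap D G inp r) (v' := .inl w)
        (hG.bijOn_baseMap (α₁ := α₁) (q := q) hr hw) rfl ?_ ?_).1 (hok _ hw)
      · simp only [out]; rw [hb w hw]
      · intro u _
        simp only [x]; rw [hb w hw]; exact ⟨rfl, rfl⟩
    · rw [hβ1 α ⟨hα, hB⟩ s hs w hw]
      exact (hm α ⟨hα, hB⟩).1 s hs w hw
  have hagree : ∀ w ∈ piece G D.τ D.h D.b r, ∀ u ∈ piece G D.τ D.h D.b r, G.Adj w u →
      x (β u) u w = x (β w) u w := by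
    rintro w (hw | ⟨α, hα, hB, s, hs, hw⟩) u hu ha
    · rcases hG.adj_base hr hw ha with h | ⟨α, hα, rfl, rfl⟩
      · rw [hβ0 w hw, hβ0 u (SimpleGraph.Reachable.trans hw h.reachable)]
      · rw [hβ0 _ hw, hend α ⟨hα, hw⟩]
        exact (hattach α ⟨hα, hw⟩).1.symm
    · rcases hG.adj_hang_arm hα hs.le hw ha with hh | ⟨rfl, rfl | rfl⟩
      · rw [hβ1 α ⟨hα, hB⟩ s hs w hw, hβ1 α ⟨hα, hB⟩ s hs u hh]
      · rcases s with _ | s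
        · -- the other end of a cut edge is not in the piece
          exfalso
          have hopp : arm G D.τ D.h α (1 - (0 : ℕ)) ∈ nearBlock G D.τ D.h (opp α) :=
            ⟨0, by omega, by rw [arm_opp]; simpa using hself α 1⟩
          rcases hu with hu | ⟨γ, hγ, hγB, hu⟩
          · exact hG.notMem_nearBlock_of_reachable hr hu _ hα.opp hopp
          · obtain rfl := hG.eq_of_mem_nearBlock hγ hα.opp hu hopp
            exact hG.not_reachable_opp hα
              (SimpleGraph.Reachable.trans (SimpleGraph.Reachable.symm hB) hγB)
        · rw [cast1, hβ1 α ⟨hα, hB⟩ (s + 1) hs _ hw, hβ1 α ⟨hα, hB⟩ s (by omega) _ (hself _ _)]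
          have h2 := (hm α ⟨hα, hB⟩).2.1
          have h5 := (h2 (s + 1) hs).1
          have h6 := (h2 s (by omega)).2
          rw [cast1] at h5
          rw [cast2] at h6
          exact congrArg Prod.fst (h6.trans h5.symm)
      · by_cases he : s + 1 = D.h
        · obtain rfl : s = h' := by omega
          have e1 : -(s : ℤ) - 1 = -(D.h : ℤ) := by omega
          have e2 : -(s : ℤ) = 1 - D.h := by omega
          rw [hβ1 α ⟨hα, hB⟩ s hs _ hw, e1, hβ0 _ hB, e2]
          exact (hattach α ⟨hα, hB⟩).2
        · rw [hβ1 α ⟨hα, hB⟩ s hs _ hw, cast2,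
            hβ1 α ⟨hα, hB⟩ (s + 1) (by omega) _ (hself _ _)]
          have h2 := (hm α ⟨hα, hB⟩).2.1
          have h5 := (h2 (s + 1) (by omega)).1
          have h6 := (h2 s hs).2
          rw [cast1] at h5
          rw [cast2] at h6
          exact congrArg Prod.snd (h5.trans h6.symm)
  obtain ⟨out', x'', hsol, -, hx''⟩ := exists_nodeOK_of_parts _ β out x hpart hagree
  refine ⟨out', x'', hsol, fun α hα => ?_⟩
  have h0 : arm G D.τ D.h α 0 ∈ hang G D.τ (arm G D.τ D.h α (-((0 : ℕ) : ℤ))) := by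
    simpa using hself α 0
  have hK : arm G D.τ D.h α 0 ∈ piece G D.τ D.h D.b r :=
    Or.inr ⟨α, hα.1, hα.2, 0, by omega, h0⟩
  obtain ⟨e1, e2⟩ := hx'' _ hK _ hα.1.adj_zero
  rw [e1, e2, hβ1 α hα 0 (by omega) _ h0]
  obtain ⟨-, h2, h3, -⟩ := hm α hα
  have h5 := (h2 0 (by omega)).1
  rw [h3] at h5
  have h6 := hcut α hα
  simp only [Nat.cast_zero, sub_zero, neg_zero] at h5
  rw [← h6]
  exact Prod.ext (congrArg Prod.snd h5) (congrArg Prod.fst h5)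

end Solution

/-! ### Fitting the solutions on the components together -/

section Local

variable {I O : Type*} {D : Params I O} {G : SimpleGraph ℕ} {inp : ℕ → I} {v w : ℕ}

/-- Output labels and labels of half-edges that form a solution on the component of `v` after
cutting, with the prescribed labels on the cut edges. -/
def IsPieceSolution (D : Params I O) (G : SimpleGraph ℕ) (inp : ℕ → I) (v : ℕ)
    (y : (ℕ → O) × (ℕ → ℕ → D.Label)) : Prop :=
  (∀ w, (cutGraph G D.τ (2 * D.h + 2) D.b).Reachable v w → NodeOK D.P D.Δ G inp y.1 y.2 w) ∧
  ∀ α, IsArm G D.τ D.h D.b α →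
    (cutGraph G D.τ (2 * D.h + 2) D.b).Reachable v (arm G D.τ D.h α 0) →
    (y.2 (arm G D.τ D.h α 0) (arm G D.τ D.h α 1), y.2 (arm G D.τ D.h α 1) (arm G D.τ D.h α 0)) =
      armLabel D G inp α

/-- A component at which an edge is cut has a solution by `Admissible.exists_solution_of_arm`. For
the other ones there is nothing to prescribe, and a solution on the whole graph serves. -/
theorem Admissible.exists_isPieceSolution (hG : Admissible G D.Δ D.τ D.h D.b)
    (hp : ∀ α, IsPump D G inp α (pump D G inp α)) {N k : ℕ} (hk : 1 ≤ k)
    (hN : (2 * D.halfLen + 2) * 2 ^ D.b * 2 ^ D.b ≤ N) {A : LocalAlgorithm I O} {t : ℕ → ℕ}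
    (hA : D.P.SolvedBy (treesOfDegreeAtMost D.Δ) k A t) (hDA : D.A = A N) (hDT : D.T = t N)
    (hsol : ∃ (out : ℕ → O) (x : ℕ → ℕ → D.Label), ∀ w, G.Reachable v w →
      NodeOK D.P D.Δ G inp out x w) : ∃ y, IsPieceSolution D G inp v y := by
  obtain ⟨r, hr, hK⟩ := hG.exists_piece v
  have hcut : ∀ α, IsArm G D.τ D.h D.b α → arm G D.τ D.h α 0 ∈ piece G D.τ D.h D.b r →
      α ∈ arms D G r := by
    intro α hα h
    have h0 : arm G D.τ D.h α 0 ∈ nearBlock G D.τ D.h α :=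
      ⟨0, hG.one_le_h, by simpa using mem_hang_self _⟩
    rcases h with h | ⟨β, hβ, hB, h⟩
    · exact absurd h0 (hG.notMem_nearBlock_of_reachable hr h α hα)
    · obtain rfl := hG.eq_of_mem_nearBlock hα hβ h0 h
      exact ⟨hα, hB⟩
  by_cases harm : ∃ α₁, α₁ ∈ arms D G r
  · obtain ⟨α₁, hα₁⟩ := harm
    obtain ⟨out, x, h1, h2⟩ := hG.exists_solution_of_arm hr hp hα₁ hk hN hA hDA hDT
    exact ⟨(out, x), fun w hw => h1 w (hK w hw), fun α hα h => h2 α (hcut α hα (hK _ h))⟩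
  · obtain ⟨out, x, h1⟩ := hsol
    exact ⟨(out, x), fun w hw => h1 w (hw.mono cutGraph_le),
      fun α hα h => absurd ⟨α, hcut α hα (hK _ h)⟩ harm⟩

theorem Code.nonempty (Δ : ℕ) (L : Type*) [Nonempty L] : ∀ d, Nonempty (Code Δ L d)
  | 0 => inferInstanceAs (Nonempty L)
  | _ + 1 => ⟨(Classical.arbitrary L, fun _ => 0)⟩

instance [Nonempty I] [Nonempty O] : Nonempty D.Label :=
  ⟨fun d => (Code.nonempty D.Δ (I × O) d).some⟩

/-- A fixed choice of a solution on the component of `v`. -/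
noncomputable def pieceSolution [Nonempty I] [Nonempty O] (D : Params I O) (G : SimpleGraph ℕ)
    (inp : ℕ → I) (v : ℕ) : (ℕ → O) × (ℕ → ℕ → D.Label) :=
  Classical.epsilon (IsPieceSolution D G inp v)

theorem pieceSolution_eq_of_reachable [Nonempty I] [Nonempty O]
    (h : (cutGraph G D.τ (2 * D.h + 2) D.b).Reachable v w) :
    pieceSolution D G inp v = pieceSolution D G inp w := by
  have : ∀ u, (cutGraph G D.τ (2 * D.h + 2) D.b).Reachable v u ↔
      (cutGraph G D.τ (2 * D.h + 2) D.b).Reachable w u := fun u => ⟨h.symm.trans, h.trans⟩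
  unfold pieceSolution IsPieceSolution
  simp only [this]

/-- The chosen solutions on the components fit together. -/
theorem exists_nodeOK_pieceSolution [Nonempty I] [Nonempty O]
    {S : Set ℕ} (hsol : ∀ v ∈ S, ∃ y, IsPieceSolution D G inp v y) :
    ∃ x, ∀ v ∈ S, NodeOK D.P D.Δ G inp (fun v => (pieceSolution D G inp v).1 v) x v := by
  have hspec : ∀ v ∈ S, IsPieceSolution D G inp v (pieceSolution D G inp v) := fun v hv =>
    Classical.epsilon_spec (hsol v hv)
  obtain ⟨out', x', h1, h2, -⟩ := exists_nodeOK_of_parts (P := D.P) (Δ := D.Δ) (G := G)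
    (inp := inp) S (pieceSolution D G inp) (fun y => y.1) (fun y => y.2)
    (fun w hw => (hspec w hw).1 w (.refl _)) (by
      intro w hw u hu ha
      by_cases hc : IsCut G D.τ (2 * D.h + 2) D.b w u
      · obtain ⟨α, hα, rfl, rfl⟩ := exists_arm_of_isCut hc
        have e1 := (hspec _ hw).2 α hα (.refl _)
        have e2 := (hspec _ hu).2 (opp α) hα.opp (by rw [arm_opp]; exact .refl _)
        rw [arm_opp, arm_opp, sub_self] at e2
        have e3 : armLabel D G inp (opp α) = (armLabel D G inp α).swap := by
          rcases α with ⟨v, _ | _⟩ <;> simp [armLabel, opp]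
        rw [e3, ← e1] at e2
        exact congrArg Prod.fst e2
      · rw [pieceSolution_eq_of_reachable (SimpleGraph.Adj.reachable
          (show (cutGraph G D.τ (2 * D.h + 2) D.b).Adj w u from ⟨ha, hc⟩))])
  exact ⟨x', fun v hv => (h1 v hv).congr (h2 v).symm fun _ _ => ⟨rfl, rfl⟩⟩

end Local

/-! ### Locality of the construction -/

section Agree

variable {V I O : Type*} {G G' : SimpleGraph V} {inp inp' : V → I} {v u w : V} {ρ m τ : ℕ}

/-- The two networks look the same around the nodes at distance at most `ρ` from `v`. -/
def Agree (ρ : ℕ) (G G' : SimpleGraph V) (inp inp' : V → I) (v : V) : Prop :=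
  ∀ u, G.edist v u ≤ (ρ : ℕ∞) → (∀ w, G.Adj u w ↔ G'.Adj u w) ∧ inp u = inp' u

theorem Agree.mono {l : ℕ} (h : Agree ρ G G' inp inp' v) (hl : l ≤ ρ) :
    Agree l G G' inp inp' v := fun u hu => h u (edist_le_mono hu hl)

theorem Agree.shift {l : ℕ} (h : Agree ρ G G' inp inp' v) (hu : G.edist v u ≤ (m : ℕ∞))
    (hl : m + l ≤ ρ) : Agree l G G' inp inp' u := fun _ hz =>
  h _ (edist_le_mono (edist_le_add hu hz) hl)

theorem Agree.bijOn (h : Agree ρ G G' inp inp' v) (hu : G.edist v u ≤ (ρ : ℕ∞)) :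
    Set.BijOn id (G.neighborSet u) (G'.neighborSet u) := by
  have : G.neighborSet u = G'.neighborSet u := Set.ext fun w => (h u hu).1 w
  rw [this]
  exact Set.bijOn_id _

theorem Agree.edist_le_iff (h : Agree ρ G G' inp inp' v) (hm : m ≤ ρ + 1) :
    G'.edist v u ≤ (m : ℕ∞) ↔ G.edist v u ≤ (m : ℕ∞) := by
  have := edist_image_iff (G := G) (G' := G') (φ := id) (v := v) (t := ρ + 1)
    (fun u hu => h.bijOn (edist_lt_natCast_succ_iff.1 hu)) m hm u
  simpa using this

theorem Agree.symm (h : Agree ρ G G' inp inp' v) : Agree ρ G' G inp' inp v := fun u hu => by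
  have := h u ((h.edist_le_iff (by omega)).1 hu)
  exact ⟨fun w => (this.1 w).symm, this.2.symm⟩

theorem Agree.adj_iff (h : Agree ρ G G' inp inp' v) : G.Adj v w ↔ G'.Adj v w :=
  (h v (by simp)).1 w

theorem Agree.of_adj {l : ℕ} (h : Agree ρ G G' inp inp' v) (ha : G.Adj v u) (hl : l + 1 ≤ ρ) :
    Agree l G G' inp inp' u :=
  h.shift (m := 1) (by rw [SimpleGraph.edist_eq_one_iff_adj.2 ha]; simp) (by omega)

theorem Agree.low_iff : ∀ {d : ℕ} {v u : V}, Agree d G G' inp inp' v →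
    (Low G d v u ↔ Low G' d v u)
  | 0, _, _, _ => Iff.rfl
  | d + 1, v, u, h => by
    constructor
    · intro hl w ha hne
      have ha' := h.adj_iff.2 ha
      exact (h.of_adj ha' le_rfl).low_iff.1 (hl w ha' hne)
    · intro hl w ha hne
      exact (h.of_adj ha le_rfl).low_iff.2 (hl w (h.adj_iff.1 ha) hne)

theorem Agree.core_iff (h : Agree τ G G' inp inp' v) : Core G τ v ↔ Core G' τ v :=
  forall_congr' fun _ => imp_congr h.adj_iff (not_congr h.low_iff)

theorem Agree.isChain {e : ℕ} {c : ℤ → V} (h : Agree (τ + e + 1) G G' inp inp' v)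
    (hc : IsChain G τ e v c) : IsChain G' τ e v c := by
  have hd : ∀ i : ℤ, -e ≤ i → i ≤ e → G.edist v (c i) ≤ (e : ℕ∞) := fun i h1 h2 =>
    hc.edist_le (by omega) h1 h2
  refine ⟨hc.zero, fun i h1 h2 => ?_, fun i h1 h2 u => ?_, hc.ne⟩
  · exact (h.shift (l := τ) (hd i h1 h2) (by omega)).core_iff.1 (hc.core i h1 h2)
  · rw [← hc.nbr i h1 h2 u]
    have h' := h.shift (l := τ + 1) (hd i h1 h2) (by omega)
    constructor
    · rintro ⟨ha, hu⟩
      have ha' := h'.adj_iff.2 ha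
      exact ⟨ha', (h'.of_adj ha' le_rfl).core_iff.2 hu⟩
    · rintro ⟨ha, hu⟩
      exact ⟨h'.adj_iff.1 ha, (h'.of_adj ha le_rfl).core_iff.1 hu⟩

theorem Agree.isChain_iff {e : ℕ} {c : ℤ → V} (h : Agree (τ + e + 1) G G' inp inp' v) :
    IsChain G τ e v c ↔ IsChain G' τ e v c := ⟨h.isChain, h.symm.isChain⟩

theorem Agree.hang_subset (hτ : 1 ≤ τ) (h : Agree (τ + 1) G G' inp inp' v) (hv : Core G τ v) :
    hang G τ v ⊆ hang G' τ v := by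
  rintro w (rfl | ⟨m, y, hw⟩)
  · exact mem_hang_self _
  · refine Or.inr ⟨m, y, ?_⟩
    induction hw with
    | base ha hc =>
      exact .base (h.adj_iff.1 ha) fun hc' => hc ((h.of_adj ha le_rfl).core_iff.2 hc')
    | step hw ha hne ih =>
      obtain ⟨_, h2, _, _, h5, _⟩ := hw.spec hτ hv
      exact ih.step (((h _ (edist_le_mono h5 (by omega))).1 _).1 ha) hne

theorem Agree.hang_eq (hτ : 1 ≤ τ) (h : Agree (τ + 1) G G' inp inp' v) (hv : Core G τ v) :
    hang G τ v = hang G' τ v :=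
  Set.Subset.antisymm (h.hang_subset hτ hv)
    (h.symm.hang_subset hτ ((h.mono (by omega)).core_iff.1 hv))

theorem Agree.nodeOK_iff {P : LCL I O} {Δ : ℕ} {out : V → O}
    {x : V → V → EdgeLabel Δ (I × O) P.r} (h : Agree ρ G G' inp inp' v)
    (hu : G.edist v u ≤ (ρ : ℕ∞)) : NodeOK P Δ G inp out x u ↔ NodeOK P Δ G' inp' out x u :=
  (nodeOK_iff_of_bijOn (φ := id) (h.bijOn hu) (h u hu).2.symm rfl fun _ _ => ⟨rfl, rfl⟩).symm

theorem Agree.blockRel_eq {P : LCL I O} {Δ : ℕ} (hτ : 1 ≤ τ)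
    (h : Agree (τ + 1) G G' inp inp' v) (hv : Core G τ v) (y z : V) :
    BlockRel P Δ G inp τ v y z = BlockRel P Δ G' inp' τ v y z := by
  funext p q
  unfold BlockRel
  rw [← h.hang_eq hτ hv]
  refine propext (exists_congr fun out => exists_congr fun x => and_congr_left fun _ =>
    forall₂_congr fun w hw => ?_)
  exact h.nodeOK_iff (edist_le_mono (edist_le_of_mem_hang hτ hv hw) (by omega))

end Agree

section AgreeNat

variable {I O : Type*} {D : Params I O} {G G' : SimpleGraph ℕ} {inp inp' : ℕ → I} {v u w ρ : ℕ}
  {α : ℕ × Bool}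

theorem Agree.ruling_iff {τ e : ℕ} : ∀ {j v : ℕ}, Agree (τ + (j + 1) * e + 1) G G' inp inp' v →
    (Ruling G τ e j v ↔ Ruling G' τ e j v)
  | 0, v, h => exists_congr fun _ => (h.mono (by omega)).isChain_iff
  | j + 1, v, h => by
    have e1 : (j + 1 + 1) * e = (j + 1) * e + e := by ring
    have hu : ∀ u, G.edist v u ≤ (e : ℕ∞) → (Ruling G τ e j u ↔ Ruling G' τ e j u) := fun u hd =>
      (h.shift hd (by omega)).ruling_iff
    have hd : ∀ u, G'.edist v u ≤ (e : ℕ∞) ↔ G.edist v u ≤ (e : ℕ∞) := fun u =>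
      h.edist_le_iff (by omega)
    simp only [Ruling]
    refine and_congr (h.mono (by omega)).ruling_iff (or_congr Iff.rfl (forall_congr' fun u => ?_))
    constructor
    · intro h1 h2 h3
      rw [hd] at h3
      exact h1 ((hu u h3).2 h2) h3
    · intro h1 h2 h3
      exact h1 ((hu u h3).1 h2) ((hd u).2 h3)

theorem Agree.chainAt_eq {τ e : ℕ} (h : Agree (τ + e + 1) G G' inp inp' v) :
    chainAt G τ e v = chainAt G' τ e v := by
  unfold chainAt
  congr 1
  funext c
  exact propext h.isChain_iff

/-- The distance up to which the label of a cut edge depends on the network. -/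
def Params.armRadius (D : Params I O) : ℕ := D.τ + 2 * D.h + 4

theorem Agree.arm_eq (h : Agree D.armRadius G G' inp inp' α.1) :
    arm G D.τ D.h α = arm G' D.τ D.h α := by
  funext i
  unfold arm
  rw [(h.mono (by unfold Params.armRadius; omega)).chainAt_eq]

/-- Around the first nodes of an arm, the networks agree as well. -/
theorem Agree.arm (h : Agree D.armRadius G G' inp inp' α.1) (hα : IsArm G D.τ D.h D.b α) {s : ℕ}
    (hs : s ≤ D.h) : Agree (D.τ + 1) G G' inp inp' (arm G D.τ D.h α (-(s : ℤ))) :=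
  h.shift (hα.edist_le (by omega) (by omega)) (by unfold Params.armRadius; omega)

theorem Agree.nearWord_eq (hτ : 1 ≤ D.τ) (h : Agree D.armRadius G G' inp inp' α.1)
    (hα : IsArm G D.τ D.h D.b α) : nearWord D G inp α = nearWord D G' inp' α := by
  funext s
  unfold nearWord
  split_ifs with hs
  · rw [(h.arm hα hs.le).blockRel_eq hτ (hα.core_neg hs.le), h.arm_eq]
  · rfl

theorem Agree.pump_eq (hτ : 1 ≤ D.τ) (h : Agree D.armRadius G G' inp inp' α.1)
    (hα : IsArm G D.τ D.h D.b α) : pump D G inp α = pump D G' inp' α := by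
  unfold pump IsPump
  rw [h.nearWord_eq hτ hα]

theorem Agree.stripRoot_eq (hτ : 1 ≤ D.τ) (h : Agree D.armRadius G G' inp inp' α.1)
    (hα : IsArm G D.τ D.h D.b α) : stripRoot D G inp α = stripRoot D G' inp' α := by
  have h' : Agree D.armRadius G G' inp inp' (opp α).1 := h
  funext t
  unfold stripRoot
  rw [h.pump_eq hτ hα, h'.pump_eq hτ hα.opp, h.arm_eq, h'.arm_eq]

theorem exists_of_edist_stripGraph_le {V : Type*} {G : SimpleGraph V} {H : ℕ → Set V} {ρ : ℕ → V}
    (hρ : ∀ t, ρ t ∈ H t) {t : ℕ} {w : V} (hw : w ∈ H t) {m : ℕ} :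
    ∀ y, (stripGraph G H ρ).edist (t, w) y ≤ (m : ℕ∞) →
      t ≤ y.1 + m ∧ y.1 ≤ t + m ∧ y.2 ∈ H y.1 := by
  induction m with
  | zero =>
    intro y hy
    rw [edist_le_zero_iff] at hy
    subst hy
    exact ⟨by simp, by simp, hw⟩
  | succ m ih =>
    intro y hy
    rcases edist_le_succ_iff.1 hy with rfl | ⟨⟨t', w'⟩, hz, ha⟩
    · exact ⟨by simp, by simp, hw⟩
    · obtain ⟨t'', u⟩ := y
      obtain ⟨h1, h2, h3⟩ := ih _ hz
      dsimp only at h1 h2 h3 ⊢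
      rcases stripGraph_adj.1 ha with ⟨rfl, _, h5, h6⟩ | ⟨rfl, _, rfl⟩ | ⟨h, _, rfl⟩
      · exact ⟨by omega, by omega, h5⟩
      · exact ⟨by omega, by omega, hρ _⟩
      · exact ⟨by omega, by omega, hρ _⟩

/-- The labels of a cut edge depend only on the network near that edge. -/
theorem Agree.cutLabel_eq (hτ : 1 ≤ D.τ) (hp : ∀ α, IsPump D G inp α (pump D G inp α))
    (h : Agree D.armRadius G G' inp inp' v) (hv : IsArm G D.τ D.h D.b (v, true)) :
    cutLabel D G inp v = cutLabel D G' inp' v := by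
  have hl := halfLen_lt (D := D)
  have hroot := Agree.stripRoot_eq (α := (v, true)) hτ h hv
  -- the blocks of the strip agree
  have hH : ∀ t < 2 * D.halfLen, Core G D.τ (stripRoot D G inp (v, true) t) ∧
      Agree (D.τ + 1) G G' inp inp' (stripRoot D G inp (v, true) t) := by
    intro t ht
    obtain ⟨β, s, h1, h2, h3⟩ := exists_stripRoot_eq hp ht (α := (v, true))
    have hβ : IsArm G D.τ D.h D.b β := by unfold IsArm; rw [h1]; exact hv
    rw [h3]
    exact ⟨hβ.core_neg h2.le, Agree.arm (by rw [h1]; exact h) hβ h2.le⟩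
  have hHeq : ∀ t < 2 * D.halfLen, hang G D.τ (stripRoot D G inp (v, true) t) =
      hang G' D.τ (stripRoot D G' inp' (v, true) t) := by
    intro t ht
    rw [(hH t ht).2.hang_eq hτ (hH t ht).1, hroot]
  have hag : ∀ t < 2 * D.halfLen, ∀ w ∈ hang G D.τ (stripRoot D G inp (v, true) t),
      (∀ u, G.Adj w u ↔ G'.Adj w u) ∧ inp w = inp' w := fun t ht w hw =>
    (hH t ht).2 w (edist_le_mono (edist_le_of_mem_hang hτ (hH t ht).1 hw) (by omega))
  have hbij : ∀ t < 2 * D.halfLen, ∀ w ∈ hang G D.τ (stripRoot D G inp (v, true) t),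
      Set.BijOn id ((cutStrip D G inp v).neighborSet (t, w))
        ((cutStrip D G' inp' v).neighborSet (t, w)) := by
    intro t ht w hw
    have : (cutStrip D G inp v).neighborSet (t, w) =
        (cutStrip D G' inp' v).neighborSet (t, w) := by
      ext ⟨t', w'⟩
      simp only [SimpleGraph.mem_neighborSet, cutStrip, stripGraph_adj]
      rw [hHeq t ht, hroot, (hag t ht w hw).1 w']
    rw [this]
    exact Set.bijOn_id _
  have hmem : ∀ t, stripRoot D G inp (v, true) t ∈ hang G D.τ (stripRoot D G inp (v, true) t) :=
    fun t => mem_hang_self _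
  have hview : ∀ t w, w ∈ hang G D.τ (stripRoot D G inp (v, true) t) →
      t + D.T < 2 * D.halfLen →
      stripLabel D G' inp' v (t, w) = stripLabel D G inp v (t, w) := by
    intro t w hw ht
    unfold stripLabel
    dsimp only
    rw [(hag t (by omega) w hw).2]
    refine congrArg (fun z => (inp' w, D.A z))
      (localView_eq_of_bijOn (φ := id) fun y hy => ?_)
    obtain ⟨h1, h2, h3⟩ := exists_of_edist_stripGraph_le hmem hw y hy
    exact ⟨hbij y.1 (by omega) y.2 h3, rfl, ((hag y.1 (by omega) y.2 h3).2).symm⟩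
  have hmsg : ∀ t t', t ≤ D.halfLen →
      (cutStrip D G inp v).Adj (t, stripRoot D G inp (v, true) t)
        (t', stripRoot D G inp (v, true) t') →
      msgLabel D.Δ (cutStrip D G' inp' v) (stripLabel D G' inp' v) D.P.r
        (t, stripRoot D G inp (v, true) t) (t', stripRoot D G inp (v, true) t') =
      msgLabel D.Δ (cutStrip D G inp v) (stripLabel D G inp v) D.P.r
        (t, stripRoot D G inp (v, true) t) (t', stripRoot D G inp (v, true) t') := by
    intro t t' ht ha
    funext d
    have hd := d.2
    refine msg_eq_of_bijOn (φ := id) d _ _ (fun y hy => ?_) ha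
    obtain ⟨h1, h2, h3⟩ := exists_of_edist_stripGraph_le hmem (hmem t) y hy
    exact ⟨hbij y.1 (by omega) y.2 h3, hview y.1 y.2 h3 (by omega)⟩
  have hadj : (cutStrip D G inp v).Adj (D.halfLen - 1, stripRoot D G inp (v, true) (D.halfLen - 1))
      (D.halfLen, stripRoot D G inp (v, true) D.halfLen) :=
    stripGraph_adj.2 (Or.inr (Or.inl ⟨by omega, rfl, rfl⟩))
  unfold cutLabel
  rw [← hroot, hmsg _ _ (by omega) hadj, hmsg _ _ le_rfl hadj.symm]

theorem Agree.armLabel_eq (hτ : 1 ≤ D.τ) (hp : ∀ α, IsPump D G inp α (pump D G inp α))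
    (h : Agree D.armRadius G G' inp inp' α.1) (hα : IsArm G D.τ D.h D.b α) :
    armLabel D G inp α = armLabel D G' inp' α := by
  unfold armLabel
  rw [Agree.cutLabel_eq hτ hp h hα]

/-- The distance up to which the cutting depends on the network. -/
def Params.cutRadius (D : Params I O) : ℕ := D.τ + (D.b + 1) * (2 * D.h + 2) + 4

theorem armRadius_le_cutRadius : D.armRadius ≤ D.cutRadius := by
  have : 1 * (2 * D.h + 2) ≤ (D.b + 1) * (2 * D.h + 2) := Nat.mul_le_mul_right _ (by omega)
  unfold Params.armRadius Params.cutRadius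
  omega

theorem Agree.isArm_iff (h : Agree D.cutRadius G G' inp inp' α.1) :
    IsArm G D.τ D.h D.b α ↔ IsArm G' D.τ D.h D.b α :=
  (h.mono (by unfold Params.cutRadius; omega)).ruling_iff

theorem Agree.isCut (h : Agree (D.cutRadius + 1) G G' inp inp' u)
    (hc : IsCut G D.τ (2 * D.h + 2) D.b u w) : IsCut G' D.τ (2 * D.h + 2) D.b u w := by
  obtain ⟨α, hα, rfl, rfl⟩ := exists_arm_of_isCut hc
  have h' : Agree D.cutRadius G G' inp inp' α.1 := h.shift hα.edist_one_le (by omega)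
  rw [(h'.mono armRadius_le_cutRadius).arm_eq]
  exact (h'.isArm_iff.1 hα).isCut

theorem Agree.cutGraph_adj (h : Agree (D.cutRadius + 1) G G' inp inp' u)
    (ha : (cutGraph G D.τ (2 * D.h + 2) D.b).Adj u w) :
    (cutGraph G' D.τ (2 * D.h + 2) D.b).Adj u w :=
  ⟨h.adj_iff.1 ha.1, fun hc => ha.2 (h.symm.isCut hc)⟩

theorem Agree.reachable_cutGraph {K : ℕ} (h : Agree (K + (D.cutRadius + 1)) G G' inp inp' v)
    (hK : ∀ w, (cutGraph G D.τ (2 * D.h + 2) D.b).Reachable v w → G.edist v w ≤ (K : ℕ∞))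
    (hw : (cutGraph G D.τ (2 * D.h + 2) D.b).Reachable v w) :
    (cutGraph G' D.τ (2 * D.h + 2) D.b).Reachable v w := by
  have key : ∀ {u w}, (cutGraph G D.τ (2 * D.h + 2) D.b).Walk u w →
      (cutGraph G D.τ (2 * D.h + 2) D.b).Reachable v u →
      (cutGraph G' D.τ (2 * D.h + 2) D.b).Reachable u w := by
    intro u w p
    induction p with
    | nil => exact fun _ => .refl _
    | cons ha p ih =>
      intro hu
      exact ((h.shift (hK _ hu) le_rfl).cutGraph_adj ha).reachable.trans
        (ih (hu.trans ha.reachable))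
  obtain ⟨p⟩ := hw
  exact key p (.refl _)

/-- What counts as a solution on a component of diameter at most `K` depends only on the network up
to a distance slightly larger than `K`. -/
theorem Agree.isPieceSolution {K : ℕ} (hτ : 1 ≤ D.τ)
    (hp : ∀ α, IsPump D G inp α (pump D G inp α))
    (h : Agree (K + (D.cutRadius + 1)) G G' inp inp' v)
    (hK : ∀ w, (cutGraph G D.τ (2 * D.h + 2) D.b).Reachable v w → G.edist v w ≤ (K : ℕ∞))
    (hK' : ∀ w, (cutGraph G' D.τ (2 * D.h + 2) D.b).Reachable v w → G'.edist v w ≤ (K : ℕ∞))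
    {y : (ℕ → O) × (ℕ → ℕ → D.Label)} (hy : IsPieceSolution D G inp v y) :
    IsPieceSolution D G' inp' v y := by
  refine ⟨fun w hw => ?_, fun α hα hw => ?_⟩
  · have hw' := h.symm.reachable_cutGraph hK' hw
    exact (h.nodeOK_iff (edist_le_mono (hK w hw') (by omega))).1 (hy.1 w hw')
  · have hw' := h.symm.reachable_cutGraph hK' hw
    have h1 := (h.shift (hK _ hw') le_rfl)
    have h2 : Agree D.cutRadius G' G inp' inp α.1 := h1.symm.shift hα.edist_one_le (by omega)
    have h3 := h2.isArm_iff.1 hα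
    have h4 := h2.symm.mono armRadius_le_cutRadius
    rw [← h4.arm_eq, ← h4.armLabel_eq hτ hp h3]
    refine hy.2 α h3 ?_
    rw [h4.arm_eq]
    exact hw'

/-- The output of a node depends on its neighbourhood only. -/
theorem Agree.pieceSolution_eq [Nonempty I] [Nonempty O] {K : ℕ} (hτ : 1 ≤ D.τ)
    (hp : ∀ α, IsPump D G inp α (pump D G inp α))
    (hp' : ∀ α, IsPump D G' inp' α (pump D G' inp' α))
    (h : Agree (K + (D.cutRadius + 1)) G G' inp inp' v)
    (hK : ∀ w, (cutGraph G D.τ (2 * D.h + 2) D.b).Reachable v w → G.edist v w ≤ (K : ℕ∞))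
    (hK' : ∀ w, (cutGraph G' D.τ (2 * D.h + 2) D.b).Reachable v w → G'.edist v w ≤ (K : ℕ∞)) :
    pieceSolution D G inp v = pieceSolution D G' inp' v := by
  unfold pieceSolution
  congr 1
  funext y
  exact propext ⟨h.isPieceSolution hτ hp hK hK', h.symm.isPieceSolution hτ hp' hK' hK⟩

end AgreeNat

/-! ### The algorithm -/

section Final

/-- Nodes with the same view of radius `ρ + 1` have the same neighbourhoods up to distance `ρ`. -/
theorem agree_of_localView_eq {I : Type*} {G G' : SimpleGraph ℕ} {inp inp' : ℕ → I} {v : ℕ}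
    {ρ : ℕ} (h : localView G id inp (ρ + 1) v = localView G' id inp' (ρ + 1) v) :
    Agree ρ G G' inp inp' v := by
  have hnode := congrArg View.nodes h
  have hedge := congrArg View.edges h
  have hadj : ∀ {G G' : SimpleGraph ℕ} {inp inp' : ℕ → I},
      (localView G id inp (ρ + 1) v).edges = (localView G' id inp' (ρ + 1) v).edges →
      ∀ {u w}, G.edist v u ≤ (ρ : ℕ∞) → G.Adj u w → G'.Adj u w := by
    intro G G' inp inp' he u w hu ha
    have hm : ((u, w) : ℕ × ℕ) ∈ (localView G id inp (ρ + 1) v).edges :=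
      ⟨u, w, ha, Or.inl (edist_lt_natCast_succ_iff.2 hu), rfl⟩
    rw [he] at hm
    obtain ⟨u', w', ha', _, hp⟩ := hm
    obtain ⟨rfl, rfl⟩ := Prod.mk.inj hp
    exact ha'
  have hdist : ∀ m ≤ ρ, ∀ u, G.edist v u ≤ (m : ℕ∞) → G'.edist v u ≤ (m : ℕ∞) := by
    intro m
    induction m with
    | zero => intro _ u hu; rwa [edist_le_zero_iff] at hu ⊢
    | succ m ih =>
      intro hm u hu
      rcases edist_le_succ_iff.1 hu with rfl | ⟨y, hy, ha⟩
      · simp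
      · exact edist_le_of_adj (ih (by omega) y hy) (hadj hedge (edist_le_mono hy (by omega)) ha)
  intro u hu
  refine ⟨fun w => ⟨hadj hedge hu, hadj hedge.symm (hdist ρ le_rfl u hu)⟩, ?_⟩
  have hm : (u, (G.neighborSet u).ncard, inp u) ∈ (localView G id inp (ρ + 1) v).nodes :=
    ⟨u, edist_le_mono hu (by omega), rfl⟩
  rw [hnode] at hm
  obtain ⟨u', _, hp⟩ := hm
  simp only [Prod.mk.injEq] at hp
  obtain ⟨rfl, _, hp⟩ := hp
  exact hp

section Transport

variable {I O : Type*} {V : Type} {T : SimpleGraph V} {ident : V ↪ ℕ}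

theorem bijOn_map (u : V) : Set.BijOn ident (T.neighborSet u)
    ((T.map ident).neighborSet (ident u)) := by
  refine ⟨fun w hw => (SimpleGraph.map_adj _ _ _ _).2 ⟨u, w, hw, rfl, rfl⟩,
    ident.injective.injOn, fun a ha => ?_⟩
  obtain ⟨u', w, h, h1, rfl⟩ := (SimpleGraph.map_adj _ _ _ _).1 ha
  obtain rfl := ident.injective h1
  exact ⟨w, h, rfl⟩

theorem isAcyclic_map (hT : T.IsTree) : (T.map ident).IsAcyclic := by
  have : Nonempty V := hT.connected.nonempty
  have r := Classical.arbitrary V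
  refine isAcyclic_of_rank (fun a => T.dist r (Function.invFun ident a)) ?_
  intro x y y' h h' hd hd'
  obtain ⟨u, w, ha, rfl, rfl⟩ := (SimpleGraph.map_adj _ _ _ _).1 h
  obtain ⟨u', w', ha', h1, rfl⟩ := (SimpleGraph.map_adj _ _ _ _).1 h'
  obtain rfl := ident.injective h1
  simp only [Function.leftInverse_invFun ident.injective _] at hd hd'
  rw [eq_of_adj_of_dist_le hT.isAcyclic (hT.connected r u') ha ha' hd hd']

theorem mem_range_of_map_reachable {v : V} {a : ℕ}
    (h : (T.map ident).Reachable (ident v) a) : ∃ w, ident w = a := by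
  by_cases e : a = ident v
  · exact ⟨v, e.symm⟩
  · obtain ⟨y, hy, -⟩ := exists_adj_dist_lt h e
    obtain ⟨u, _, _, h1, _⟩ := (SimpleGraph.map_adj _ _ _ _).1 hy
    exact ⟨u, h1⟩

theorem encard_neighborSet_map {Δ : ℕ} (hΔ : ∀ v, (T.neighborSet v).encard ≤ (Δ : ℕ∞)) (a : ℕ) :
    ((T.map ident).neighborSet a).encard ≤ (Δ : ℕ∞) := by
  by_cases h : ∃ v, ident v = a
  · obtain ⟨v, rfl⟩ := h
    rw [← (bijOn_map v).image_eq, (bijOn_map v).injOn.encard_image]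
    exact hΔ v
  · have : (T.map ident).neighborSet a = ∅ := by
      ext b
      simp only [SimpleGraph.mem_neighborSet, SimpleGraph.map_adj, Set.mem_empty_iff_false,
        iff_false]
      rintro ⟨u, _, _, h1, _⟩
      exact h ⟨u, h1⟩
    rw [this]
    simp

end Transport

section Pieces

variable {G : SimpleGraph ℕ} {τ e b q : ℕ}

/-- A bound for the diameter of the pieces. -/
theorem edist_le_of_reachable_cutGraph (hτ : 1 ≤ τ) (hG : G.IsAcyclic) {S : Finset ℕ}
    (hS : ∀ u w, G.Adj u w → u ∈ S) (hq : S.card < q * (τ + 1)) {v w : ℕ}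
    (h : (cutGraph G τ e b).Reachable v w) :
    G.edist v w ≤ ((2 * (τ + b * e + e + 2) + (2 * e + 1) * q : ℕ) : ℕ∞) := by
  obtain ⟨s, h0, h1, hs⟩ := exists_nonBacktracking h
  have hL := length_lt_of_nonBacktracking_cutGraph hτ hG hS hs hq
  have hsG : NonBacktracking G s ((cutGraph G τ e b).dist v w) :=
    ⟨fun i hi => (hs.1 i hi).1, hs.2⟩
  have := hsG.edist_le _ le_rfl
  rw [h0, h1] at this
  exact edist_le_mono this hL.le

end Pieces

variable {I O : Type*}

/-- The parameters for networks with `n` nodes, where the given algorithm is run as on networks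
with `N` nodes. The value of `b` ensures `n ^ k < 2 ^ b`. -/
def gapParams (P : LCL I O) (Δ k h : ℕ) (A : LocalAlgorithm I O) (t : ℕ → ℕ) (N n : ℕ) :
    Params I O where
  P := P
  Δ := Δ
  τ := n.sqrt + 1
  h := h
  b := 2 * (n.sqrt + 1) * k
  T := t N
  A := A N

/-- The bound for the diameter of the pieces of a network with `n` nodes. -/
def pieceRadius (D : Params I O) (n : ℕ) : ℕ :=
  2 * (D.τ + D.b * (2 * D.h + 2) + (2 * D.h + 2) + 2) + (2 * (2 * D.h + 2) + 1) * (n.sqrt + 1)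

/-- A node of a network to which the construction applies. -/
def IsSuitable (D : Params I O) (n : ℕ) (y : SimpleGraph ℕ × (ℕ → I) × ℕ) : Prop :=
  Admissible y.1 D.Δ D.τ D.h D.b ∧
    ∀ w, (cutGraph y.1 D.τ (2 * D.h + 2) D.b).Reachable y.2.2 w →
      y.1.edist y.2.2 w ≤ (pieceRadius D n : ℕ∞)

/-- The number of rounds of the new algorithm. -/
def gapRounds (D : Params I O) (n : ℕ) : ℕ := pieceRadius D n + (D.cutRadius + 1) + 1

/-- A node in a network that accounts for a given view. -/
noncomputable def guess [Nonempty I] (D : Params I O) (n : ℕ) (ω : View I) :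
    SimpleGraph ℕ × (ℕ → I) × ℕ :=
  Classical.epsilon fun y => IsSuitable D n y ∧
    localView y.1 id y.2.1 (gapRounds D n) y.2.2 = ω

/-- The output that belongs to a view: that of the construction in any network that accounts for
the view. -/
noncomputable def gapOutput [Nonempty I] [Nonempty O] (D : Params I O) (n : ℕ) (ω : View I) : O :=
  (pieceSolution D (guess D n ω).1 (guess D n ω).2.1 (guess D n ω).2.2).1 (guess D n ω).2.2

/-- Any two networks that account for the same view lead to the same output. -/
theorem gapOutput_localView [Nonempty I] [Nonempty O] {D : Params I O} {n : ℕ}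
    (hp : ∀ G inp α, IsPump D G inp α (pump D G inp α)) {G : SimpleGraph ℕ} {inp : ℕ → I} {v : ℕ}
    (h : IsSuitable D n (G, inp, v)) :
    gapOutput D n (localView G id inp (gapRounds D n) v) = (pieceSolution D G inp v).1 v := by
  obtain ⟨h1, h2⟩ : IsSuitable D n (guess D n (localView G id inp (gapRounds D n) v)) ∧
      localView (guess D n (localView G id inp (gapRounds D n) v)).1 id
        (guess D n (localView G id inp (gapRounds D n) v)).2.1 (gapRounds D n)
        (guess D n (localView G id inp (gapRounds D n) v)).2.2 =
      localView G id inp (gapRounds D n) v :=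
    Classical.epsilon_spec (p := fun y => IsSuitable D n y ∧
      localView y.1 id y.2.1 (gapRounds D n) y.2.2 = localView G id inp (gapRounds D n) v)
      ⟨(G, inp, v), h, rfl⟩
  unfold gapOutput
  generalize guess D n (localView G id inp (gapRounds D n) v) = y at h1 h2 ⊢
  obtain ⟨G', inp', v'⟩ := y
  obtain rfl : v' = v := congrArg View.center h2
  dsimp only at h2 ⊢
  rw [(agree_of_localView_eq h2).pieceSolution_eq h.1.one_le_τ (hp G' inp') (hp G inp) h1.2 h.2]

/-- Identifiers of networks with `n` nodes have `O(√n)` digits. Although `O(log n)` digits would do,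
this suffices: each digit costs a constant number of rounds. -/
theorem lt_two_pow_mul (n k : ℕ) (hk : 1 ≤ k) : n ^ k < 2 ^ (2 * (n.sqrt + 1) * k) := by
  rw [pow_mul]
  refine Nat.pow_lt_pow_left ?_ (by omega)
  calc n < (n.sqrt + 1) * (n.sqrt + 1) := Nat.lt_succ_sqrt n
    _ ≤ 2 ^ (n.sqrt + 1) * 2 ^ (n.sqrt + 1) :=
      Nat.mul_le_mul Nat.lt_two_pow_self.le Nat.lt_two_pow_self.le
    _ = 2 ^ (2 * (n.sqrt + 1)) := by rw [← pow_add]; congr 1; ring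

/-- An algorithm that is fast on networks of one large size yields an algorithm for networks with
`n` nodes. -/
theorem isValid_gapOutput [Nonempty I] [Nonempty O] {P : LCL I O} {Δ k h N : ℕ} (hk : 1 ≤ k)
    (hh : 1 ≤ h) {A : LocalAlgorithm I O} {t : ℕ → ℕ}
    (hA : P.SolvedBy (treesOfDegreeAtMost Δ) k A t) {V : Type} [Fintype V] {T : SimpleGraph V}
    (hT : treesOfDegreeAtMost Δ V T) {ident : V → ℕ} (hid : IsIdentAssignment k ident)
    {D : Params I O} (hD : D = gapParams P Δ k h A t N (Fintype.card V))
    (hp : ∀ G inp α, IsPump D G inp α (pump D G inp α))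
    (hN : (2 * D.halfLen + 2) * 2 ^ D.b * 2 ^ D.b ≤ N) (inp : V → I) :
    P.IsValid T inp (fun v => gapOutput D (Fintype.card V)
      (localView T ident inp (gapRounds D (Fintype.card V)) v)) := by
  set n := Fintype.card V with hn
  let f : V ↪ ℕ := ⟨ident, hid.1⟩
  let inpN : ℕ → I := Function.extend ident inp fun _ => Classical.arbitrary I
  have hinp : ∀ v, inpN (f v) = inp v := fun v => hid.1.extend_apply _ _ v
  have hb := fun v => bijOn_map (T := T) (ident := f) v
  have hadm : Admissible (T.map f) D.Δ D.τ D.h D.b := by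
    subst hD
    refine ⟨isAcyclic_map hT.1, encard_neighborSet_map hT.2, by simp [gapParams], hh, ?_⟩
    intro a b ha
    obtain ⟨u, _, _, rfl, _⟩ := (SimpleGraph.map_adj _ _ _ _).1 ha
    exact ⟨(hid.2 u).1, lt_of_le_of_lt (hid.2 u).2 (lt_two_pow_mul n k hk)⟩
  have hsuit : ∀ v, IsSuitable D n (T.map f, inpN, f v) := by
    intro v
    refine ⟨hadm, fun w hw => ?_⟩
    refine edist_le_of_reachable_cutGraph (S := Finset.univ.map f) hadm.one_le_τ hadm.acyclic
      (fun a b ha => ?_) ?_ hw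
    · obtain ⟨u, _, _, rfl, _⟩ := (SimpleGraph.map_adj _ _ _ _).1 ha
      exact Finset.mem_map_of_mem _ (Finset.mem_univ _)
    · rw [Finset.card_map, Finset.card_univ, ← hn]
      subst hD
      calc n < (n.sqrt + 1) * (n.sqrt + 1) := Nat.lt_succ_sqrt n
        _ ≤ (n.sqrt + 1) * (n.sqrt + 1 + 1) := Nat.mul_le_mul_left _ (by omega)
  have hview : ∀ v, localView (T.map f) id inpN (gapRounds D n) (f v) =
      localView T ident inp (gapRounds D n) v := fun v =>
    localView_eq_of_bijOn fun u _ => ⟨hb u, rfl, hinp u⟩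
  -- the given algorithm provides a solution on the whole tree
  have hval := hA V T hT ident hid inp
  have : Nonempty V := hT.1.connected.nonempty
  have hleft := Function.leftInverse_invFun f.injective
  have hsol : ∀ v, ∃ (out : ℕ → O) (x : ℕ → ℕ → EdgeLabel Δ (I × O) P.r),
      ∀ w, (T.map f).Reachable (f v) w → NodeOK P Δ (T.map f) inpN out x w := by
    intro v
    have hok := nodeOK_of_isValid hT.1 hT.2 hval
    refine ⟨fun a => A n (localView T ident inp (t n) (Function.invFun f a)),
      fun a b => msgLabel Δ T (fun u => (inp u, A n (localView T ident inp (t n) u))) P.r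
        (Function.invFun f a) (Function.invFun f b), fun a ha => ?_⟩
    obtain ⟨w, rfl⟩ := mem_range_of_map_reachable ha
    refine (nodeOK_iff_of_bijOn (hb w) (hinp w) ?_ fun u _ => ?_).2 (hok w)
    · simp only [hleft w]; rfl
    · simp only [hleft w, hleft u]
      exact ⟨rfl, rfl⟩
  have hpiece : ∀ a ∈ Set.range f, ∃ y, IsPieceSolution D (T.map f) inpN a y := by
    rintro _ ⟨v, rfl⟩
    refine hadm.exists_isPieceSolution (N := N) (A := A) (t := t) (k := k) (hp _ _) hk hN ?_ ?_ ?_ ?_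
    all_goals subst hD
    · exact hA
    · rfl
    · rfl
    · exact hsol v
  obtain ⟨x, hx⟩ := exists_nodeOK_pieceSolution hpiece
  have hPD : ∃ x', ∀ v, NodeOK P Δ T inp (fun v => gapOutput D n
      (localView T ident inp (gapRounds D n) v)) x' v := by
    have hout : ∀ v, (pieceSolution D (T.map f) inpN (f v)).1 (f v) =
        gapOutput D n (localView T ident inp (gapRounds D n) v) := fun v => by
      rw [← hview, gapOutput_localView hp (hsuit v)]
    subst hD
    exact ⟨fun u w => x (f u) (f w), fun v => (nodeOK_iff_of_bijOn (hb v) (hinp v) (hout v)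
      fun u _ => ⟨rfl, rfl⟩).1 (hx _ ⟨v, rfl⟩)⟩
  obtain ⟨x', hx'⟩ := hPD
  exact isValid_of_nodeOK hT.1 hT.2 hx'

theorem exists_mul_add_le {t : ℕ → ℕ}
    (ht : (fun n : ℕ => (t n : ℝ)) =o[atTop] (fun n : ℕ => (n : ℝ))) (a c : ℕ) :
    ∃ N, a * t N + c ≤ N := by
  have h1 := (isLittleO_iff.1 ht) (c := 1 / (2 * (a + 1))) (by positivity)
  obtain ⟨N, h2, h3⟩ := (h1.and (eventually_ge_atTop (2 * c))).exists
  refine ⟨N, ?_⟩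
  simp only [Real.norm_natCast] at h2
  have h4 : (2 * c : ℝ) ≤ N := by exact_mod_cast h3
  have h5 : (a : ℝ) * t N ≤ N / 2 := by
    calc (a : ℝ) * t N ≤ (a + 1) * (1 / (2 * (a + 1)) * N) := by gcongr; simp
      _ = N / 2 := by field_simp
  have : (a : ℝ) * t N + c ≤ N := by linarith
  exact_mod_cast this

/-- There is a size `N` for which the networks with strips long enough for `t N` rounds have at most
`N` nodes. The size may be huge compared to `n`. -/
theorem exists_size {P : LCL I O} {Δ k h : ℕ} {A : LocalAlgorithm I O} {t : ℕ → ℕ}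
    (ht : (fun n : ℕ => (t n : ℝ)) =o[atTop] (fun n : ℕ => (n : ℝ))) (n : ℕ) :
    ∃ N, (2 * (gapParams P Δ k h A t N n).halfLen + 2) * 2 ^ (gapParams P Δ k h A t N n).b *
      2 ^ (gapParams P Δ k h A t N n).b ≤ N := by
  set Y := 2 ^ (2 * (n.sqrt + 1) * k) * 2 ^ (2 * (n.sqrt + 1) * k) with hY
  obtain ⟨N, hN⟩ := exists_mul_add_le ht (2 * h.factorial * Y)
    ((2 * (h + (P.r + 3) * h.factorial) + 2) * Y)
  refine ⟨N, le_trans (le_of_eq ?_) hN⟩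
  simp only [gapParams, Params.halfLen]
  rw [mul_assoc, ← hY]
  ring

theorem gapRounds_isBigO {P : LCL I O} {Δ k h : ℕ} {A : LocalAlgorithm I O} {t N : ℕ → ℕ} :
    (fun n : ℕ => (gapRounds (gapParams P Δ k h A t (N n) n) n : ℝ)) =O[atTop]
      (fun n : ℕ => Real.sqrt (n : ℝ)) := by
  obtain ⟨C, hC⟩ : ∃ C : ℕ, ∀ n, gapRounds (gapParams P Δ k h A t (N n) n) n ≤
      C * (n.sqrt + 1) := by
    refine ⟨2 * (1 + 2 * k * (2 * h + 2) + (2 * h + 2) + 2) + (2 * (2 * h + 2) + 1) +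
      (1 + (2 * k + 1) * (2 * h + 2) + 4) + 2, fun n => ?_⟩
    simp only [gapRounds, pieceRadius, Params.cutRadius, gapParams]
    generalize n.sqrt = s
    nlinarith [Nat.zero_le (s * h), Nat.zero_le s]
  refine IsBigO.of_bound (2 * C) ?_
  filter_upwards [eventually_ge_atTop 1] with n hn
  have h1 : (1 : ℝ) ≤ Real.sqrt n := Real.one_le_sqrt.2 (by exact_mod_cast hn)
  have h2 : (n.sqrt : ℝ) ≤ Real.sqrt n := Real.nat_sqrt_le_real_sqrt
  rw [Real.norm_natCast, Real.norm_of_nonneg (Real.sqrt_nonneg _)]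
  calc (gapRounds (gapParams P Δ k h A t (N n) n) n : ℝ) ≤ (C * (n.sqrt + 1) : ℕ) := by
        exact_mod_cast hC n
    _ = C * ((n.sqrt : ℝ) + 1) := by push_cast; ring
    _ ≤ C * (2 * Real.sqrt n) := by gcongr; linarith
    _ = 2 * C * Real.sqrt n := by ring

theorem solvableIn_sqrt [Finite I] [Finite O] (P : LCL I O) (Δ k : ℕ) (hk : 1 ≤ k) (t : ℕ → ℕ)
    (ht : (fun n : ℕ => (t n : ℝ)) =o[atTop] (fun n : ℕ => (n : ℝ)))
    (hP : P.SolvableIn (treesOfDegreeAtMost Δ) k t) :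
    ∃ s : ℕ → ℕ, (fun n : ℕ => (s n : ℝ)) =O[atTop] (fun n : ℕ => Real.sqrt (n : ℝ)) ∧
      P.SolvableIn (treesOfDegreeAtMost Δ) k s := by
  obtain ⟨A, hA⟩ := hP
  have hO : Nonempty O := ⟨A 0 ⟨0, ∅, ∅⟩⟩
  rcases isEmpty_or_nonempty I with hI | hI
  · -- there are no input labellings at all
    refine ⟨fun _ => 0, by simpa using isBigO_zero _ _, A, fun V _ T hT ident _ inp => ?_⟩
    have : Nonempty V := hT.1.connected.nonempty
    exact hI.elim (inp (Classical.arbitrary V))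
  · let L := EdgeLabel Δ (I × O) P.r × EdgeLabel Δ (I × O) P.r
    -- pumping needs at least as many blocks as there are relations, and at least one block
    let h := Nat.card (L → L → Prop) + 1
    choose N hN using fun n => exists_size (P := P) (Δ := Δ) (k := k) (h := h) (A := A) ht n
    refine ⟨fun n => gapRounds (gapParams P Δ k h A t (N n) n) n, gapRounds_isBigO,
      fun n => gapOutput (gapParams P Δ k h A t (N n) n) n, fun V _ T hT ident hid inp => ?_⟩
    exact isValid_gapOutput hk (Nat.le_add_left 1 _) hA hT hid rfl
      (fun G inp α => isPump_pump (Nat.le_succ _) α) (hN _) inp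

end Final

end TreeGap

theorem mainTheorem1 {I O : Type*} [Finite I] [Finite O] (P : LCL I O) (Δ k : ℕ) (hk : 1 ≤ k) :
    (∀ t : ℕ → ℕ,
      (fun n : ℕ => (t n : ℝ)) =o[atTop] (fun n : ℕ => (n : ℝ)) →
      P.SolvableIn (treesOfDegreeAtMost Δ) k t →
      ∃ s : ℕ → ℕ,
        (fun n : ℕ => (s n : ℝ)) =O[atTop] (fun n : ℕ => Real.sqrt (n : ℝ)) ∧
        P.SolvableIn (treesOfDegreeAtMost Δ) k s) ∧
    ¬ ∃ t : ℕ → ℕ, P.HasComplexity (treesOfDegreeAtMost Δ) k t ∧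
      (fun n : ℕ => Real.sqrt (n : ℝ)) =o[atTop] (fun n : ℕ => (t n : ℝ)) ∧
      (fun n : ℕ => (t n : ℝ)) =o[atTop] (fun n : ℕ => (n : ℝ)) := by
  refine ⟨TreeGap.solvableIn_sqrt P Δ k hk, ?_⟩
  rintro ⟨t, ht, h1, h2⟩
  obtain ⟨s, hs, hP⟩ := TreeGap.solvableIn_sqrt P Δ k hk t h2 ht.1
  have hle : (fun n : ℕ => (t n : ℝ)) =O[atTop] (fun n : ℕ => (s n : ℝ)) :=
    IsBigO.of_bound 1 (Eventually.of_forall fun n => by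
      simpa using ht.2 hP n)
  have hirr := h1.trans_isBigO (hle.trans hs)
  refine isLittleO_irrefl (Eventually.frequently ?_) hirr
  filter_upwards [eventually_ge_atTop 1] with n hn
  exact (Real.sqrt_pos.2 (by exact_mod_cast hn)).ne'
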